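/- **Theorem 2.** Let $\Lambda$ be an even unimodular positive definite lattice of rank $m$, that is, a free abelian group of rank $m$ with a positive definite symmetric integral bilinear form $(x,y)$ for which $\Lambda$ coincides with its dual and $Q(x)=\tfrac12(x,x)$ is an integer for all $x\in\Lambda$. Assume that all automorphisms of $\Lambda$ have determinant $+1$. Let $E=\Lambda/2\Lambda$, with the quadratic form $q(a+2\Lambda)=Q(a)\bmod 2$ with values in $\mathbf Z/2\mathbf Z$. Choose a basis $e_1,\dots,e_m$ of $E$ with $q(\sum x_ie_i)=\sum_{j=1}^{m/2}x_jx_{m/2+j}$; the Dickson invariant of an element of the orthogonal group $O(E)$ with matrix $\begin{pmatrix}A&B\\C&D\end{pmatrix}$ is $\operatorname{tr}(C^{t}B)\in\mathbf Z/2\mathbf Z$. A subspace of $E$ is isotropic if $q$ vanishes on it. Fix a maximal isotropic subspace $F_0$ of $E$. For subspaces $F\subset E$ put $\epsilon(F)=0$ if $F$ is not maximal isotropic, $\epsilon(F)=1$ if $F$ is maximal isotropic and in the orbit of $F_0$ under the kernel of the Dickson invariant, and $\epsilon(F)=-1$ for all other maximal isotropic $F$. For $n\ge 0$ and $g=(g_1,\dots,g_n)\in\Lambda^n$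 let $T(g)=((g_i,g_j))_{i,j}$, let $F(g)$ be the image of $\mathbf Zg_1+\dots+\mathbf Zg_n$ in $E$, and, for $Z$ in the Siegel upper half space $\mathbf H_n$, let $$f^{(n)}(Z)=\sum_{g\in\Lambda^n}\epsilon(F(g))\exp\Bigl(\frac{\pi i}{2}\operatorname{tr}(T(g)Z)\Bigr).$$ For an even lattice $L$ let $\vartheta_L(Z)=\sum_{g\in L^n}\exp(\pi i\operatorname{tr}(T(g)Z))$. For a maximal isotropic $F\subset E$ let the perestroika $\Lambda_F$ be the inverse image of $F$ in $\Lambda$ with the bilinear form $\tfrac12(x,y)$, and let $\operatorname{Aut}(\Lambda,F)$ be the group of automorphisms of $\Lambda$ that preserve $F$. Let $(\Lambda_i)_{i}$ be a system of representatives of the isomorphism classes of even unimodular positive definite lattices of rank $m$, and put $$\operatorname{mass}^\epsilon(i)=\sum_{F:\ \Lambda_F\cong\Lambda_i}\frac{\epsilon(F)}{\#\operatorname{Aut}(\Lambda,F)},$$ where $F$ runs over a system of representatives of the $\operatorname{Aut}(\Lambda)$-orbits of maximal isotropic subspaces of $E$ with $\Lambda_F\cong\Lambda_i$. Then all these series converge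 absolutely on $\mathbf H_n$, only finitely many $\operatorname{mass}^\epsilon(i)$ are nonzero, and for all $n\ge 0$ and $Z\in\mathbf H_n$ $$f^{(n)}(Z)=\#\operatorname{Aut}(\Lambda)\sum_{i}\operatorname{mass}^\epsilon(i)\,\vartheta_{\Lambda_i}(Z).$$ Each $f^{(n)}$ is a Siegel modular form of degree $n$ and weight $m/2$ for the full modular group $\operatorname{Sp}(2n,\mathbf Z)$. It vanishes identically for $n<m/2$, and it is a cusp form (it is annihilated by the Siegel operator $\Phi$) for $n=m/2$. -/

import Mathlib

open scoped Matrix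

universe u

noncomputable section

/-! ### Reduction modulo two of an abelian group -/

/-- The group `M / 2M`. -/
abbrev ModTwo (M : Type*) [AddCommGroup M] : Type _ :=
  M ⧸ (nsmulAddMonoidHom (α := M) 2).range

/-- `M / 2M` as a vector space over the field with two elements. -/
instance ModTwo.instModule (M : Type*) [AddCommGroup M] : Module (ZMod 2) (ModTwo M) :=
  QuotientAddGroup.zmodModule fun x => ⟨x, rfl⟩

/-- The projection `M → M / 2M`. -/
def ModTwo.proj (M : Type*) [AddCommGroup M] : M →+ ModTwo M :=
  QuotientAddGroup.mk' _

/-- The endomorphism of `M / 2M` induced by an endomorphism of `M`. -/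
def ModTwo.map {M : Type*} [AddCommGroup M] (φ : M →+ M) : ModTwo M →ₗ[ZMod 2] ModTwo M :=
  (QuotientAddGroup.map _ _ φ (by rintro _ ⟨x, rfl⟩; exact ⟨φ x, by simp⟩) :
    ModTwo M →+ ModTwo M).toZModLinearMap 2

/-! ### Quadratic spaces over the field with two elements -/

section QuadraticSpace

variable {E : Type*} [AddCommGroup E] [Module (ZMod 2) E]

/-- A subspace on which the quadratic form vanishes. -/
def IsIsotropic (q : QuadraticForm (ZMod 2) E) (F : Submodule (ZMod 2) E) : Prop :=
  ∀ x ∈ F, q x = 0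

/-- Maximal isotropic subspaces: maximal, for inclusion, among the isotropic subspaces. -/
def IsMaximalIsotropic (q : QuadraticForm (ZMod 2) E) (F : Submodule (ZMod 2) E) : Prop :=
  Maximal (IsIsotropic q) F

/-- A basis in which `q (∑ xᵢ eᵢ) = ∑ⱼ xⱼ x_{k+j}`. -/
def IsHyperbolicBasis (q : QuadraticForm (ZMod 2) E) {k : ℕ}
    (e : Module.Basis (Fin k ⊕ Fin k) (ZMod 2) E) : Prop :=
  ∀ x, q x = ∑ j, e.repr x (Sum.inl j) * e.repr x (Sum.inr j)

open Classical in
/-- The Dickson invariant of an element of the orthogonal group `O(E)`: if the element has block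
matrix `(A B; C D)` in a hyperbolic basis, it is `trace (Cᵀ B)`. The value does not depend on the
hyperbolic basis. (The value `0` when there is no hyperbolic basis is a placeholder.) -/
def dicksonInvariant (q : QuadraticForm (ZMod 2) E) (g : q.IsometryEquiv q) : ZMod 2 :=
  if h : ∃ e : Module.Basis (Fin (Module.finrank (ZMod 2) E / 2) ⊕
      Fin (Module.finrank (ZMod 2) E / 2)) (ZMod 2) E, IsHyperbolicBasis q e then
    let M := LinearMap.toMatrix h.choose h.choose (g.toLinearEquiv : E →ₗ[ZMod 2] E)
    (M.toBlocks₂₁ᵀ * M.toBlocks₁₂).trace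
  else 0

/-- `F` is in the orbit of `F₀` under the kernel of the Dickson invariant. -/
def SameDicksonOrbit (q : QuadraticForm (ZMod 2) E) (F₀ F : Submodule (ZMod 2) E) : Prop :=
  ∃ g : q.IsometryEquiv q, dicksonInvariant q g = 0 ∧
    F₀.map (g.toLinearEquiv : E →ₗ[ZMod 2] E) = F

open Classical in
/-- The sign function `ε`, where the orbit of the maximal isotropic subspace `F₀` is the one that
is selected as the first orbit: `ε` is `1` on the first orbit, `-1` on the other maximal isotropic
subspaces, and `0` on subspaces which are not maximal isotropic. -/
def dicksonSign (q : QuadraticForm (ZMod 2) E) (F₀ F : Submodule (ZMod 2) E) : ℤ :=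
  if IsMaximalIsotropic q F then (if SameDicksonOrbit q F₀ F then 1 else -1) else 0

end QuadraticSpace

/-! ### Even positive definite lattices -/

/-- An even positive definite lattice: a free abelian group of finite rank with a positive
definite symmetric integral bilinear form such that all `(x, x)` are even. -/
structure EvenLattice : Type (u + 1) where
  carrier : Type u
  [addCommGroup : AddCommGroup carrier]
  [free : Module.Free ℤ carrier]
  [finite : Module.Finite ℤ carrier]
  form : LinearMap.BilinForm ℤ carrier
  symm : ∀ x y, form x y = form y x
  pos : ∀ x, x ≠ 0 → 0 < form x x
  even : ∀ x, Even (form x x)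

namespace EvenLattice

instance : CoeSort EvenLattice.{u} (Type u) := ⟨carrier⟩

attribute [instance] addCommGroup free finite

variable (Λ : EvenLattice.{u})

/-- The rank of the lattice. -/
def rank : ℕ := Module.finrank ℤ Λ

/-- The lattice coincides with its dual. -/
def IsUnimodular : Prop :=
  Function.Bijective (Λ.form : Λ → (Λ →ₗ[ℤ] ℤ))

/-- The integral quadratic form `Q(x) = (x, x) / 2`. -/
def Q (x : Λ) : ℤ := Λ.form x x / 2

theorem two_mul_Q (x : Λ) : 2 * Λ.Q x = Λ.form x x :=
  Int.mul_ediv_cancel' (Λ.even x).two_dvd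

theorem Q_add (x y : Λ) : Λ.Q (x + y) = Λ.Q x + Λ.Q y + Λ.form x y := by
  have h1 := Λ.two_mul_Q (x + y)
  have h2 := Λ.two_mul_Q x
  have h3 := Λ.two_mul_Q y
  have h4 := Λ.symm x y
  simp only [map_add, LinearMap.add_apply] at h1
  linarith

theorem Q_two_nsmul (x : Λ) : Λ.Q (2 • x) = 4 * Λ.Q x := by
  rw [two_nsmul, Q_add, ← two_mul_Q]; ring

theorem Q_zero : Λ.Q 0 = 0 := by simp [Q]

/-- The function `Λ / 2Λ → ℤ / 2ℤ`, `a + 2Λ ↦ Q(a) mod 2`. -/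
def qFun : ModTwo Λ → ZMod 2 :=
  Quotient.lift (fun a : Λ => (Λ.Q a : ZMod 2)) (by
    intro a b hab
    obtain ⟨c, hc⟩ := QuotientAddGroup.leftRel_apply.mp hab
    have hb : b = a + 2 • c := by
      simp only [nsmulAddMonoidHom_apply] at hc
      rw [hc]; abel
    have h2 : (2 : ZMod 2) = 0 := rfl
    have h4 : (4 : ZMod 2) = 0 := rfl
    simp [hb, Q_add, Q_two_nsmul, h2, h4])

theorem qFun_proj (a : Λ) : Λ.qFun (ModTwo.proj Λ a) = (Λ.Q a : ZMod 2) := rfl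

theorem polar_qFun_proj (a b : Λ) :
    QuadraticMap.polar Λ.qFun (ModTwo.proj Λ a) (ModTwo.proj Λ b) = (Λ.form a b : ZMod 2) := by
  simp only [QuadraticMap.polar, ← map_add, qFun_proj, Q_add, Int.cast_add]
  ring

/-- The quadratic form `q` on `E = Λ / 2Λ`, with `q(a + 2Λ) = Q(a) mod 2`. -/
def q : QuadraticForm (ZMod 2) (ModTwo Λ) :=
  QuadraticMap.ofPolar Λ.qFun
    (by
      intro a x
      have h0 : Λ.qFun 0 = 0 := by
        rw [← map_zero (ModTwo.proj Λ), qFun_proj, Q_zero, Int.cast_zero]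
      fin_cases a
      · change Λ.qFun ((0 : ZMod 2) • x) = ((0 : ZMod 2) * 0) • Λ.qFun x
        rw [zero_smul, h0, mul_zero, zero_smul]
      · change Λ.qFun ((1 : ZMod 2) • x) = ((1 : ZMod 2) * 1) • Λ.qFun x
        rw [one_smul, mul_one, one_smul])
    (by
      intro x x' y
      obtain ⟨a, rfl⟩ := QuotientAddGroup.mk'_surjective _ x
      obtain ⟨a', rfl⟩ := QuotientAddGroup.mk'_surjective _ x'
      obtain ⟨b, rfl⟩ := QuotientAddGroup.mk'_surjective _ y
      change QuadraticMap.polar Λ.qFun (ModTwo.proj Λ a + ModTwo.proj Λ a') (ModTwo.proj Λ b) =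
        QuadraticMap.polar Λ.qFun (ModTwo.proj Λ a) (ModTwo.proj Λ b) +
        QuadraticMap.polar Λ.qFun (ModTwo.proj Λ a') (ModTwo.proj Λ b)
      rw [← map_add, polar_qFun_proj, polar_qFun_proj, polar_qFun_proj]
      simp)
    (by
      intro a x y
      have h0 : Λ.qFun 0 = 0 := by
        rw [← map_zero (ModTwo.proj Λ), qFun_proj, Q_zero, Int.cast_zero]
      fin_cases a
      · change QuadraticMap.polar Λ.qFun ((0 : ZMod 2) • x) y =
          (0 : ZMod 2) • QuadraticMap.polar Λ.qFun x y
        rw [zero_smul, zero_smul, QuadraticMap.polar, zero_add, h0, sub_zero, sub_self]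
      · change QuadraticMap.polar Λ.qFun ((1 : ZMod 2) • x) y =
          (1 : ZMod 2) • QuadraticMap.polar Λ.qFun x y
        rw [one_smul, one_smul])

theorem q_proj (a : Λ) : Λ.q (ModTwo.proj Λ a) = (Λ.Q a : ZMod 2) := rfl

/-- Isomorphism of lattices. -/
def Iso (L L' : EvenLattice.{u}) : Prop :=
  ∃ φ : L ≃ₗ[ℤ] L', ∀ x y, L'.form (φ x) (φ y) = L.form x y

/-- The automorphism group `Aut(Λ)`. -/
def Aut : Subgroup (Λ ≃ₗ[ℤ] Λ) where
  carrier := {σ | ∀ x y, Λ.form (σ x) (σ y) = Λ.form x y}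
  mul_mem' {σ τ} hσ hτ x y := by
    rw [LinearEquiv.mul_apply, LinearEquiv.mul_apply, hσ, hτ]
  one_mem' _ _ := rfl
  inv_mem' {σ} hσ x y := by
    rw [← hσ (σ⁻¹ x) (σ⁻¹ y), ← LinearEquiv.mul_apply, ← LinearEquiv.mul_apply,
      mul_inv_cancel]
    rfl

/-- The image `σ F` of a subspace `F` of `Λ / 2Λ` under an automorphism `σ` of `Λ`. -/
def translate (σ : Λ ≃ₗ[ℤ] Λ) (F : Submodule (ZMod 2) (ModTwo Λ)) :
    Submodule (ZMod 2) (ModTwo Λ) :=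
  F.map (ModTwo.map (σ : Λ →+ Λ))

/-- The order of the group `Aut(Λ, F)` of all automorphisms of `Λ` which preserve `F`. -/
def cardAutPair (F : Submodule (ZMod 2) (ModTwo Λ)) : ℕ :=
  Nat.card {σ : Λ.Aut // Λ.translate σ F = F}

/-- `R` is a system of representatives of the `Aut(Λ)`-orbits of maximal isotropic subspaces. -/
def IsOrbitRepresentatives (R : Finset (Submodule (ZMod 2) (ModTwo Λ))) : Prop :=
  (∀ F ∈ R, IsMaximalIsotropic Λ.q F) ∧
    ∀ F, IsMaximalIsotropic Λ.q F → ∃! F' : Submodule (ZMod 2) (ModTwo Λ),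
      F' ∈ R ∧ ∃ σ ∈ Λ.Aut, Λ.translate σ F' = F

/-- The inverse image of `F` under the projection `Λ → Λ / 2Λ`. -/
def preimage (F : Submodule (ZMod 2) (ModTwo Λ)) : Submodule ℤ Λ :=
  AddSubgroup.toIntSubmodule (F.toAddSubgroup.comap (ModTwo.proj Λ))

variable {Λ} in
theorem even_Q_of_isIsotropic {F : Submodule (ZMod 2) (ModTwo Λ)} (hF : IsIsotropic Λ.q F)
    (x : Λ.preimage F) : (2 : ℤ) ∣ Λ.Q x := by
  have h := hF _ (show ModTwo.proj Λ x ∈ F from x.2)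
  rw [q_proj] at h
  exact_mod_cast (ZMod.intCast_zmod_eq_zero_iff_dvd _ 2).mp h

variable {Λ} in
theorem even_form_of_isIsotropic {F : Submodule (ZMod 2) (ModTwo Λ)} (hF : IsIsotropic Λ.q F)
    (x y : Λ.preimage F) : (2 : ℤ) ∣ Λ.form x y := by
  have h1 := even_Q_of_isIsotropic hF x
  have h2 := even_Q_of_isIsotropic hF y
  have h3 := even_Q_of_isIsotropic hF (x + y)
  have h4 := Λ.Q_add x y
  rw [Submodule.coe_add] at h3
  omega

/-- The perestroika `Λ_F`: the inverse image of the isotropic subspace `F` in `Λ`, with the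
bilinear form `(x, y) / 2`, that is, with the quadratic form `Q / 2`. -/
def perestroika (F : Submodule (ZMod 2) (ModTwo Λ)) (hF : IsIsotropic Λ.q F) :
    EvenLattice.{u} where
  carrier := Λ.preimage F
  form := LinearMap.mk₂ ℤ (fun x y => Λ.form x y / 2)
    (fun x x' y => by
      rw [Submodule.coe_add, map_add, LinearMap.add_apply,
        Int.add_ediv_of_dvd_left (even_form_of_isIsotropic hF x y)])
    (fun c x y => by
      rw [Submodule.coe_smul, map_smul, LinearMap.smul_apply, smul_eq_mul, smul_eq_mul,
        Int.mul_ediv_assoc _ (even_form_of_isIsotropic hF x y)])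
    (fun x y y' => by
      rw [Submodule.coe_add, map_add, Int.add_ediv_of_dvd_left (even_form_of_isIsotropic hF x y)])
    (fun c x y => by
      rw [Submodule.coe_smul, map_smul, smul_eq_mul, smul_eq_mul,
        Int.mul_ediv_assoc _ (even_form_of_isIsotropic hF x y)])
  symm x y := by simp only [LinearMap.mk₂_apply, Λ.symm x y]
  pos x hx := by
    have h1 := Λ.pos x (by simpa using hx)
    have h2 := even_form_of_isIsotropic hF x x
    simp only [LinearMap.mk₂_apply]
    omega
  even x := (even_iff_two_dvd.mpr (even_Q_of_isIsotropic hF x) :)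

open Classical in
/-- The modified mass of `L`, the sum of `ε(F) / #Aut(Λ, F)` over those `F` in the system `R` of
representatives of `Aut(Λ)`-orbits of maximal isotropic subspaces for which `Λ_F ≅ L`. -/
def modifiedMass (ε : Submodule (ZMod 2) (ModTwo Λ) → ℤ)
    (R : Finset (Submodule (ZMod 2) (ModTwo Λ))) (L : EvenLattice.{u}) : ℚ :=
  ∑ F ∈ R with ∃ hF : IsIsotropic Λ.q F, (Λ.perestroika F hF).Iso L,
    (ε F : ℚ) / (Λ.cardAutPair F : ℚ)

/-- `L` is a system of representatives of the isomorphism classes of even unimodular positive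
definite lattices of rank `m`. -/
def IsClassRepresentatives (m : ℕ) {ι : Type*} (L : ι → EvenLattice.{u}) : Prop :=
  (∀ i, (L i).IsUnimodular ∧ (L i).rank = m) ∧
    ∀ L' : EvenLattice.{u}, L'.IsUnimodular → L'.rank = m → ∃! i, L'.Iso (L i)

/-! ### Theta series -/

/-- The Gram matrix `T(g) = ((gᵢ, gⱼ))`. -/
def gram {n : ℕ} (g : Fin n → Λ) : Matrix (Fin n) (Fin n) ℤ :=
  Matrix.of fun i j => Λ.form (g i) (g j)

/-- `F(g)`, the image of `ℤ g₁ + ⋯ + ℤ gₙ` in `Λ / 2Λ`. -/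
def spanModTwo {n : ℕ} (g : Fin n → Λ) : Submodule (ZMod 2) (ModTwo Λ) :=
  Submodule.span (ZMod 2) (Set.range fun i => ModTwo.proj Λ (g i))

/-- The term `exp (π i σ(T(g) Z))` of the theta series. -/
def thetaTerm {n : ℕ} (Z : Matrix (Fin n) (Fin n) ℂ) (g : Fin n → Λ) : ℂ :=
  Complex.exp (Real.pi * Complex.I * ((Λ.gram g).map (Int.cast : ℤ → ℂ) * Z).trace)

/-- The theta series of degree `n`. -/
def theta (n : ℕ) (Z : Matrix (Fin n) (Fin n) ℂ) : ℂ :=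
  ∑' g : Fin n → Λ, Λ.thetaTerm Z g

/-- The term `ε(F(g)) exp ((π i / 2) σ(T(g) Z))` of the twisted theta series. -/
def twistedThetaTerm (ε : Submodule (ZMod 2) (ModTwo Λ) → ℤ) {n : ℕ}
    (Z : Matrix (Fin n) (Fin n) ℂ) (g : Fin n → Λ) : ℂ :=
  (ε (Λ.spanModTwo g) : ℂ) *
    Complex.exp (Real.pi * Complex.I / 2 * ((Λ.gram g).map (Int.cast : ℤ → ℂ) * Z).trace)

/-- The twisted theta series `f^(n)` of degree `n`. -/
def twistedTheta (ε : Submodule (ZMod 2) (ModTwo Λ) → ℤ) (n : ℕ)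
    (Z : Matrix (Fin n) (Fin n) ℂ) : ℂ :=
  ∑' g : Fin n → Λ, Λ.twistedThetaTerm ε Z g

end EvenLattice

/-! ### Siegel modular forms for the full modular group -/

/-- The Siegel upper half space of degree `n`: complex symmetric matrices with positive definite
imaginary part. -/
def siegelUpperHalfSpace (n : ℕ) : Set (Matrix (Fin n) (Fin n) ℂ) :=
  {Z | Z.IsSymm ∧ (Z.map Complex.im).PosDef}

/-- The automorphy factor matrix `C Z + D` for `M = (A B; C D)`. -/
def siegelDenom {n : ℕ} (M : Matrix (Fin n ⊕ Fin n) (Fin n ⊕ Fin n) ℤ)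
    (Z : Matrix (Fin n) (Fin n) ℂ) : Matrix (Fin n) (Fin n) ℂ :=
  M.toBlocks₂₁.map (Int.cast : ℤ → ℂ) * Z + M.toBlocks₂₂.map (Int.cast : ℤ → ℂ)

/-- The action `M Z = (A Z + B) (C Z + D)⁻¹` for `M = (A B; C D)`. -/
def siegelAction {n : ℕ} (M : Matrix (Fin n ⊕ Fin n) (Fin n ⊕ Fin n) ℤ)
    (Z : Matrix (Fin n) (Fin n) ℂ) : Matrix (Fin n) (Fin n) ℂ :=
  (M.toBlocks₁₁.map (Int.cast : ℤ → ℂ) * Z + M.toBlocks₁₂.map (Int.cast : ℤ → ℂ)) *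
    (siegelDenom M Z)⁻¹

/-- Siegel modular forms of degree `n` and weight `k` for the full modular group `Sp(2n, ℤ)`.
The half space is a relatively open subset of the space of symmetric matrices, and
differentiability within it is holomorphy in the entries on and above the diagonal. Boundedness in
the domains `Im Z ≥ Y₀ > 0` is regularity at the cusps; it is a condition for `n = 1` and
automatic for `n ≥ 2`. -/
structure IsSiegelModularForm (n k : ℕ) (f : Matrix (Fin n) (Fin n) ℂ → ℂ) : Prop where
  holomorphic : DifferentiableOn ℂ f (siegelUpperHalfSpace n)
  transform : ∀ M ∈ Matrix.symplecticGroup (Fin n) ℤ, ∀ Z ∈ siegelUpperHalfSpace n,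
    f (siegelAction M Z) = (siegelDenom M Z).det ^ k * f Z
  bounded : ∀ Y₀ : Matrix (Fin n) (Fin n) ℝ, Y₀.PosDef → ∃ c : ℝ,
    ∀ Z ∈ siegelUpperHalfSpace n, (Z.map Complex.im - Y₀).PosSemidef → ‖f Z‖ ≤ c

/-- The block diagonal matrix of degree `n + 1` with blocks `Z` and `i t`. -/
def siegelExtend {n : ℕ} (Z : Matrix (Fin n) (Fin n) ℂ) (t : ℝ) :
    Matrix (Fin (n + 1)) (Fin (n + 1)) ℂ :=
  Matrix.reindex finSumFinEquiv finSumFinEquiv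
    (Matrix.fromBlocks Z 0 0 (Matrix.of fun _ _ : Fin 1 => Complex.I * t))

/-- Cusp forms: Siegel modular forms `f` of degree `n` with `Φ f = 0`, where `Φ` is the Siegel
operator `(Φ f)(Z) = lim_{t → ∞} f (Z 0; 0 i t)` with values in degree `n - 1`; in degree `0`
there is no condition. -/
def IsSiegelCuspForm (n k : ℕ) (f : Matrix (Fin n) (Fin n) ℂ → ℂ) : Prop :=
  IsSiegelModularForm n k f ∧
    match n, f with
    | 0, _ => True
    | n + 1, f => ∀ Z ∈ siegelUpperHalfSpace n,
        Filter.Tendsto (fun t : ℝ => f (siegelExtend Z t)) Filter.atTop (nhds 0)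

end

/-! The twisted series is a signed sum of ordinary theta series. The point is that the sum of ε(F)
over all F containing a given subspace F₁ equals ε(F₁) (`sum_dicksonSign`). If F₁ is isotropic but
not maximal, some v orthogonal to F₁ has q(v) = 1; the transvection in v fixes F₁ pointwise, so it
permutes the maximal isotropic F ⊇ F₁, and it exchanges the two orbits because its Dickson invariant
is 1. The signs therefore cancel. Applied to F₁ = F(g), this gives f = ∑ ε(F) ϑ(Λ_F) over the
finitely many F (`twistedTheta_eq_sum`): the condition F(g) ⊆ F says that all gᵢ lie in the inverse
image of F, and the extra factor 1/2 in the exponent is the rescaled form of Λ_F. Grouping the F by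
Aut(Λ)-orbits and then by the class of Λ_F yields the identity with the masses, provided that ε is
constant on orbits.

Three facts carry the argument.

A maximal isotropic subspace is its own orthogonal complement. This needs the Gauss sum G = ∑
(-1)^q(x) to be positive (`IsMaximalIsotropic.isLagrangian`). Elementary counting gives only G² =
2^m. The sign comes from the one-variable theta function: its value at 1/2 + i/(4t) is related to
that at 1/2 + it once through the modular group and once by Poisson summation over the cosets of 2Λ,
and the comparison gives G = 2^(m/2) (`quadraticGaussSum_pos`). Then Λ_F is unimodular of rank m,
and dim F = m/2.

An automorphism of determinant 1 has trivial Dickson invariant (`dicksonInvariant_modTwoIsometry`),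
so ε is constant on Aut(Λ)-orbits. The determinant is read modulo 4: the automorphism is compared
with a symplectic matrix over ℤ/4, whose determinant is 1, and the discrepancy is a matrix 1 + 2Y
with det = 1 + 2 tr Y, where tr Y mod 2 turns out to be the Dickson invariant
(`dicksonTrace_eq_zero_of_det_eq_one`).

The theta series of an even unimodular lattice is modular (`EvenLattice.theta_transform`). The
integral symplectic group is generated by shears, block diagonal matrices and quarter turns in one
coordinate plane; a quarter turn amounts to Poisson summation in a single lattice vector. The eighth
roots of unity disappear because the relation (ST)³ = ±1 forces (-i)^(m/2) = 1.

Since dim F = m/2, fewer than m/2 vectors never span a maximal isotropic space, hence the vanishing.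
For n = m/2 every term with nonzero sign has a nonzero last vector, so it decays under the Siegel
operator. -/

/-! ### Gauss sums of quadratic forms over the field with two elements -/

/-- The nontrivial additive character of the field with two elements. -/
def signChar (a : ZMod 2) : ℤ := if a = 0 then 1 else -1

theorem signChar_add : ∀ a b : ZMod 2, signChar (a + b) = signChar a * signChar b := by decide

theorem signChar_zero : signChar 0 = 1 := rfl

theorem signChar_one : signChar 1 = -1 := rfl

theorem ZMod.two_eq_zero_or_one : ∀ a : ZMod 2, a = 0 ∨ a = 1 := by decide

theorem ZMod.two_eq_one_of_ne_zero : ∀ {a : ZMod 2}, a ≠ 0 → a = 1 := by decide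

/-- Translation by a permutes the summands and multiplies the sum by -1. -/
theorem sum_signChar_eq_zero {A : Type*} [AddCommGroup A] [Fintype A] (f : A →+ ZMod 2)
    {a : A} (ha : f a ≠ 0) : ∑ x, signChar (f x) = 0 := by
  have h := Equiv.sum_comp (Equiv.addRight a) fun x => signChar (f x)
  simp only [Equiv.coe_addRight, map_add, signChar_add, ZMod.two_eq_one_of_ne_zero ha,
    signChar_one, mul_neg_one, Finset.sum_neg_distrib] at h
  omega

section QuadraticSpace

open QuadraticMap

variable {E : Type*} [AddCommGroup E] [Module (ZMod 2) E] (q : QuadraticForm (ZMod 2) E)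

theorem map_add_eq_polar (x y : E) : q (x + y) = q x + q y + polar q x y := by
  simp only [polar]; ring

theorem add_self_eq_zero_of_zmod_two (x : E) : x + x = 0 := by
  rw [← two_smul (ZMod 2) x, show (2 : ZMod 2) = 0 from rfl, zero_smul]

theorem polar_self_eq_zero (x : E) : polar q x x = 0 := by
  rw [polar_self, two_smul]
  exact CharTwo.add_self_eq_zero _

/-- The orthogonal complement for the polar form. -/
def polarPerp (F : Submodule (ZMod 2) E) : Submodule (ZMod 2) E where
  carrier := {x | ∀ y ∈ F, polar q x y = 0}
  add_mem' {a b} ha hb y hy := by rw [polar_add_left, ha y hy, hb y hy, add_zero]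
  zero_mem' y _ := by simp
  smul_mem' c x hx y hy := by rw [polar_smul_left, hx y hy, smul_zero]

variable {q}

theorem IsIsotropic.polar_eq_zero {F : Submodule (ZMod 2) E} (hF : IsIsotropic q F) {x y : E}
    (hx : x ∈ F) (hy : y ∈ F) : polar q x y = 0 := by
  rw [polar, hF _ (F.add_mem hx hy), hF x hx, hF y hy]; simp

theorem IsIsotropic.le_polarPerp {F : Submodule (ZMod 2) E} (hF : IsIsotropic q F) :
    F ≤ polarPerp q F := fun _ hx _ hy => hF.polar_eq_zero hx hy

variable (q) in
/-- Isotropic subspaces which contain their orthogonal complement. -/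
structure IsLagrangian (F : Submodule (ZMod 2) E) : Prop where
  isIsotropic : IsIsotropic q F
  polarPerp_le : polarPerp q F ≤ F

theorem IsLagrangian.isMaximalIsotropic {F : Submodule (ZMod 2) E} (hF : IsLagrangian q F) :
    IsMaximalIsotropic q F :=
  ⟨hF.1, fun _ hF' hle _ hx => hF.2 fun _ hy => hF'.polar_eq_zero hx (hle hy)⟩

/-- Adjoining such an x to F produces another isotropic subspace. -/
theorem IsMaximalIsotropic.mem_of_polarPerp {F : Submodule (ZMod 2) E}
    (hF : IsMaximalIsotropic q F) {x : E} (hx : x ∈ polarPerp q F) (hqx : q x = 0) : x ∈ F := by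
  have h : IsIsotropic q (F ⊔ Submodule.span (ZMod 2) {x}) := by
    intro z hz
    obtain ⟨y, hy, w, hw, rfl⟩ := Submodule.mem_sup.mp hz
    obtain ⟨c, rfl⟩ := Submodule.mem_span_singleton.mp hw
    rw [map_add_eq_polar, hF.1 y hy, QuadraticMap.map_smul, hqx, polar_comm, polar_smul_left,
      hx y hy]
    simp
  exact hF.2 h le_sup_left (Submodule.mem_sup_right (Submodule.mem_span_singleton_self x))

variable (q) in
/-- The Gauss sum of a quadratic form. -/
def quadraticGaussSum [Fintype E] : ℤ := ∑ x, signChar (q x)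

variable (q) in
/-- The polar form with a vector as an additive map. -/
def polarHom (y : E) : E →+ ZMod 2 :=
  AddMonoidHom.mk' (fun x => polar q x y) fun a b => polar_add_left q a b y

theorem sum_signChar_polar [Fintype E] (hq : ∀ x, (∀ y, polar q x y = 0) → x = 0)
    [DecidableEq E] (y : E) :
    ∑ x, signChar (polar q x y) = if y = 0 then (Fintype.card E : ℤ) else 0 := by
  split_ifs with hy
  · simp [hy, signChar_zero]
  · have : ∃ x, polar q x y ≠ 0 := by
      by_contra! h
      exact hy (hq y fun x => by rw [polar_comm]; exact h x)
    obtain ⟨x, hx⟩ := this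
    exact sum_signChar_eq_zero (polarHom q y) hx

theorem sum_signChar_polar_submodule [Fintype E] (F : Submodule (ZMod 2) E) [Fintype F]
    [DecidablePred (· ∈ polarPerp q F)] (x : E) :
    ∑ y : F, signChar (polar q x y) = if x ∈ polarPerp q F then (Fintype.card F : ℤ) else 0 := by
  split_ifs with hx
  · simp [hx _ (Subtype.coe_prop _), signChar_zero]
  · have : ∃ y : F, polar q x y ≠ 0 := by
      by_contra! h
      exact hx fun y hy => h ⟨y, hy⟩
    obtain ⟨y, hy⟩ := this
    simp_rw [polar_comm q x] at hy ⊢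
    exact sum_signChar_eq_zero ((polarHom q x).comp F.subtype.toAddMonoidHom) hy

/-- Replace the second summation variable by x + y: since q(x) + q(x + y) equals q(y) plus the polar
form of x and y, the sum over x is a character sum, which nondegeneracy kills unless y = 0. -/
theorem quadraticGaussSum_sq [Fintype E] (hq : ∀ x, (∀ y, polar q x y = 0) → x = 0) :
    quadraticGaussSum q ^ 2 = Fintype.card E := by
  classical
  have h1 : ∀ x, ∑ y, signChar (q y) = ∑ y, signChar (q (x + y)) := fun x =>
    (Equiv.sum_comp (Equiv.addLeft x) fun y => signChar (q y)).symm
  calc quadraticGaussSum q ^ 2 = ∑ x, signChar (q x) * ∑ y, signChar (q y) := by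
        rw [pow_two, quadraticGaussSum, Finset.sum_mul]
    _ = ∑ x, ∑ y, signChar (q y) * signChar (polar q x y) := by
        refine Finset.sum_congr rfl fun x _ => ?_
        rw [h1 x, Finset.mul_sum]
        refine Finset.sum_congr rfl fun y _ => ?_
        rw [← signChar_add, ← signChar_add, map_add_eq_polar]
        congr 1
        linear_combination CharTwo.add_self_eq_zero (q x)
    _ = ∑ y, signChar (q y) * ∑ x, signChar (polar q x y) := by
        rw [Finset.sum_comm]; simp_rw [Finset.mul_sum]
    _ = Fintype.card E := by
        simp [sum_signChar_polar hq, signChar_zero]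

/-- Sum (-1)^(x, y) over x in E and y in F in both orders: summing over y first detects the
complement of F, summing over x first detects y = 0. -/
theorem card_mul_card_polarPerp [Fintype E] (hq : ∀ x, (∀ y, polar q x y = 0) → x = 0)
    (F : Submodule (ZMod 2) E) : Nat.card F * Nat.card (polarPerp q F) = Fintype.card E := by
  classical
  have h1 : ∑ x : E, ∑ y : F, signChar (polar q x y) =
      (Nat.card F * Nat.card (polarPerp q F) : ℕ) := by
    simp_rw [sum_signChar_polar_submodule]
    rw [← Finset.sum_filter, Finset.sum_const, Nat.card_eq_fintype_card, Nat.card_eq_fintype_card,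
      Fintype.card_subtype (· ∈ polarPerp q F), nsmul_eq_mul]
    push_cast; ring
  have h2 : ∑ x : E, ∑ y : F, signChar (polar q x y) = Fintype.card E := by
    rw [Finset.sum_comm]
    simp_rw [sum_signChar_polar hq]
    simp
  exact_mod_cast h1.symm.trans h2

/-- The Gauss sum is unchanged by translating x by y in F, which inserts the factor (-1)^(x, y);
averaging over F leaves only x orthogonal to F. -/
theorem IsIsotropic.quadraticGaussSum_eq [Fintype E] {F : Submodule (ZMod 2) E}
    (hF : IsIsotropic q F) [DecidablePred (· ∈ polarPerp q F)] :
    quadraticGaussSum q = ∑ x with x ∈ polarPerp q F, signChar (q x) := by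
  classical
  have h1 : ∀ y : F, quadraticGaussSum q = ∑ x, signChar (q x) * signChar (polar q x y) := by
    intro y
    rw [quadraticGaussSum, ← Equiv.sum_comp (Equiv.addRight (y : E))]
    refine Finset.sum_congr rfl fun x _ => ?_
    rw [Equiv.coe_addRight, map_add_eq_polar, hF y y.2, add_zero, signChar_add]
  have h2 : (Fintype.card F : ℤ) * quadraticGaussSum q =
      Fintype.card F * ∑ x with x ∈ polarPerp q F, signChar (q x) := by
    calc (Fintype.card F : ℤ) * quadraticGaussSum q
        = ∑ y : F, ∑ x, signChar (q x) * signChar (polar q x y) := by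
          rw [← Finset.sum_congr rfl fun y _ => h1 y]; simp
      _ = _ := by
          rw [Finset.sum_comm]
          simp_rw [← Finset.mul_sum, sum_signChar_polar_submodule]
          rw [Finset.mul_sum, Finset.sum_filter]
          refine Finset.sum_congr rfl fun x _ => ?_
          split_ifs <;> ring
  exact mul_left_cancel₀ (by exact_mod_cast Fintype.card_ne_zero) h2

/-- If the Gauss sum is positive, maximal isotropic subspaces are Lagrangian. -/
theorem IsMaximalIsotropic.isLagrangian [Fintype E]
    (hq : ∀ x, (∀ y, polar q x y = 0) → x = 0) (hG : 0 < quadraticGaussSum q)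
    {F : Submodule (ZMod 2) E} (hF : IsMaximalIsotropic q F) : IsLagrangian q F := by
  classical
  refine ⟨hF.1, ?_⟩
  -- Inside the complement of F the zeros of q are exactly F, by maximality, so the signs are +1 on
  -- F and -1 on the rest.
  have h1 : quadraticGaussSum q = 2 * Nat.card F - Nat.card (polarPerp q F) := by
    have h3 : ∀ x ∈ Finset.univ.filter (· ∈ polarPerp q F),
        signChar (q x) = 2 * (if x ∈ F then 1 else 0) - 1 := by
      intro x hx
      rw [Finset.mem_filter] at hx
      split_ifs with hxF
      · rw [hF.1 x hxF]; rfl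
      · rw [ZMod.two_eq_one_of_ne_zero fun h => hxF (hF.mem_of_polarPerp hx.2 h)]; rfl
    rw [IsIsotropic.quadraticGaussSum_eq hF.1, Finset.sum_congr rfl h3, Finset.sum_sub_distrib,
      ← Finset.mul_sum, ← Finset.sum_filter, Finset.filter_filter,
      Finset.filter_congr (q := (· ∈ F)) fun x _ => and_iff_right_of_imp fun h =>
        IsIsotropic.le_polarPerp hF.1 h]
    simp [Fintype.card_subtype]
  have h2 := card_mul_card_polarPerp hq F
  have h3 := quadraticGaussSum_sq hq
  rw [← h2] at h3
  have hle : Nat.card F ≤ Nat.card (polarPerp q F) :=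
    Nat.card_mono (Set.toFinite _) (IsIsotropic.le_polarPerp hF.1)
  push_cast at h3
  -- With a = #F and b the order of its complement, (2a - b)² = ab factors in this way. The root b =
  -- 4a would give the Gauss sum -2a, contrary to positivity.
  have h4 : ((Nat.card (polarPerp q F) : ℤ) - Nat.card F) *
      (Nat.card (polarPerp q F) - 4 * Nat.card F) = 0 := by
    rw [h1] at h3
    linear_combination h3
  have h5 : Nat.card (polarPerp q F) = Nat.card F := by
    rcases mul_eq_zero.mp h4 with h | h
    · omega
    · omega
  have h6 : (F : Set E) = polarPerp q F :=
    Set.eq_of_subset_of_ncard_le (IsIsotropic.le_polarPerp hF.1) h5.le (Set.toFinite _)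
  exact (SetLike.coe_injective h6).ge

theorem IsLagrangian.polarPerp_eq {F : Submodule (ZMod 2) E} (hF : IsLagrangian q F) :
    polarPerp q F = F := le_antisymm hF.2 hF.1.le_polarPerp

theorem IsLagrangian.two_mul_finrank [Fintype E]
    (hq : ∀ x, (∀ y, polar q x y = 0) → x = 0)
    {F : Submodule (ZMod 2) E} (hF : IsLagrangian q F) :
    2 * Module.finrank (ZMod 2) F = Module.finrank (ZMod 2) E := by
  have h := card_mul_card_polarPerp hq F
  rw [hF.polarPerp_eq, ← Nat.card_eq_fintype_card,
    Module.natCard_eq_pow_finrank (K := ZMod 2) (V := F),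
    Module.natCard_eq_pow_finrank (K := ZMod 2) (V := E), Nat.card_zmod, ← pow_add] at h
  have := Nat.pow_right_injective le_rfl h
  omega

/-! ### Transvections -/

variable (q) in
/-- The orthogonal transvection attached to a vector `v` with `q v = 1`. -/
def orthogonalTransvection (v : E) (hv : q v = 1) : q.IsometryEquiv q where
  toLinearEquiv := LinearEquiv.ofInvolutive
    { toFun := fun x => x + polar q x v • v
      map_add' := fun x y => by rw [polar_add_left, add_smul]; abel
      map_smul' := fun c x => by simp [polar_smul_left, smul_smul, smul_add] }
    (fun x => by
      simp only [LinearMap.coe_mk, AddHom.coe_mk, polar_add_left, polar_smul_left,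
        polar_self_eq_zero, smul_zero, add_zero]
      rw [add_assoc, add_self_eq_zero_of_zmod_two, add_zero])
  map_app' x := by
    change q (x + polar q x v • v) = q x
    rw [map_add_eq_polar, QuadraticMap.map_smul, hv, polar_smul_right]
    rcases ZMod.two_eq_zero_or_one (polar q x v) with h | h <;> rw [h] <;> simp
    rw [add_assoc, CharTwo.add_self_eq_zero, add_zero]

theorem orthogonalTransvection_apply {v : E} (hv : q v = 1) (x : E) :
    orthogonalTransvection q v hv x = x + polar q x v • v := rfl

theorem polar_isometryEquiv (g : q.IsometryEquiv q) (x y : E) :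
    polar q (g x) (g y) = polar q x y := by
  simp only [polar, ← map_add, g.map_app]

theorem IsLagrangian.map {F : Submodule (ZMod 2) E} (hF : IsLagrangian q F)
    (g : q.IsometryEquiv q) : IsLagrangian q (F.map (g.toLinearEquiv : E →ₗ[ZMod 2] E)) := by
  constructor
  · rintro _ ⟨x, hx, rfl⟩
    exact (g.map_app x).trans (hF.1 x hx)
  · intro x hx
    refine ⟨g.symm x, hF.2 fun y hy => ?_, g.apply_symm_apply x⟩
    rw [← polar_isometryEquiv g, g.apply_symm_apply]
    exact hx _ ⟨y, hy, rfl⟩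

/-- The orthogonal group acts transitively on Lagrangian subspaces. -/
theorem IsLagrangian.exists_isometryEquiv_map_eq [Fintype E]
    (hq : ∀ x, (∀ y, polar q x y = 0) → x = 0) {F F' : Submodule (ZMod 2) E}
    (hF : IsLagrangian q F) (hF' : IsLagrangian q F') :
    ∃ g : q.IsometryEquiv q, F.map (g.toLinearEquiv : E →ₗ[ZMod 2] E) = F' := by
  -- Induction on the codimension of F ⊓ F': one transvection enlarges the intersection with F'.
  induction hn : Module.finrank (ZMod 2) E - Module.finrank (ZMod 2) ↥(F ⊓ F')
    using Nat.strong_induction_on generalizing F with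
  | _ n ih =>
    have hdF := hF.two_mul_finrank hq
    have hdF' := hF'.two_mul_finrank hq
    by_cases hle : F ≤ F'
    · refine ⟨QuadraticMap.IsometryEquiv.refl q, ?_⟩
      rw [show (((QuadraticMap.IsometryEquiv.refl q).toLinearEquiv : E ≃ₗ[ZMod 2] E) : E →ₗ[ZMod 2] E) =
        LinearMap.id from rfl, Submodule.map_id]
      exact Submodule.eq_of_le_of_finrank_eq hle (by omega)
    · obtain ⟨x, hxF, hxF'⟩ := SetLike.not_le_iff_exists.mp hle
      have : ∃ y ∈ F', polar q x y ≠ 0 := by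
        by_contra! h
        exact hxF' (hF'.2 h)
      obtain ⟨y, hyF', hxy⟩ := this
      have hxy := ZMod.two_eq_one_of_ne_zero hxy
      have hyF : y ∉ F := fun h => by simp [hF.1.polar_eq_zero hxF h] at hxy
      -- The transvection in x + y takes x to y, and it fixes F ⊓ F' pointwise because that
      -- intersection is orthogonal to both x and y. The new intersection gains y.
      have hv : q (x + y) = 1 := by
        rw [map_add_eq_polar, hF.1 x hxF, hF'.1 y hyF', hxy]; rfl
      set t := orthogonalTransvection q (x + y) hv with ht
      have hlt : F ⊓ F' < F.map (t.toLinearEquiv : E →ₗ[ZMod 2] E) ⊓ F' := by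
        rw [SetLike.lt_iff_le_and_exists]
        refine ⟨fun z hz => ⟨⟨z, hz.1, ?_⟩, hz.2⟩, y, ⟨⟨x, hxF, ?_⟩, hyF'⟩, fun h => hyF h.1⟩
        · change t z = z
          rw [orthogonalTransvection_apply, polar_add_right, hF.1.polar_eq_zero hz.1 hxF,
            hF'.1.polar_eq_zero hz.2 hyF']
          simp
        · change t x = y
          rw [orthogonalTransvection_apply, polar_add_right, polar_self_eq_zero, hxy, zero_add,
            one_smul, ← add_assoc, add_self_eq_zero_of_zmod_two, zero_add]
      have hlt' := Submodule.finrank_lt_finrank_of_lt hlt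
      have hle' := Submodule.finrank_le (F.map (t.toLinearEquiv : E →ₗ[ZMod 2] E) ⊓ F')
      obtain ⟨g, hg⟩ := ih _ (by omega) (hF.map t) rfl
      refine ⟨t.trans g, ?_⟩
      rw [← hg, ← Submodule.map_comp]
      rfl

end QuadraticSpace

/-! ### Hyperbolic bases from Lagrangian subspaces -/

section HyperbolicBasis

open QuadraticMap

variable {E : Type*} [AddCommGroup E] [Module (ZMod 2) E] {q : QuadraticForm (ZMod 2) E}

theorem map_sum_eq_zero_of_polar_eq_zero {ι : Type*} (s : Finset ι) (v : ι → E)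
    (hv : ∀ i, q (v i) = 0) (hp : ∀ i j, i ≠ j → polar q (v i) (v j) = 0) (c : ι → ZMod 2) :
    q (∑ i ∈ s, c i • v i) = 0 := by
  classical
  induction s using Finset.induction_on with
  | empty => simp
  | insert a s ha ih =>
    rw [Finset.sum_insert ha, map_add_eq_polar, ih, QuadraticMap.map_smul, hv, smul_zero, zero_add,
      zero_add]
    change polarBilin q _ _ = 0
    rw [map_sum]
    refine Finset.sum_eq_zero fun i hi => ?_
    rw [polarBilin_apply_apply, polar_smul_left, polar_smul_right,
      hp a i (by rintro rfl; exact ha hi), smul_zero, smul_zero]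

/-- Pairing a combination of the f and w with w j and f j reads off its coefficients. This gives
linear independence, hence a basis by dimension, and the same relations evaluate q. -/
theorem exists_hyperbolicBasis_of_polar [Fintype E] {k : ℕ} (hk : 2 * k = Module.finrank (ZMod 2) E)
    (f w : Fin k → E) (hf : ∀ i, q (f i) = 0) (hw : ∀ i, q (w i) = 0)
    (hff : ∀ i j, polar q (f i) (f j) = 0) (hww : ∀ i j, i ≠ j → polar q (w i) (w j) = 0)
    (hfw : ∀ i j, polar q (f i) (w j) = if i = j then 1 else 0) :
    ∃ e : Module.Basis (Fin k ⊕ Fin k) (ZMod 2) E, IsHyperbolicBasis q e := by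
  have hww' : ∀ i j, polar q (w i) (w j) = 0 := fun i j => by
    by_cases h : i = j
    · rw [h, polar_self_eq_zero]
    · exact hww i j h
  have key : ∀ a b : Fin k → ZMod 2, ∀ j,
      polar q (∑ i, a i • f i + ∑ i, b i • w i) (w j) = a j ∧
      polar q (∑ i, a i • f i + ∑ i, b i • w i) (f j) = b j := by
    intro a b j
    simp only [← polarBilin_apply_apply, map_add, map_sum, map_smul, LinearMap.add_apply,
      LinearMap.sum_apply, LinearMap.smul_apply]
    simp only [polarBilin_apply_apply, hfw, hww', hff, polar_comm q (w _) (f _)]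
    simp
  have hli : LinearIndependent (ZMod 2) (Sum.elim f w) := by
    rw [Fintype.linearIndependent_iff]
    intro c hc
    rw [Fintype.sum_sum_type] at hc
    simp only [Sum.elim_inl, Sum.elim_inr] at hc
    have h := fun j => key (fun i => c (.inl i)) (fun i => c (.inr i)) j
    simp only [hc, polar_zero_left] at h
    rintro (j | j)
    · exact (h j).1.symm
    · exact (h j).2.symm
  let e := Module.Basis.mk hli (hli.span_eq_top_of_card_eq_finrank' (by simp [← hk, two_mul])).ge
  refine ⟨e, fun x => ?_⟩
  have hx : x = ∑ i, e.repr x (.inl i) • f i + ∑ i, e.repr x (.inr i) • w i := by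
    conv_lhs => rw [← e.sum_repr x, Fintype.sum_sum_type]
    simp [e]
  conv_lhs => rw [hx]
  rw [map_add_eq_polar, map_sum_eq_zero_of_polar_eq_zero _ f hf fun i j _ => hff i j,
    map_sum_eq_zero_of_polar_eq_zero _ w hw hww, zero_add, zero_add, ← polarBilin_apply_apply,
    map_sum]
  refine Finset.sum_congr rfl fun j _ => ?_
  have h := (key (fun i => e.repr x (.inl i)) 0 j).1
  simp only [Pi.zero_apply, zero_smul, Finset.sum_const_zero, add_zero] at h
  rw [map_smul, polarBilin_apply_apply, h, smul_eq_mul, mul_comm]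

variable (q) in
/-- The quadratic space has a hyperbolic basis. -/
def HasHyperbolicBasis : Prop :=
  ∃ e : Module.Basis (Fin (Module.finrank (ZMod 2) E / 2) ⊕
    Fin (Module.finrank (ZMod 2) E / 2)) (ZMod 2) E, IsHyperbolicBasis q e

/-- A quadratic space with a Lagrangian subspace has a hyperbolic basis. -/
theorem IsLagrangian.exists_hyperbolicBasis [Fintype E]
    (hq : ∀ x, (∀ y, polar q x y = 0) → x = 0) {F : Submodule (ZMod 2) E}
    (hF : IsLagrangian q F) :
    HasHyperbolicBasis q := by
  have hd := hF.two_mul_finrank hq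
  set k := Module.finrank (ZMod 2) E / 2 with hk
  have hkF : Module.finrank (ZMod 2) F = k := by omega
  let f := Module.finBasisOfFinrankEq (ZMod 2) F hkF
  let Φ : E →ₗ[ZMod 2] Module.Dual (ZMod 2) F := (polarBilin q).domRestrict₂ F
  have hker : Φ.ker = F := by
    ext x
    rw [LinearMap.mem_ker]
    constructor
    · intro h
      exact hF.2 fun y hy => LinearMap.congr_fun h (⟨y, hy⟩ : F)
    · intro h
      ext y
      exact hF.1.polar_eq_zero h y.2
  -- The kernel F has half the dimension of E, so the image has the dimension of the dual of F.
  -- Preimages of the coordinate functionals are then paired dually with f.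
  have hsurj : Function.Surjective Φ := by
    rw [← LinearMap.range_eq_top]
    apply Submodule.eq_top_of_finrank_eq
    have h1 := Φ.finrank_range_add_finrank_ker
    rw [hker] at h1
    rw [Subspace.dual_finrank_eq]
    omega
  choose w hw using fun i => hsurj (f.coord i)
  have hwf : ∀ i j, polar q (w i) (f j) = if j = i then 1 else 0 := by
    intro i j
    have := LinearMap.congr_fun (hw i) (f j)
    rw [Module.Basis.coord_apply, Module.Basis.repr_self, Finsupp.single_apply] at this
    exact this
  -- Vectors of F are added to the w i to make them isotropic and mutually orthogonal. The diagonal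
  -- of c corrects q (w i); for i ≠ j only c i j + c j i enters the polar form, so a triangular
  -- choice suffices.
  let c : Fin k → Fin k → ZMod 2 := fun i j =>
    if i = j then q (w i) else if i < j then polar q (w i) (w j) else 0
  let u : Fin k → E := fun i => ∑ l, c i l • (f l : E)
  have hu : ∀ i, u i ∈ F := fun i => F.sum_mem fun l _ => F.smul_mem _ (f l).2
  have hwu : ∀ i j, polar q (w i) (u j) = c j i := by
    intro i j
    rw [← polarBilin_apply_apply, map_sum]
    simp only [map_smul, polarBilin_apply_apply, hwf]
    simp
  refine exists_hyperbolicBasis_of_polar (by omega) (fun i => (f i : E)) (fun i => w i + u i)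
    (fun i => hF.1 _ (f i).2) ?_ (fun i j => hF.1.polar_eq_zero (f i).2 (f j).2) ?_ ?_
  · intro i
    rw [map_add_eq_polar, hwu, hF.1 _ (hu i), add_zero]
    simp only [c, if_true]
    exact CharTwo.add_self_eq_zero _
  · intro i j hij
    rw [polar_add_left, polar_add_right, polar_add_right, polar_comm q (u i) (w j), hwu, hwu,
      hF.1.polar_eq_zero (hu i) (hu j), add_zero]
    simp only [c, if_neg hij, if_neg hij.symm]
    rcases lt_or_gt_of_ne hij with h | h
    · rw [if_neg h.not_gt, if_pos h, add_zero, CharTwo.add_self_eq_zero]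
    · rw [if_pos h, if_neg h.not_gt, add_zero, polar_comm, CharTwo.add_self_eq_zero]
  · intro i j
    rw [polar_comm, polar_add_left, hwf, hF.1.polar_eq_zero (hu j) (f i).2, add_zero]

end HyperbolicBasis

/-! ### The Dickson invariant -/

/-- An alternating matrix over the field with two elements is `L + Lᵀ` for some `L`. -/
theorem exists_eq_add_transpose {ι : Type*} (K : Matrix ι ι (ZMod 2)) (hK : Kᵀ = K)
    (hd : ∀ i, K i i = 0) : ∃ L : Matrix ι ι (ZMod 2), K = L + Lᵀ := by
  classical
  refine ⟨Matrix.of fun i j => if WellOrderingRel i j then K i j else 0, ?_⟩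
  ext i j
  have hs : K j i = K i j := congrFun (congrFun hK i) j
  rw [Matrix.add_apply, Matrix.transpose_apply, Matrix.of_apply, Matrix.of_apply]
  rcases trichotomous_of WellOrderingRel i j with h | h | h
  · rw [if_pos h, if_neg (asymm_of _ h), add_zero]
  · subst h; rw [hd]; simp
  · rw [if_pos h, if_neg (asymm_of _ h), zero_add, hs]

/-- For K = L + Lᵀ and S symmetric, both halves of the trace equal tr (L S), so they cancel in
characteristic two. -/
theorem trace_mul_eq_zero_of_alternating {ι : Type*} [Fintype ι] {K S : Matrix ι ι (ZMod 2)}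
    (hK : Kᵀ = K) (hd : ∀ i, K i i = 0) (hS : Sᵀ = S) : (K * S).trace = 0 := by
  obtain ⟨L, rfl⟩ := exists_eq_add_transpose K hK hd
  rw [add_mul, Matrix.trace_add, ← Matrix.trace_transpose (Lᵀ * S), Matrix.transpose_mul,
    Matrix.transpose_transpose, hS, Matrix.trace_mul_comm S L]
  exact CharTwo.add_self_eq_zero _

section Dickson

variable {ι : Type*} [Fintype ι] [DecidableEq ι]

/-- The matrix `(0 1; 1 0)` of the hyperbolic polar form. -/
def hyperbolicMatrix (ι R : Type*) [DecidableEq ι] [Zero R] [One R] :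
    Matrix (ι ⊕ ι) (ι ⊕ ι) R := Matrix.fromBlocks 0 1 1 0

/-- The trace of `Cᵀ B` for a block matrix `(A B; C D)`. -/
def dicksonTrace (M : Matrix (ι ⊕ ι) (ι ⊕ ι) (ZMod 2)) : ZMod 2 :=
  (M.toBlocks₂₁ᵀ * M.toBlocks₁₂).trace

/-- Matrices which preserve the quadratic form `∑ xⱼ x_{k+j}`. -/
structure IsHyperbolicIsometry (M : Matrix (ι ⊕ ι) (ι ⊕ ι) (ZMod 2)) : Prop where
  polar : Mᵀ * hyperbolicMatrix ι (ZMod 2) * M = hyperbolicMatrix ι (ZMod 2)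
  diag_left : ∀ i, (M.toBlocks₁₁ᵀ * M.toBlocks₂₁) i i = 0
  diag_right : ∀ i, (M.toBlocks₁₂ᵀ * M.toBlocks₂₂) i i = 0

theorem map_hyperbolicMatrix {ι R S : Type*} [DecidableEq ι] [NonAssocSemiring R]
    [NonAssocSemiring S] (f : R →+* S) :
    (hyperbolicMatrix ι R).map f = hyperbolicMatrix ι S := by
  simp [hyperbolicMatrix, Matrix.fromBlocks_map]

theorem hyperbolicMatrix_mul_self (R : Type*) [CommRing R] :
    hyperbolicMatrix ι R * hyperbolicMatrix ι R = 1 := by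
  simp [hyperbolicMatrix, Matrix.fromBlocks_multiply]

theorem IsHyperbolicIsometry.polar_transpose {M : Matrix (ι ⊕ ι) (ι ⊕ ι) (ZMod 2)}
    (hM : IsHyperbolicIsometry M) :
    M * hyperbolicMatrix ι (ZMod 2) * Mᵀ = hyperbolicMatrix ι (ZMod 2) := by
  have h1 : (hyperbolicMatrix ι (ZMod 2) * Mᵀ * hyperbolicMatrix ι (ZMod 2)) * M = 1 := by
    rw [mul_assoc, mul_assoc, ← mul_assoc Mᵀ, hM.polar, hyperbolicMatrix_mul_self]
  have h2 := mul_eq_one_comm.mp h1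
  rw [← mul_one (M * hyperbolicMatrix ι (ZMod 2) * Mᵀ),
    ← hyperbolicMatrix_mul_self (ι := ι) (ZMod 2), ← mul_assoc,
    show M * hyperbolicMatrix ι (ZMod 2) * Mᵀ * hyperbolicMatrix ι (ZMod 2) = 1 by
      rw [← h2]; simp only [mul_assoc], one_mul]

theorem IsHyperbolicIsometry.block_relations {A B C D : Matrix ι ι (ZMod 2)}
    (h : IsHyperbolicIsometry (Matrix.fromBlocks A B C D)) :
    Cᵀ * A + Aᵀ * C = 0 ∧ Cᵀ * B + Aᵀ * D = 1 ∧ Dᵀ * B + Bᵀ * D = 0 := by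
  have h1 := h.polar
  simp only [hyperbolicMatrix, Matrix.fromBlocks_transpose, Matrix.fromBlocks_multiply, mul_zero,
    mul_one, zero_add, add_zero, Matrix.fromBlocks_inj] at h1
  exact ⟨h1.1, h1.2.1, h1.2.2.2⟩

theorem IsHyperbolicIsometry.block_relations_transpose {A B C D : Matrix ι ι (ZMod 2)}
    (h : IsHyperbolicIsometry (Matrix.fromBlocks A B C D)) :
    B * Aᵀ + A * Bᵀ = 0 ∧ B * Cᵀ + A * Dᵀ = 1 ∧ D * Cᵀ + C * Dᵀ = 0 := by
  have h1 := h.polar_transpose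
  simp only [hyperbolicMatrix, Matrix.fromBlocks_transpose, Matrix.fromBlocks_multiply, mul_zero,
    mul_one, zero_add, add_zero, Matrix.fromBlocks_inj] at h1
  exact ⟨h1.1, h1.2.1, h1.2.2.2⟩

theorem Matrix.eq_of_add_eq_zero_of_zmod_two {ι : Type*} {X Y : Matrix ι ι (ZMod 2)} (h : X + Y = 0) :
    X = Y := by
  ext i j
  have := congrFun (congrFun h i) j
  exact CharTwo.add_eq_zero.mp this

/-- The trace for the product expands into four terms. Two are traces of an alternating matrix (CᵀA
or DᵀB) times a symmetric one and vanish. The relations DᵀA = 1 + BᵀC and D'A'ᵀ = 1 + C'B'ᵀ turn the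
other two into the Dickson traces of the factors plus a common term, which cancels. -/
theorem dicksonTrace_mul {M M' : Matrix (ι ⊕ ι) (ι ⊕ ι) (ZMod 2)}
    (hM : IsHyperbolicIsometry M) (hM' : IsHyperbolicIsometry M') :
    dicksonTrace (M * M') = dicksonTrace M + dicksonTrace M' := by
  obtain ⟨A, B, C, D, rfl⟩ : ∃ A B C D, M = Matrix.fromBlocks A B C D :=
    ⟨_, _, _, _, (Matrix.fromBlocks_toBlocks M).symm⟩
  obtain ⟨A', B', C', D', rfl⟩ : ∃ A B C D, M' = Matrix.fromBlocks A B C D :=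
    ⟨_, _, _, _, (Matrix.fromBlocks_toBlocks M').symm⟩
  obtain ⟨h1, h2, h3⟩ := hM.block_relations
  obtain ⟨h4, h5, h6⟩ := hM'.block_relations_transpose
  have hd := hM.diag_left
  have hd' := hM.diag_right
  simp only [Matrix.toBlocks_fromBlocks₁₁, Matrix.toBlocks_fromBlocks₂₁,
    Matrix.toBlocks_fromBlocks₁₂, Matrix.toBlocks_fromBlocks₂₂] at hd hd'
  simp only [dicksonTrace, Matrix.fromBlocks_multiply, Matrix.toBlocks_fromBlocks₂₁,
    Matrix.toBlocks_fromBlocks₁₂, Matrix.transpose_add, Matrix.transpose_mul, add_mul, mul_add,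
    Matrix.trace_add]
  have t1 : (A'ᵀ * Cᵀ * (A * B')).trace = 0 := by
    have e := Matrix.eq_of_add_eq_zero_of_zmod_two h1
    rw [mul_assoc, Matrix.trace_mul_comm, ← mul_assoc, mul_assoc, e]
    refine trace_mul_eq_zero_of_alternating ?_ hd ?_
    · rw [Matrix.transpose_mul, Matrix.transpose_transpose, e]
    · rw [Matrix.transpose_mul, Matrix.transpose_transpose]
      exact (Matrix.eq_of_add_eq_zero_of_zmod_two h4).symm
  have t2 : (C'ᵀ * Dᵀ * (B * D')).trace = 0 := by
    have e := Matrix.eq_of_add_eq_zero_of_zmod_two h3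
    rw [mul_assoc, Matrix.trace_mul_comm, ← mul_assoc, mul_assoc, e]
    refine trace_mul_eq_zero_of_alternating ?_ hd' ?_
    · rw [Matrix.transpose_mul, Matrix.transpose_transpose, e]
    · rw [Matrix.transpose_mul, Matrix.transpose_transpose]
      exact (Matrix.eq_of_add_eq_zero_of_zmod_two h6).symm
  have hDA : Dᵀ * A = 1 + Bᵀ * C := by
    have := congrArg Matrix.transpose h2
    rw [Matrix.transpose_add, Matrix.transpose_mul, Matrix.transpose_mul, Matrix.transpose_one,
      Matrix.transpose_transpose, Matrix.transpose_transpose] at this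
    rw [← this, add_comm (Bᵀ * C), add_assoc, add_self_eq_zero_of_zmod_two, add_zero]
  have hDA' : D' * A'ᵀ = 1 + C' * B'ᵀ := by
    have := congrArg Matrix.transpose h5
    rw [Matrix.transpose_add, Matrix.transpose_mul, Matrix.transpose_mul, Matrix.transpose_one,
      Matrix.transpose_transpose, Matrix.transpose_transpose] at this
    rw [← this, add_comm (C' * B'ᵀ), add_assoc, add_self_eq_zero_of_zmod_two, add_zero]
  have t3 : (A'ᵀ * Cᵀ * (B * D')).trace = (Cᵀ * B).trace + (Cᵀ * B * (C' * B'ᵀ)).trace := by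
    rw [mul_assoc, Matrix.trace_mul_comm, ← mul_assoc, mul_assoc, hDA', mul_add, mul_one,
      Matrix.trace_add]
  have t4 : (C'ᵀ * Dᵀ * (A * B')).trace = (C'ᵀ * B').trace + (Cᵀ * B * (C' * B'ᵀ)).trace := by
    rw [mul_assoc, Matrix.trace_mul_comm, ← mul_assoc, mul_assoc, hDA, add_mul, one_mul,
      Matrix.trace_add, Matrix.trace_mul_comm B' C'ᵀ, ← Matrix.trace_transpose (Bᵀ * C * _)]
    simp only [Matrix.transpose_mul, Matrix.transpose_transpose]
    rw [Matrix.trace_mul_comm (C' * B'ᵀ)]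
  rw [t1, t2, t3, t4]
  linear_combination CharTwo.add_self_eq_zero (Cᵀ * B * (C' * B'ᵀ)).trace

end Dickson

/-! ### The Dickson invariant of isometries and the sign of a Lagrangian subspace -/

section DicksonInvariant

open QuadraticMap

variable {E : Type*} [AddCommGroup E] [Module (ZMod 2) E] {q : QuadraticForm (ZMod 2) E}
  {k : ℕ} {e : Module.Basis (Fin k ⊕ Fin k) (ZMod 2) E}

theorem IsHyperbolicBasis.polar_eq (he : IsHyperbolicBasis q e) (x y : E) :
    polar q x y = ∑ j, (e.repr x (.inl j) * e.repr y (.inr j) +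
      e.repr x (.inr j) * e.repr y (.inl j)) := by
  rw [polar, he, he, he, ← Finset.sum_sub_distrib, ← Finset.sum_sub_distrib]
  refine Finset.sum_congr rfl fun j _ => ?_
  rw [map_add, Finsupp.add_apply, Finsupp.add_apply]
  ring

theorem IsHyperbolicBasis.polar_basis (he : IsHyperbolicBasis q e) (i j : Fin k ⊕ Fin k) :
    polar q (e i) (e j) = hyperbolicMatrix (Fin k) (ZMod 2) i j := by
  rw [he.polar_eq]
  rcases i with i | i <;> rcases j with j | j <;>
    simp [hyperbolicMatrix, Finsupp.single_apply, Matrix.one_apply, eq_comm]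

theorem IsHyperbolicBasis.isHyperbolicIsometry (he : IsHyperbolicBasis q e)
    (g : q.IsometryEquiv q) :
    IsHyperbolicIsometry (LinearMap.toMatrix e e (g.toLinearEquiv : E →ₗ[ZMod 2] E)) := by
  have hM : ∀ i j, LinearMap.toMatrix e e (g.toLinearEquiv : E →ₗ[ZMod 2] E) i j =
      e.repr (g (e j)) i := fun i j => LinearMap.toMatrix_apply e e _ i j
  have hp : ∀ i j, polar q (g (e i)) (g (e j)) = hyperbolicMatrix (Fin k) (ZMod 2) i j :=
    fun i j => by rw [polar_isometryEquiv, he.polar_basis]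
  refine ⟨?_, fun i => ?_, fun i => ?_⟩
  · ext i j
    rw [← hp, he.polar_eq, Matrix.mul_apply, Fintype.sum_sum_type, Finset.sum_add_distrib,
      add_comm]
    congr 1 <;> refine Finset.sum_congr rfl fun l _ => ?_
    · rw [Matrix.mul_apply, Fintype.sum_sum_type, hM]
      simp [hyperbolicMatrix, Matrix.one_apply, hM]
    · rw [Matrix.mul_apply, Fintype.sum_sum_type, hM]
      simp [hyperbolicMatrix, Matrix.one_apply, hM]
  · have h := he (g (e (.inl i)))
    rw [g.map_app, he] at h
    simp only [Module.Basis.repr_self, Finsupp.single_apply, reduceCtorEq, if_false, mul_zero,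
      Finset.sum_const_zero] at h
    rw [h, Matrix.mul_apply]
    exact Finset.sum_congr rfl fun l _ => by
      rw [Matrix.transpose_apply, Matrix.toBlocks₁₁, Matrix.toBlocks₂₁, Matrix.of_apply,
        Matrix.of_apply, hM, hM]
  · have h := he (g (e (.inr i)))
    rw [g.map_app, he] at h
    simp only [Module.Basis.repr_self, Finsupp.single_apply, reduceCtorEq, if_false, zero_mul,
      Finset.sum_const_zero] at h
    rw [h, Matrix.mul_apply]
    exact Finset.sum_congr rfl fun l _ => by
      rw [Matrix.transpose_apply, Matrix.toBlocks₁₂, Matrix.toBlocks₂₂, Matrix.of_apply,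
        Matrix.of_apply, hM, hM]

theorem exists_dicksonInvariant_eq (h : HasHyperbolicBasis q) :
    ∃ e : Module.Basis (Fin (Module.finrank (ZMod 2) E / 2) ⊕
      Fin (Module.finrank (ZMod 2) E / 2)) (ZMod 2) E, IsHyperbolicBasis q e ∧
      ∀ g : q.IsometryEquiv q, dicksonInvariant q g =
        dicksonTrace (LinearMap.toMatrix e e (g.toLinearEquiv : E →ₗ[ZMod 2] E)) := by
  unfold HasHyperbolicBasis at h
  refine ⟨h.choose, h.choose_spec, fun g => ?_⟩
  rw [dicksonInvariant, dif_pos h]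
  rfl

theorem dicksonInvariant_trans (h : HasHyperbolicBasis q) (g g' : q.IsometryEquiv q) :
    dicksonInvariant q (g.trans g') = dicksonInvariant q g + dicksonInvariant q g' := by
  obtain ⟨e, he, hD⟩ := exists_dicksonInvariant_eq h
  rw [hD, hD, hD, add_comm, ← dicksonTrace_mul (he.isHyperbolicIsometry _)
    (he.isHyperbolicIsometry _), ← LinearMap.toMatrix_comp]
  rfl

theorem dicksonInvariant_refl : dicksonInvariant q (QuadraticMap.IsometryEquiv.refl q) = 0 := by
  unfold dicksonInvariant
  split_ifs with h
  · change (_ * (LinearMap.toMatrix h.choose h.choose LinearMap.id).toBlocks₁₂).trace = 0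
    rw [LinearMap.toMatrix_id, ← Matrix.fromBlocks_one, Matrix.toBlocks_fromBlocks₁₂, mul_zero,
      Matrix.trace_zero]
  · rfl

theorem dicksonInvariant_symm (h : HasHyperbolicBasis q) (g : q.IsometryEquiv q) :
    dicksonInvariant q g.symm = dicksonInvariant q g := by
  have h1 := dicksonInvariant_trans h g g.symm
  rw [show g.trans g.symm = QuadraticMap.IsometryEquiv.refl q from
    DFunLike.ext _ _ fun x => g.symm_apply_apply x, dicksonInvariant_refl] at h1
  exact (CharTwo.add_eq_zero.mp h1.symm).symm

/-- The off-diagonal blocks B and C of a transvection have rank at most one, and the trace of CᵀB is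
the square of ∑ vⱼ v_{k+j} = q(v) = 1. -/
theorem dicksonInvariant_orthogonalTransvection (h : HasHyperbolicBasis q) {v : E} (hv : q v = 1) :
    dicksonInvariant q (orthogonalTransvection q v hv) = 1 := by
  obtain ⟨e, he, hD⟩ := exists_dicksonInvariant_eq h
  have hM : ∀ i j, LinearMap.toMatrix e e
      ((orthogonalTransvection q v hv).toLinearEquiv : E →ₗ[ZMod 2] E) i j =
      e.repr (e j) i + polar q (e j) v * e.repr v i := by
    intro i j
    rw [LinearMap.toMatrix_apply]
    change e.repr (e j + polar q (e j) v • v) i = _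
    rw [map_add, map_smul]
    rfl
  rw [hD, dicksonTrace, Matrix.trace]
  have hsum := he v
  rw [hv] at hsum
  have hl : ∀ j, polar q (e (.inl j)) v = e.repr v (.inr j) := fun j => by
    rw [he.polar_eq]; simp [Finsupp.single_apply]
  have hr : ∀ j, polar q (e (.inr j)) v = e.repr v (.inl j) := fun j => by
    rw [he.polar_eq]; simp [Finsupp.single_apply]
  simp only [Matrix.diag_apply, Matrix.mul_apply, Matrix.transpose_apply, Matrix.toBlocks₂₁,
    Matrix.toBlocks₁₂, Matrix.of_apply, hM, hl, hr]
  simp only [Module.Basis.repr_self, Finsupp.single_apply, reduceCtorEq, if_false, zero_add]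
  calc ∑ x, ∑ y, e.repr v (.inr x) * e.repr v (.inr y) * (e.repr v (.inl x) * e.repr v (.inl y))
      = (∑ x, e.repr v (.inl x) * e.repr v (.inr x)) *
          ∑ y, e.repr v (.inl y) * e.repr v (.inr y) := by
        rw [Finset.sum_mul_sum]
        exact Finset.sum_congr rfl fun x _ => Finset.sum_congr rfl fun y _ => by ring
    _ = 1 := by rw [← hsum]; rfl

/-- By transitivity a conjugate of g preserves the span of the first half of the hyperbolic basis,
so its block C is zero; conjugation does not change the invariant, a homomorphism to ℤ/2. -/
theorem dicksonInvariant_eq_zero_of_map_eq [Fintype E] (h : HasHyperbolicBasis q)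
    (hq : ∀ x, (∀ y, polar q x y = 0) → x = 0) {F : Submodule (ZMod 2) E}
    (hF : IsLagrangian q F) (g : q.IsometryEquiv q)
    (hg : F.map (g.toLinearEquiv : E →ₗ[ZMod 2] E) = F) : dicksonInvariant q g = 0 := by
  obtain ⟨e, he, hD⟩ := exists_dicksonInvariant_eq h
  let F₁ : Submodule (ZMod 2) E := ⨅ j, LinearMap.ker (e.coord (.inr j))
  have hF₁ : ∀ x, x ∈ F₁ ↔ ∀ j, e.repr x (.inr j) = 0 := fun x => by
    simp [F₁, Submodule.mem_iInf]
  have hL : IsLagrangian q F₁ := by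
    refine ⟨fun x hx => ?_, fun x hx => ?_⟩
    · rw [he]; simp [(hF₁ x).mp hx]
    · rw [hF₁]
      intro j
      have := hx (e (.inl j)) ((hF₁ _).mpr fun i => by simp)
      rw [he.polar_eq] at this
      simpa [Finsupp.single_apply] using this
  obtain ⟨t, ht⟩ := hL.exists_isometryEquiv_map_eq hq hF
  have h1 : dicksonInvariant q ((t.trans g).trans t.symm) = 0 := by
    rw [hD, dicksonTrace]
    have hC : (LinearMap.toMatrix e e (((t.trans g).trans t.symm).toLinearEquiv :
        E →ₗ[ZMod 2] E)).toBlocks₂₁ = 0 := by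
      ext i j
      rw [Matrix.toBlocks₂₁, Matrix.of_apply, LinearMap.toMatrix_apply]
      change e.repr (t.symm (g (t (e (.inl j))))) (.inr i) = 0
      refine (hF₁ _).mp ?_ i
      have h2 : t (e (.inl j)) ∈ F := by
        rw [← ht]
        exact ⟨_, (hF₁ _).mpr fun i => by simp, rfl⟩
      have h3 : g (t (e (.inl j))) ∈ F := by
        have h4 : g (t (e (.inl j))) ∈ F.map (g.toLinearEquiv : E →ₗ[ZMod 2] E) := ⟨_, h2, rfl⟩
        rwa [hg] at h4
      rw [← ht] at h3
      obtain ⟨y, hy, hyt⟩ := h3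
      rw [← hyt]
      change t.symm (t y) ∈ F₁
      rwa [t.symm_apply_apply]
    rw [hC, Matrix.transpose_zero, zero_mul, Matrix.trace_zero]
  rw [dicksonInvariant_trans h, dicksonInvariant_trans h, dicksonInvariant_symm h] at h1
  linear_combination h1 - CharTwo.add_self_eq_zero (dicksonInvariant q t)

theorem Submodule.map_eq_self_of_apply_eq {R M : Type*} [Semiring R] [AddCommMonoid M]
    [Module R M] (f : M →ₗ[R] M) (hf : ∀ x, f x = x) (F : Submodule R M) : F.map f = F := by
  rw [show f = LinearMap.id from LinearMap.ext hf, Submodule.map_id]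

/-- Two isometries that carry F₀ to F differ by one that stabilizes F₀, and that one has invariant
0. Thus any single isometry decides the orbit of F. -/
theorem sameDicksonOrbit_iff [Fintype E]
    (hq : ∀ x, (∀ y, polar q x y = 0) → x = 0) {F₀ F : Submodule (ZMod 2) E}
    (hF₀ : IsLagrangian q F₀) (g : q.IsometryEquiv q)
    (hg : F₀.map (g.toLinearEquiv : E →ₗ[ZMod 2] E) = F) :
    SameDicksonOrbit q F₀ F ↔ dicksonInvariant q g = 0 := by
  have h := hF₀.exists_hyperbolicBasis hq
  refine ⟨?_, fun hD => ⟨g, hD, hg⟩⟩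
  rintro ⟨g', hD', hg'⟩
  have h1 := dicksonInvariant_eq_zero_of_map_eq h hq hF₀ (g'.trans g.symm) (by
    rw [show (((g'.trans g.symm).toLinearEquiv : E ≃ₗ[ZMod 2] E) : E →ₗ[ZMod 2] E) =
      (g.symm.toLinearEquiv : E →ₗ[ZMod 2] E) ∘ₗ (g'.toLinearEquiv : E →ₗ[ZMod 2] E) from rfl,
      Submodule.map_comp, hg', ← hg, ← Submodule.map_comp]
    exact Submodule.map_eq_self_of_apply_eq _ (fun x => g.symm_apply_apply x) F₀)
  rwa [dicksonInvariant_trans h, dicksonInvariant_symm h, hD', zero_add] at h1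

/-- An isometry multiplies the sign by its Dickson character. -/
theorem dicksonSign_map [Fintype E]
    (hq : ∀ x, (∀ y, polar q x y = 0) → x = 0) {F₀ F : Submodule (ZMod 2) E}
    (hF₀ : IsLagrangian q F₀) (hF : IsLagrangian q F) (g : q.IsometryEquiv q) :
    dicksonSign q F₀ (F.map (g.toLinearEquiv : E →ₗ[ZMod 2] E)) =
      signChar (dicksonInvariant q g) * dicksonSign q F₀ F := by
  classical
  obtain ⟨t, ht⟩ := hF₀.exists_isometryEquiv_map_eq hq hF
  have h := hF₀.exists_hyperbolicBasis hq
  rw [dicksonSign, dicksonSign, if_pos hF.isMaximalIsotropic,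
    if_pos (hF.map g).isMaximalIsotropic, if_congr (sameDicksonOrbit_iff hq hF₀ t ht) rfl rfl,
    if_congr (sameDicksonOrbit_iff hq hF₀ (t.trans g)
      (by rw [← ht, ← Submodule.map_comp]; rfl)) rfl rfl, dicksonInvariant_trans h]
  generalize dicksonInvariant q t = a
  generalize dicksonInvariant q g = b
  revert a b
  decide

/-- The sum of the signs of the maximal isotropic subspaces which contain a given subspace. -/
theorem sum_dicksonSign [Fintype E] [Fintype (Submodule (ZMod 2) E)]
    (hq : ∀ x, (∀ y, polar q x y = 0) → x = 0) (hG : 0 < quadraticGaussSum q)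
    {F₀ : Submodule (ZMod 2) E} (hF₀ : IsLagrangian q F₀) (F₁ : Submodule (ZMod 2) E)
    [DecidablePred (F₁ ≤ ·)] :
    ∑ F with F₁ ≤ F, dicksonSign q F₀ F = dicksonSign q F₀ F₁ := by
  classical
  have h := hF₀.exists_hyperbolicBasis hq
  by_cases hI : IsIsotropic q F₁
  · by_cases hM : IsMaximalIsotropic q F₁
    · rw [Finset.sum_eq_single_of_mem F₁ (by simp)]
      intro F hF hne
      rw [dicksonSign, if_neg]
      intro hF'
      simp only [Finset.mem_filter, Finset.mem_univ, true_and] at hF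
      exact hne (le_antisymm (hM.2 hF'.1 hF) hF)
    -- Otherwise q vanishes on the complement of F₁, the Gauss sum is the order of that complement,
    -- and comparison with its square, the product of the orders of F₁ and of its complement, forces
    -- the two subspaces to be equal. Then F₁ would be Lagrangian, hence maximal.
    · have hv : ∃ v ∈ polarPerp q F₁, q v = 1 := by
        by_contra! hv
        refine hM (IsLagrangian.isMaximalIsotropic ⟨hI, ?_⟩)
        have h0 : IsIsotropic q (polarPerp q F₁) := fun x hx =>
          (ZMod.two_eq_zero_or_one (q x)).resolve_right (hv x hx)
        have h1 := hI.quadraticGaussSum_eq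
        rw [Finset.sum_congr rfl (g := fun _ => (1 : ℤ)) fun x hx => by
          rw [h0 x (by simpa using hx)]; rfl] at h1
        have h2 := quadraticGaussSum_sq hq
        rw [← card_mul_card_polarPerp hq F₁, h1] at h2
        simp only [Finset.sum_const, Int.nsmul_eq_mul, mul_one] at h2
        rw [← Fintype.card_subtype (· ∈ polarPerp q F₁), ← Nat.card_eq_fintype_card] at h2
        have h3 : Nat.card (polarPerp q F₁) = Nat.card F₁ := by
          have : Nat.card (polarPerp q F₁) ≠ 0 := Nat.card_pos.ne'
          rw [pow_two] at h2
          exact Nat.eq_of_mul_eq_mul_right (Nat.pos_of_ne_zero this) (by exact_mod_cast h2)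
        have h6 : (F₁ : Set E) = polarPerp q F₁ :=
          Set.eq_of_subset_of_ncard_le hI.le_polarPerp h3.le (Set.toFinite _)
        exact (SetLike.coe_injective h6).ge
      obtain ⟨v, hv, hqv⟩ := hv
      let t := orthogonalTransvection q v hqv
      have htt : ∀ F : Submodule (ZMod 2) E, (F.map (t.toLinearEquiv : E →ₗ[ZMod 2] E)).map
          (t.toLinearEquiv : E →ₗ[ZMod 2] E) = F := by
        intro F
        rw [← Submodule.map_comp]
        exact Submodule.map_eq_self_of_apply_eq _
          (fun x => t.toLinearEquiv.symm_apply_apply x) F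
      have hle : ∀ F : Submodule (ZMod 2) E, F₁ ≤ F →
          F₁ ≤ F.map (t.toLinearEquiv : E →ₗ[ZMod 2] E) := by
        intro F hF x hx
        refine ⟨x, hF hx, ?_⟩
        change x + polar q x v • v = x
        rw [polar_comm, hv x hx, zero_smul, add_zero]
      -- The transvection in v is an involution on the subspaces above F₁, because v is orthogonal
      -- to F₁, and it reverses every sign; the sum equals its own negative.
      have hsum : ∑ F with F₁ ≤ F, dicksonSign q F₀ F = ∑ F with F₁ ≤ F, -dicksonSign q F₀ F := by
        refine Finset.sum_bij' (fun F _ => F.map (t.toLinearEquiv : E →ₗ[ZMod 2] E))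
          (fun F _ => F.map (t.toLinearEquiv : E →ₗ[ZMod 2] E)) ?_ ?_
          (fun F _ => htt F) (fun F _ => htt F) ?_
        · intro F hF
          simpa using hle F (by simpa using hF)
        · intro F hF
          simpa using hle F (by simpa using hF)
        · intro F _
          by_cases hF : IsMaximalIsotropic q F
          · rw [dicksonSign_map hq hF₀ (hF.isLagrangian hq hG),
              dicksonInvariant_orthogonalTransvection h, signChar_one]
            ring
          · rw [dicksonSign, dicksonSign, if_neg hF, if_neg, neg_zero]
            intro hF'
            refine hF ?_
            rw [← htt F]
            exact ((hF'.isLagrangian hq hG).map t).isMaximalIsotropic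
      rw [Finset.sum_neg_distrib] at hsum
      rw [dicksonSign, if_neg hM]
      omega
  · rw [dicksonSign, if_neg fun h => hI h.1]
    refine Finset.sum_eq_zero fun F hF => ?_
    rw [dicksonSign, if_neg]
    intro hF'
    exact hI fun x hx => hF'.1 x ((Finset.mem_filter.mp hF).2 hx)

end DicksonInvariant

/-! ### Determinants modulo four and the Dickson invariant -/

section DetModFour

variable {ι : Type*}

/-- The reduction `ℤ / 4 → ℤ / 2`. -/
def zmodFourToTwo : ZMod 4 →+* ZMod 2 := ZMod.castHom (by decide) (ZMod 2)

theorem zmodFourToTwo_eq_zero_iff : ∀ x : ZMod 4, zmodFourToTwo x = 0 ↔ 2 * x = 0 := by decide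

theorem exists_eq_two_mul_of_zmodFourToTwo : ∀ x : ZMod 4, zmodFourToTwo x = 0 →
    ∃ y, x = 2 * y := by decide

theorem zmodFourToTwo_surjective : ∀ x : ZMod 2, ∃ y, zmodFourToTwo y = x := by decide

theorem two_smul_eq_iff_map_zmodFourToTwo {κ : Type*} {A B : Matrix ι κ (ZMod 4)} :
    (2 : ZMod 4) • A = (2 : ZMod 4) • B ↔ A.map zmodFourToTwo = B.map zmodFourToTwo := by
  simp only [← Matrix.ext_iff, Matrix.smul_apply, Matrix.map_apply, smul_eq_mul]
  refine forall_congr' fun i => forall_congr' fun j => ?_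
  rw [← sub_eq_zero, ← mul_sub, ← zmodFourToTwo_eq_zero_iff, map_sub, sub_eq_zero]

variable [Fintype ι] [DecidableEq ι]

/-- The trace of the upper right block of `L + Lᵀ` is the trace of `L` times the hyperbolic
matrix. -/
theorem trace_toBlocks₁₂_add_transpose {R : Type*} [CommRing R]
    (L : Matrix (ι ⊕ ι) (ι ⊕ ι) R) :
    (L + Lᵀ).toBlocks₁₂.trace = (hyperbolicMatrix ι R * L).trace := by
  obtain ⟨A, B, C, D, rfl⟩ : ∃ A B C D, L = Matrix.fromBlocks A B C D :=
    ⟨_, _, _, _, (Matrix.fromBlocks_toBlocks L).symm⟩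
  rw [Matrix.fromBlocks_transpose, Matrix.fromBlocks_add, Matrix.toBlocks_fromBlocks₁₂,
    hyperbolicMatrix, Matrix.fromBlocks_multiply]
  simp [Matrix.trace, Fintype.sum_sum_type, add_comm, Finset.sum_add_distrib]

/-- For K = L + Lᵀ the trace of the upper right block is the trace of the hyperbolic matrix times L.
Conjugation replaces L by MᵀLM, and M preserves the hyperbolic matrix in the transposed sense as
well. -/
theorem trace_toBlocks₁₂_conj {K M : Matrix (ι ⊕ ι) (ι ⊕ ι) (ZMod 2)} (hK : Kᵀ = K)
    (hd : ∀ i, K i i = 0) (hM : IsHyperbolicIsometry M) :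
    (Mᵀ * K * M).toBlocks₁₂.trace = K.toBlocks₁₂.trace := by
  obtain ⟨L, rfl⟩ := exists_eq_add_transpose K hK hd
  have h : Mᵀ * (L + Lᵀ) * M = Mᵀ * L * M + (Mᵀ * L * M)ᵀ := by
    simp [Matrix.transpose_mul, mul_add, add_mul, mul_assoc]
  rw [h, trace_toBlocks₁₂_add_transpose, trace_toBlocks₁₂_add_transpose, ← mul_assoc,
    Matrix.trace_mul_comm, ← mul_assoc, ← mul_assoc, hM.polar_transpose]

/-- All terms beyond the linear one carry the factor 2² = 0. -/
theorem det_one_add_two_smul (Y : Matrix ι ι (ZMod 4)) :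
    (1 + (2 : ZMod 4) • Y).det = 1 + 2 * Y.trace := by
  rw [Matrix.det_one_add_smul, show (2 : ZMod 4) ^ 2 = 0 from rfl]
  ring

theorem map_J_zmodFourToTwo {ι : Type*} [DecidableEq ι] :
    (Matrix.J ι (ZMod 4)).map zmodFourToTwo = hyperbolicMatrix ι (ZMod 2) := by
  ext (i | i) (j | j) <;> simp [Matrix.J, hyperbolicMatrix, Matrix.one_apply, apply_ite]

/-- Antisymmetry gives only that twice the diagonal vanishes, which is too weak over ℤ/4. Here the
matrix has the form N - Nᵀ, since J itself does. -/
theorem transpose_mul_J_mul_apply_self (G : Matrix (ι ⊕ ι) (ι ⊕ ι) (ZMod 4)) (i : ι ⊕ ι) :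
    (Gᵀ * Matrix.J ι (ZMod 4) * G) i i = 0 := by
  have h : Matrix.J ι (ZMod 4) =
      Matrix.fromBlocks 0 0 1 0 - (Matrix.fromBlocks 0 0 1 0)ᵀ := by
    rw [Matrix.J, Matrix.fromBlocks_transpose, sub_eq_add_neg, Matrix.fromBlocks_neg,
      Matrix.fromBlocks_add]
    simp
  have h2 : Gᵀ * Matrix.J ι (ZMod 4) * G = Gᵀ * Matrix.fromBlocks 0 0 1 0 * G -
      (Gᵀ * Matrix.fromBlocks 0 0 1 0 * G)ᵀ := by
    rw [h]; simp only [Matrix.transpose_mul, Matrix.transpose_transpose, mul_sub, sub_mul,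
      mul_assoc]
  rw [h2, Matrix.sub_apply, Matrix.transpose_apply, sub_self]

/-- A matrix over `ℤ / 4` of determinant one which preserves a symmetric form congruent modulo two
to the hyperbolic form has trivial Dickson invariant. -/
theorem dicksonTrace_eq_zero_of_det_eq_one {G K : Matrix (ι ⊕ ι) (ι ⊕ ι) (ZMod 4)}
    (hG : Gᵀ * (hyperbolicMatrix ι (ZMod 4) + (2 : ZMod 4) • K) * G =
      hyperbolicMatrix ι (ZMod 4) + (2 : ZMod 4) • K)
    (hK : (K.map zmodFourToTwo)ᵀ = K.map zmodFourToTwo)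
    (hd : ∀ i, K.map zmodFourToTwo i i = 0)
    (hG2 : IsHyperbolicIsometry (G.map zmodFourToTwo)) (hdet : G.det = 1) :
    dicksonTrace (G.map zmodFourToTwo) = 0 := by
  set φ := zmodFourToTwo
  -- Modulo two the hyperbolic form and the symplectic form X coincide, so GᵀXG = X + 2V with V
  -- alternating modulo two. The trace of the upper right block of V is computed twice: from det G =
  -- 1 it is zero, and from the blocks of G it is the Dickson trace.
  set X := Matrix.J ι (ZMod 4) with hX
  have hφmul : ∀ A B : Matrix (ι ⊕ ι) (ι ⊕ ι) (ZMod 4), (A * B).map φ = A.map φ * B.map φ :=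
    fun A B => Matrix.map_mul
  have hXX : X * X = -1 := Matrix.J_squared ι (ZMod 4)
  have hXT : Xᵀ = -X := Matrix.J_transpose ι (ZMod 4)
  have hXφ : X.map φ = hyperbolicMatrix ι (ZMod 2) := map_J_zmodFourToTwo
  have hWφ : (Gᵀ * X * G - X).map φ = 0 := by
    rw [Matrix.map_sub _ (map_sub φ), hφmul, hφmul, hXφ, Matrix.transpose_map, hG2.polar, sub_self]
  have hV : ∃ V : Matrix (ι ⊕ ι) (ι ⊕ ι) (ZMod 4), Gᵀ * X * G - X = (2 : ZMod 4) • V := by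
    choose V hV using fun i j => exists_eq_two_mul_of_zmodFourToTwo _ (congrFun (congrFun hWφ i) j)
    exact ⟨V, by ext i j; exact hV i j⟩
  obtain ⟨V, hV⟩ := hV
  have hVsymm : (V.map φ)ᵀ = V.map φ := by
    rw [← Matrix.transpose_map, ← two_smul_eq_iff_map_zmodFourToTwo, ← Matrix.transpose_smul, ← hV]
    have h1 : (Gᵀ * X * G - X)ᵀ = -(Gᵀ * X * G - X) := by
      simp only [Matrix.transpose_sub, Matrix.transpose_mul, Matrix.transpose_transpose, hXT,
        mul_neg, neg_mul, mul_assoc]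
      abel
    rw [h1, hV, ← neg_smul]
    rfl
  have hVd : ∀ i, V.map φ i i = 0 := by
    intro i
    rw [Matrix.map_apply, zmodFourToTwo_eq_zero_iff]
    have h1 := congrFun (congrFun hV i) i
    rw [Matrix.sub_apply, transpose_mul_J_mul_apply_self, Matrix.smul_apply, smul_eq_mul] at h1
    rw [← h1, zero_sub, neg_eq_zero, hX]
    rcases i with i | i <;> rfl
  obtain ⟨L₂, hL₂⟩ := exists_eq_add_transpose _ hVsymm hVd
  obtain ⟨L, rfl⟩ : ∃ L : Matrix (ι ⊕ ι) (ι ⊕ ι) (ZMod 4), L.map φ = L₂ := by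
    choose L hL using fun i j => zmodFourToTwo_surjective (L₂ i j)
    exact ⟨L, by ext i j; exact hL i j⟩
  -- With V = L + Lᵀ modulo two, this Y makes H = 1 + 2Y move X exactly as G does, so G H⁻¹ is
  -- symplectic and det H = det G.
  set Y := -(X * L) with hY
  set H := 1 + (2 : ZMod 4) • Y with hH
  have h4 : ∀ A : Matrix (ι ⊕ ι) (ι ⊕ ι) (ZMod 4), (2 : ZMod 4) • (2 : ZMod 4) • A = 0 := by
    intro A; rw [smul_smul, show (2 : ZMod 4) * 2 = 0 from rfl, zero_smul]
  have hHX : Hᵀ * X * H = Gᵀ * X * G := by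
    have e1 : X * Y = L := by rw [hY, mul_neg, ← mul_assoc, hXX]; simp
    have e2 : Yᵀ * X = -Lᵀ := by
      rw [hY, Matrix.transpose_neg, Matrix.transpose_mul, hXT, neg_mul, mul_neg, neg_mul, neg_neg,
        mul_assoc, hXX]; simp
    have e3 : Hᵀ * X * H = X + (2 : ZMod 4) • (L - Lᵀ) := by
      rw [hH, Matrix.transpose_add, Matrix.transpose_one, Matrix.transpose_smul, add_mul, one_mul,
        smul_mul_assoc, e2, mul_add, mul_one, mul_smul_comm, add_mul, e1, smul_mul_assoc, smul_add,
        h4, add_zero, smul_sub, smul_neg]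
      abel
    have e4 : (2 : ZMod 4) • (L - Lᵀ) = (2 : ZMod 4) • V := by
      rw [two_smul_eq_iff_map_zmodFourToTwo, hL₂, Matrix.map_sub _ (map_sub φ),
        Matrix.transpose_map]
      ext i j
      exact CharTwo.sub_eq_add _ _
    rw [e3, e4, ← hV]
    abel
  have hdetH : H.det = 1 + 2 * Y.trace := det_one_add_two_smul Y
  have hunit : IsUnit H.det := by
    have : ∀ x : ZMod 4, IsUnit (1 + 2 * x) := by decide
    rw [hdetH]; exact this _
  have hsymp : G * H⁻¹ ∈ Matrix.symplecticGroup ι (ZMod 4) := by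
    rw [SymplecticGroup.mem_iff', Matrix.transpose_mul]
    have : H⁻¹ᵀ * Gᵀ * X * (G * H⁻¹) = H⁻¹ᵀ * (Gᵀ * X * G) * H⁻¹ := by simp only [mul_assoc]
    rw [this, ← hHX]
    have : H⁻¹ᵀ * (Hᵀ * X * H) * H⁻¹ = (H * H⁻¹)ᵀ * X * (H * H⁻¹) := by
      rw [Matrix.transpose_mul]; simp only [mul_assoc]
    rw [this, Matrix.mul_nonsing_inv _ hunit, Matrix.transpose_one, one_mul, mul_one]
  have hdetGH : H.det = 1 := by
    have h1 := SymplecticGroup.det_eq_one hsymp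
    rw [Matrix.det_mul, hdet, one_mul] at h1
    have h2 : H.det * H⁻¹.det = 1 := by
      rw [← Matrix.det_mul, Matrix.mul_nonsing_inv _ hunit, Matrix.det_one]
    rwa [h1, mul_one] at h2
  have htrY : φ Y.trace = 0 := by
    rw [zmodFourToTwo_eq_zero_iff]
    rw [hdetH] at hdetGH
    linear_combination hdetGH
  have htrV : (V.map φ).toBlocks₁₂.trace = 0 := by
    rw [hL₂, trace_toBlocks₁₂_add_transpose, ← hXφ, ← hφmul]
    rw [hY, Matrix.trace_neg, map_neg, neg_eq_zero] at htrY
    exact (AddMonoidHom.map_trace φ.toAddMonoidHom (X * L)).symm.trans htrY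
  -- The invariance of the symmetric form gives CᵀB + AᵀD, and the definition of V gives CᵀB - AᵀD;
  -- adding the two upper right blocks eliminates AᵀD and leaves 2 CᵀB. The terms with K will
  -- contribute nothing to the trace.
  have hblock : (2 : ZMod 4) • V.toBlocks₁₂ = (2 : ZMod 4) • (G.toBlocks₂₁ᵀ * G.toBlocks₁₂ +
      (Gᵀ * K * G).toBlocks₁₂ - K.toBlocks₁₂) := by
    obtain ⟨A, B, C, D, hABCD⟩ : ∃ A B C D, G = Matrix.fromBlocks A B C D :=
      ⟨_, _, _, _, (Matrix.fromBlocks_toBlocks G).symm⟩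
    have b1 := congrArg Matrix.toBlocks₁₂ hV
    have b2 : (Gᵀ * hyperbolicMatrix ι (ZMod 4) * G).toBlocks₁₂ +
        (2 : ZMod 4) • (Gᵀ * K * G).toBlocks₁₂ = 1 + (2 : ZMod 4) • K.toBlocks₁₂ := by
      have := congrArg Matrix.toBlocks₁₂ hG
      rw [mul_add, add_mul, mul_smul_comm, smul_mul_assoc] at this
      exact this
    have b3 : (Gᵀ * hyperbolicMatrix ι (ZMod 4) * G).toBlocks₁₂ = Cᵀ * B + Aᵀ * D := by
      rw [hABCD, hyperbolicMatrix, Matrix.fromBlocks_transpose, Matrix.fromBlocks_multiply,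
        Matrix.fromBlocks_multiply, Matrix.toBlocks_fromBlocks₁₂]
      simp
    have b4 : (Gᵀ * X * G - X).toBlocks₁₂ = Cᵀ * B - Aᵀ * D + 1 := by
      have : (Gᵀ * X * G - X).toBlocks₁₂ = (Gᵀ * X * G).toBlocks₁₂ - X.toBlocks₁₂ := rfl
      rw [this, hABCD, hX, Matrix.J, Matrix.fromBlocks_transpose, Matrix.fromBlocks_multiply,
        Matrix.fromBlocks_multiply, Matrix.toBlocks_fromBlocks₁₂, Matrix.toBlocks_fromBlocks₁₂]
      simp [sub_eq_add_neg]
    rw [b4] at b1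
    rw [b3] at b2
    have b5 : (2 : ZMod 4) • V.toBlocks₁₂ = Cᵀ * B - Aᵀ * D + 1 := b1.symm
    rw [b5, show (1 : Matrix ι ι (ZMod 4)) = Cᵀ * B + Aᵀ * D +
        (2 : ZMod 4) • (Gᵀ * K * G).toBlocks₁₂ - (2 : ZMod 4) • K.toBlocks₁₂ from
        eq_sub_of_add_eq b2.symm, smul_sub, smul_add, hABCD, Matrix.toBlocks_fromBlocks₁₂,
        Matrix.toBlocks_fromBlocks₂₁, two_smul _ (Cᵀ * B)]
    abel
  rw [two_smul_eq_iff_map_zmodFourToTwo] at hblock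
  have h5 : (V.map φ).toBlocks₁₂ = (G.map φ).toBlocks₂₁ᵀ * (G.map φ).toBlocks₁₂ +
      ((G.map φ)ᵀ * K.map φ * G.map φ).toBlocks₁₂ - (K.map φ).toBlocks₁₂ := by
    rw [← Matrix.transpose_map, ← hφmul, ← hφmul]
    refine Eq.trans hblock ?_
    rw [Matrix.map_sub _ (map_sub φ), Matrix.map_add _ (map_add φ), Matrix.map_mul]
    rfl
  rw [h5, Matrix.trace_sub, Matrix.trace_add, trace_toBlocks₁₂_conj hK hd hG2,
    add_sub_cancel_right] at htrV
  exact htrV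

end DetModFour

/-! ### Lattices modulo two -/

section ModTwo

variable {M : Type*} [AddCommGroup M]

theorem ModTwo.proj_surjective : Function.Surjective (ModTwo.proj M) :=
  QuotientAddGroup.mk'_surjective _

theorem ModTwo.proj_eq_zero_iff {x : M} : ModTwo.proj M x = 0 ↔ ∃ y, x = 2 • y := by
  rw [ModTwo.proj, QuotientAddGroup.mk'_apply, QuotientAddGroup.eq_zero_iff]
  exact ⟨fun ⟨y, hy⟩ => ⟨y, hy.symm⟩, fun ⟨y, hy⟩ => ⟨y, hy.symm⟩⟩

variable {ι : Type*} (b : Module.Basis ι ℤ M)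

/-- Coordinates modulo two. -/
noncomputable def ModTwo.coords : ModTwo M →+ (ι → ZMod 2) :=
  QuotientAddGroup.lift _ (AddMonoidHom.mk' (fun x i => ((b.repr x i : ℤ) : ZMod 2))
    fun x y => by ext i; simp) (by
    rintro _ ⟨x, rfl⟩
    ext i
    have h2 : (2 : ZMod 2) = 0 := rfl
    simp [h2])

theorem ModTwo.coords_proj (x : M) (i : ι) :
    ModTwo.coords b (ModTwo.proj M x) i = ((b.repr x i : ℤ) : ZMod 2) := rfl

theorem ModTwo.coords_bijective [Fintype ι] : Function.Bijective (ModTwo.coords b) := by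
  constructor
  · rw [injective_iff_map_eq_zero]
    intro a ha
    obtain ⟨x, rfl⟩ := ModTwo.proj_surjective a
    rw [ModTwo.proj_eq_zero_iff]
    have h : ∀ i, ∃ c : ℤ, b.repr x i = 2 * c := fun i =>
      (ZMod.intCast_zmod_eq_zero_iff_dvd _ 2).mp (congrFun ha i)
    choose c hc using h
    refine ⟨b.equivFun.symm c, b.equivFun.injective ?_⟩
    ext i
    rw [map_nsmul, LinearEquiv.apply_symm_apply, Module.Basis.equivFun_apply, hc]
    simp
  · intro v
    refine ⟨ModTwo.proj M (b.equivFun.symm fun i => (v i).val), ?_⟩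
    ext i
    rw [ModTwo.coords_proj, ← Module.Basis.equivFun_apply, LinearEquiv.apply_symm_apply]
    simp

/-- The basis of `M / 2M` given by a basis of `M`. -/
noncomputable def ModTwo.basis [Fintype ι] : Module.Basis ι (ZMod 2) (ModTwo M) :=
  Module.Basis.ofEquivFun
    (LinearEquiv.ofBijective ((ModTwo.coords b).toZModLinearMap 2) (ModTwo.coords_bijective b))

theorem ModTwo.basis_repr_proj [Fintype ι] (x : M) (i : ι) :
    (ModTwo.basis b).repr (ModTwo.proj M x) i = ((b.repr x i : ℤ) : ZMod 2) := rfl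

theorem ModTwo.basis_apply [Fintype ι] (i : ι) : ModTwo.basis b i = ModTwo.proj M (b i) := by
  classical
  refine (ModTwo.basis b).repr.injective ?_
  ext j
  rw [ModTwo.basis_repr_proj, Module.Basis.repr_self, Module.Basis.repr_self,
    Finsupp.single_apply, Finsupp.single_apply]
  split_ifs <;> simp

end ModTwo

/-! ### The quadratic space of a unimodular lattice and its automorphisms of determinant one -/

namespace EvenLattice

open QuadraticMap

variable (Λ : EvenLattice.{u})

noncomputable instance : Fintype (ModTwo Λ) :=
  have : Module.Finite (ZMod 2) (ModTwo Λ) :=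
    Module.Basis.finiteDimensional_of_finite (ModTwo.basis (Module.finBasis ℤ Λ))
  have : Finite (ModTwo Λ) := Module.finite_of_finite (ZMod 2)
  Fintype.ofFinite _

theorem finrank_modTwo : Module.finrank (ZMod 2) (ModTwo Λ) = Λ.rank := by
  rw [Module.finrank_eq_card_basis (ModTwo.basis (Module.finBasis ℤ Λ)), Fintype.card_fin, rank]

theorem card_modTwo : Fintype.card (ModTwo Λ) = 2 ^ Λ.rank := by
  rw [Module.card_eq_pow_finrank (K := ZMod 2), finrank_modTwo, ZMod.card]

theorem polar_q_proj (x y : Λ) :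
    polar Λ.q (ModTwo.proj Λ x) (ModTwo.proj Λ y) = (Λ.form x y : ZMod 2) :=
  Λ.polar_qFun_proj x y

variable {Λ}

/-- Half of the functional (x, ·) is integral, so unimodularity represents it by some z, and then x
= 2z. -/
theorem proj_eq_zero_of_even_form (hΛ : Λ.IsUnimodular) {x : Λ} (h : ∀ y, (2 : ℤ) ∣ Λ.form x y) :
    ModTwo.proj Λ x = 0 := by
  obtain ⟨z, hz⟩ := hΛ.2
    { toFun := fun y => Λ.form x y / 2
      map_add' := fun y y' => by rw [map_add, Int.add_ediv_of_dvd_left (h y)]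
      map_smul' := fun c y => by
        rw [map_smul, smul_eq_mul, Int.mul_ediv_assoc _ (h y)]; rfl }
  rw [ModTwo.proj_eq_zero_iff]
  refine ⟨z, hΛ.1 ?_⟩
  ext y
  have := LinearMap.congr_fun hz y
  simp only [LinearMap.coe_mk, AddHom.coe_mk] at this
  rw [two_nsmul, map_add, LinearMap.add_apply, this]
  have := h y
  omega

theorem q_nondegenerate (hΛ : Λ.IsUnimodular) (x : ModTwo Λ) (hx : ∀ y, polar Λ.q x y = 0) :
    x = 0 := by
  obtain ⟨x, rfl⟩ := ModTwo.proj_surjective x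
  refine proj_eq_zero_of_even_form hΛ fun y => ?_
  have := hx (ModTwo.proj Λ y)
  rw [polar_q_proj] at this
  exact (ZMod.intCast_zmod_eq_zero_iff_dvd _ 2).mp this

/-- The isometry of `Λ / 2Λ` induced by an automorphism of `Λ`. -/
def modTwoIsometry (σ : Λ ≃ₗ[ℤ] Λ) (hσ : σ ∈ Λ.Aut) : Λ.q.IsometryEquiv Λ.q where
  toLinearEquiv := LinearEquiv.ofLinearMap (ModTwo.map (σ : Λ →+ Λ)) (ModTwo.map (σ.symm : Λ →+ Λ))
    (LinearMap.ext fun a => by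
      obtain ⟨x, rfl⟩ := ModTwo.proj_surjective a
      exact congrArg (ModTwo.proj Λ) (σ.apply_symm_apply x))
    (LinearMap.ext fun a => by
      obtain ⟨x, rfl⟩ := ModTwo.proj_surjective a
      exact congrArg (ModTwo.proj Λ) (σ.symm_apply_apply x))
  map_app' a := by
    obtain ⟨x, rfl⟩ := ModTwo.proj_surjective a
    change Λ.q (ModTwo.proj Λ (σ x)) = _
    rw [q_proj, q_proj, Q, Q, hσ]

/-- Automorphisms of determinant one have trivial Dickson invariant. -/
theorem dicksonInvariant_modTwoIsometry (hB : HasHyperbolicBasis Λ.q) (σ : Λ ≃ₗ[ℤ] Λ)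
    (hσ : σ ∈ Λ.Aut) (hdet : LinearMap.det (σ : Λ →ₗ[ℤ] Λ) = 1) :
    dicksonInvariant Λ.q (modTwoIsometry σ hσ) = 0 := by
  obtain ⟨e, he, hD⟩ := exists_dicksonInvariant_eq hB
  rw [hD]
  have hiso := he.isHyperbolicIsometry (modTwoIsometry σ hσ)
  generalize Module.finrank (ZMod 2) (ModTwo Λ) / 2 = k at e he hiso
  have hrank : Module.finrank ℤ Λ = Fintype.card (Fin k ⊕ Fin k) := by
    rw [← Module.finrank_eq_card_basis e, finrank_modTwo, rank]
  let b : Module.Basis (Fin k ⊕ Fin k) ℤ Λ :=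
    (Module.finBasisOfFinrankEq ℤ Λ hrank).reindex (Fintype.equivFin _).symm
  -- The hyperbolic basis is lifted to vectors of Λ. The lifts need not form a basis of Λ, but their
  -- coordinate matrix P has odd determinant, so P is invertible modulo 4 and conjugation by P is
  -- available there.
  choose v hv using fun i => ModTwo.proj_surjective (e i)
  set c4 := Int.castRingHom (ZMod 4)
  set c2 := Int.castRingHom (ZMod 2)
  have hφ : ∀ A : Matrix (Fin k ⊕ Fin k) (Fin k ⊕ Fin k) ℤ,
      (A.map c4).map zmodFourToTwo = A.map c2 := fun A => by
    ext i j; simp [c4, c2]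
  set P := b.toMatrix v with hP
  set s := LinearMap.toMatrix b b (σ : Λ →ₗ[ℤ] Λ) with hs
  set S := Matrix.of (fun i j => Λ.form (b i) (b j)) with hS
  have hP2 : P.map c2 = (ModTwo.basis b).toMatrix e := by
    ext i j
    rw [Matrix.map_apply, hP, Module.Basis.toMatrix_apply, Module.Basis.toMatrix_apply, ← hv,
      ModTwo.basis_repr_proj]
    rfl
  have hunit : IsUnit (P.map c4).det := by
    have h1 : ∀ x : ZMod 4, zmodFourToTwo x ≠ 0 → IsUnit x := by decide
    refine h1 _ ?_
    rw [RingHom.map_det, RingHom.mapMatrix_apply, hφ, hP2]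
    have := (ModTwo.basis b).toMatrix_mul_toMatrix_flip e
    intro h0
    have h2 := congrArg Matrix.det this
    rw [Matrix.det_mul, h0, zero_mul, Matrix.det_one] at h2
    exact zero_ne_one h2
  have hform : ∀ x y : Λ, Λ.form x y = (b.repr x : _ → ℤ) ⬝ᵥ S *ᵥ (b.repr y : _ → ℤ) := by
    intro x y
    conv_lhs => rw [← b.sum_repr x, ← b.sum_repr y]
    simp only [map_sum, LinearMap.sum_apply, map_smul, LinearMap.smul_apply, smul_eq_mul,
      dotProduct, Matrix.mulVec, hS, Matrix.of_apply, Finset.mul_sum]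
    rw [Finset.sum_comm]
    exact Finset.sum_congr rfl fun i _ => Finset.sum_congr rfl fun j _ => by ring
  have hcong : ∀ (A : Matrix (Fin k ⊕ Fin k) (Fin k ⊕ Fin k) ℤ) i j,
      (Aᵀ * S * A) i j = (fun l => A l i) ⬝ᵥ S *ᵥ (fun l => A l j) := by
    intro A i j
    rw [mul_assoc, Matrix.mul_apply]
    rfl
  have hsS : sᵀ * S * s = S := by
    ext i j
    rw [hcong, show (fun l => s l i) = b.repr (σ (b i)) from
      funext fun l => LinearMap.toMatrix_apply b b _ l i, show (fun l => s l j) = b.repr (σ (b j))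
      from funext fun l => LinearMap.toMatrix_apply b b _ l j, ← hform, hσ]
    rfl
  have hPS : ∀ i j, (Pᵀ * S * P) i j = Λ.form (v i) (v j) := by
    intro i j
    rw [hcong, hform]
    rfl
  have hK : ∀ i j, ∃ c : ℤ, Λ.form (v i) (v j) = hyperbolicMatrix (Fin k) ℤ i j + 2 * c := by
    intro i j
    have h1 : ((Λ.form (v i) (v j) - hyperbolicMatrix (Fin k) ℤ i j : ℤ) : ZMod 2) = 0 := by
      rw [Int.cast_sub, ← polar_q_proj, hv, hv, he.polar_basis, ← map_hyperbolicMatrix c2]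
      exact sub_self _
    obtain ⟨c, hc⟩ := (ZMod.intCast_zmod_eq_zero_iff_dvd _ 2).mp h1
    exact ⟨c, by push_cast at hc; linarith⟩
  choose K hK using hK
  have hPSP : Pᵀ * S * P = hyperbolicMatrix (Fin k) ℤ + (2 : ℤ) • Matrix.of K := by
    ext i j
    rw [hPS, hK]
    rfl
  have hJsymm : ∀ i j, hyperbolicMatrix (Fin k) ℤ i j = hyperbolicMatrix (Fin k) ℤ j i := by
    rintro (i | i) (j | j) <;> simp [hyperbolicMatrix, Matrix.one_apply, eq_comm]
  have hKsymm : ∀ i j, K i j = K j i := by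
    intro i j
    have h1 := hK i j
    have h2 := hK j i
    rw [Λ.symm, hJsymm] at h1
    linarith
  -- The diagonal entry is Q (v i), whose residue modulo two is q (e i) = 0. This is where evenness
  -- of the lattice enters: the bilinear form modulo two alone would not give it.
  have hKd : ∀ i, (K i i : ZMod 2) = 0 := by
    intro i
    have h1 := hK i i
    have h2 : hyperbolicMatrix (Fin k) ℤ i i = 0 := by
      rcases i with i | i <;> rfl
    rw [h2, zero_add, ← two_mul_Q] at h1
    have h3 : K i i = Λ.Q (v i) := by linarith
    rw [h3, ← q_proj, hv, he]
    rcases i with i | i <;> simp [Finsupp.single_apply]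
  obtain ⟨G, hGdef⟩ : ∃ G, G = (P.map c4)⁻¹ * s.map c4 * P.map c4 := ⟨_, rfl⟩
  have hPG : P.map c4 * G = s.map c4 * P.map c4 := by
    rw [hGdef, ← mul_assoc, ← mul_assoc, Matrix.mul_nonsing_inv _ hunit, one_mul]
  have hG2 : G.map zmodFourToTwo = LinearMap.toMatrix e e
      ((modTwoIsometry σ hσ).toLinearEquiv : ModTwo Λ →ₗ[ZMod 2] ModTwo Λ) := by
    have h1 := congrArg (fun A => A.map zmodFourToTwo) hPG
    simp only [Matrix.map_mul, hφ] at h1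
    have hs2 : s.map c2 = LinearMap.toMatrix (ModTwo.basis b) (ModTwo.basis b)
        ((modTwoIsometry σ hσ).toLinearEquiv : ModTwo Λ →ₗ[ZMod 2] ModTwo Λ) := by
      ext i j
      rw [LinearMap.toMatrix_apply, ModTwo.basis_apply, Matrix.map_apply, hs,
        LinearMap.toMatrix_apply]
      rfl
    rw [hs2, hP2, linearMap_toMatrix_mul_basis_toMatrix] at h1
    have h2 := congrArg (fun A => e.toMatrix (ModTwo.basis b) * A) h1
    simp only [← mul_assoc, Module.Basis.toMatrix_mul_toMatrix_flip, one_mul] at h2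
    rw [h2, basis_toMatrix_mul_linearMap_toMatrix]
  have hdetG : G.det = 1 := by
    rw [hGdef, Matrix.det_mul_right_comm, Matrix.det_mul,
      Matrix.nonsing_inv_mul _ hunit, Matrix.det_one, one_mul, ← RingHom.mapMatrix_apply,
      ← RingHom.map_det, LinearMap.det_toMatrix, hdet, map_one]
  rw [← hG2]
  have hJ4 : (hyperbolicMatrix (Fin k) ℤ + (2 : ℤ) • Matrix.of K).map c4 =
      hyperbolicMatrix (Fin k) (ZMod 4) + (2 : ZMod 4) • (Matrix.of K).map c4 := by
    ext i j
    simp only [Matrix.map_apply, Matrix.add_apply, Matrix.smul_apply, smul_eq_mul, map_add,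
      map_mul, map_ofNat]
    rw [← map_hyperbolicMatrix c4, Matrix.map_apply]
  refine dicksonTrace_eq_zero_of_det_eq_one (K := (Matrix.of K).map c4) ?_ ?_ ?_ ?_ hdetG
  · rw [← hJ4, ← hPSP, Matrix.map_mul, Matrix.map_mul, Matrix.transpose_map]
    calc Gᵀ * ((P.map c4)ᵀ * S.map c4 * P.map c4) * G
        = (P.map c4 * G)ᵀ * S.map c4 * (P.map c4 * G) := by
          rw [Matrix.transpose_mul]; simp only [mul_assoc]
      _ = (P.map c4)ᵀ * (sᵀ * S * s).map c4 * P.map c4 := by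
          rw [hPG, Matrix.map_mul, Matrix.map_mul, Matrix.transpose_mul, Matrix.transpose_map]
          simp only [mul_assoc]
      _ = _ := by rw [hsS]
  · rw [hφ]
    ext i j
    simp [hKsymm i j]
  · intro i
    rw [hφ]
    exact hKd i
  · rw [hG2]; exact hiso

end EvenLattice

/-! ### Gaussian sums over integral vectors -/

section Gaussian

open Complex

/-- The quadratic form of a square matrix. -/
def quadForm {ι R : Type*} [Fintype ι] [CommRing R] (S : ι → ι → R) (x : ι → R) : R :=
  ∑ i, ∑ j, S i j * x i * x j

theorem quadForm_smul {ι R : Type*} [Fintype ι] [CommRing R] (S : ι → ι → R) (c : R) (x : ι → R) :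
    quadForm S (fun i => c * x i) = c ^ 2 * quadForm S x := by
  simp only [quadForm, Finset.mul_sum]
  exact Finset.sum_congr rfl fun i _ => Finset.sum_congr rfl fun j _ => by ring

/-- By compactness the form has a positive minimum on the unit sphere of the sup norm; homogeneity
extends the bound, and dividing by the number of coordinates compares the sup norm with the sum of
squares. -/
theorem exists_mul_sum_sq_le_quadForm {ι : Type*} [Fintype ι] (S : ι → ι → ℝ)
    (hS : ∀ x, x ≠ 0 → 0 < quadForm S x) :
    ∃ c > 0, ∀ x, c * ∑ i, x i ^ 2 ≤ quadForm S x := by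
  rcases isEmpty_or_nonempty ι with hι | hι
  · exact ⟨1, one_pos, fun x => by simp [quadForm]⟩
  have hcont : Continuous fun x : ι → ℝ => quadForm S x := by
    unfold quadForm; fun_prop
  obtain ⟨x₀, hx₀, hmin⟩ := (isCompact_sphere (0 : ι → ℝ) 1).exists_isMinOn
    (NormedSpace.sphere_nonempty.mpr zero_le_one) hcont.continuousOn
  have hx₀' : x₀ ≠ 0 := by rintro rfl; simp at hx₀
  have hN : (0 : ℝ) < Fintype.card ι := by exact_mod_cast Fintype.card_pos
  refine ⟨quadForm S x₀ / Fintype.card ι, div_pos (hS _ hx₀') hN, fun x => ?_⟩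
  by_cases hx : x = 0
  · simp [hx, quadForm]
  have hxn : 0 < ‖x‖ := norm_pos_iff.mpr hx
  have h1 : quadForm S x = ‖x‖ ^ 2 * quadForm S (fun i => ‖x‖⁻¹ * x i) := by
    rw [quadForm_smul, ← mul_assoc, ← mul_pow, mul_inv_cancel₀ hxn.ne', one_pow, one_mul]
  have h2 : quadForm S x₀ ≤ quadForm S (fun i => ‖x‖⁻¹ * x i) := by
    refine hmin ?_
    rw [mem_sphere_zero_iff_norm, show (fun i => ‖x‖⁻¹ * x i) = ‖x‖⁻¹ • x from rfl, norm_smul,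
      norm_inv, norm_norm, inv_mul_cancel₀ hxn.ne']
  have h3 : ∑ i, x i ^ 2 ≤ Fintype.card ι * ‖x‖ ^ 2 := by
    rw [← nsmul_eq_mul, Fintype.card, ← Finset.sum_const]
    refine Finset.sum_le_sum fun i _ => ?_
    rw [← sq_abs]
    exact pow_le_pow_left₀ (abs_nonneg _) (norm_le_pi_norm x i) 2
  rw [h1, div_mul_eq_mul_div, div_le_iff₀ hN]
  calc quadForm S x₀ * ∑ i, x i ^ 2 ≤ quadForm S x₀ * (Fintype.card ι * ‖x‖ ^ 2) :=
        mul_le_mul_of_nonneg_left h3 (hS _ hx₀').le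
    _ = ‖x‖ ^ 2 * quadForm S x₀ * Fintype.card ι := by ring
    _ ≤ _ := by gcongr

theorem summable_exp_neg_mul_sq {c : ℝ} (hc : 0 < c) :
    Summable fun n : ℤ => Real.exp (-(c * (n : ℝ) ^ 2)) := by
  have h := ((summable_jacobiTheta₂_term_iff 0 (I * (c / Real.pi : ℝ))).mpr (by
    simp; positivity)).norm
  refine h.congr fun n => ?_
  rw [norm_jacobiTheta₂_term]
  congr 1
  simp
  field_simp

theorem summable_exp_neg_sum_sq_fin {c : ℝ} (hc : 0 < c) (N : ℕ) :
    Summable fun x : Fin N → ℤ => Real.exp (-(c * ∑ i, (x i : ℝ) ^ 2)) := by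
  induction N with
  | zero => exact Summable.of_finite
  | succ N ih =>
    rw [← (Fin.consEquiv fun _ => ℤ).summable_iff]
    refine ((summable_exp_neg_mul_sq hc).mul_of_nonneg ih (fun _ => (Real.exp_pos _).le)
      (fun _ => (Real.exp_pos _).le)).congr fun p => ?_
    rw [← Real.exp_add]
    simp [Fin.consEquiv, Fin.sum_univ_succ]
    ring

theorem summable_exp_neg_sum_sq {ι : Type*} [Fintype ι] {c : ℝ} (hc : 0 < c) :
    Summable fun x : ι → ℤ => Real.exp (-(c * ∑ i, (x i : ℝ) ^ 2)) := by
  let e := Fintype.equivFin ι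
  rw [← (Equiv.arrowCongr e (Equiv.refl ℤ)).symm.summable_iff]
  refine (summable_exp_neg_sum_sq_fin hc (Fintype.card ι)).congr fun x => ?_
  simp only [Function.comp_apply, Equiv.arrowCongr_symm, Equiv.arrowCongr_apply]
  rw [← e.symm.sum_comp]
  simp

/-- Completing the square, half of the quadratic decay absorbs the linear term at the price of a
constant factor. -/
theorem summable_of_norm_le_gaussian {ι : Type*} [Fintype ι] {f : (ι → ℤ) → ℂ} {c : ℝ} (hc : 0 < c)
    (d : ι → ℝ) (h : ∀ x, ‖f x‖ ≤ Real.exp (-(c * ∑ i, (x i : ℝ) ^ 2) + ∑ i, d i * x i)) :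
    Summable f := by
  refine Summable.of_norm_bounded ((summable_exp_neg_sum_sq (ι := ι) (half_pos hc)).mul_left
    (Real.exp (∑ i, d i ^ 2 / (2 * c)))) fun x => (h x).trans ?_
  rw [← Real.exp_add, Real.exp_le_exp, Finset.mul_sum, Finset.mul_sum, ← Finset.sum_neg_distrib,
    ← Finset.sum_neg_distrib, ← Finset.sum_add_distrib, ← Finset.sum_add_distrib]
  refine Finset.sum_le_sum fun i _ => ?_
  have h1 : 0 ≤ (c * x i - d i) ^ 2 / (2 * c) := by positivity
  have h2 : (c * x i - d i) ^ 2 / (2 * c) = c / 2 * (x i : ℝ) ^ 2 - d i * x i + d i ^ 2 / (2 * c) := by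
    field_simp
    ring
  linarith

theorem summable_cexp_quadForm {ι : Type*} [Fintype ι] (S : ι → ι → ℝ)
    (hS : ∀ x, x ≠ 0 → 0 < quadForm S x) {τ : ℂ} (hτ : 0 < τ.im) (w : ι → ℂ) :
    Summable fun x : ι → ℤ => cexp (Real.pi * I * τ * (quadForm S (fun i => (x i : ℝ)) : ℝ) +
      2 * Real.pi * I * ∑ i, (x i : ℂ) * w i) := by
  obtain ⟨c, hc, hle⟩ := exists_mul_sum_sq_le_quadForm S hS
  refine summable_of_norm_le_gaussian (c := Real.pi * τ.im * c) (by positivity)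
    (fun i => -(2 * Real.pi * (w i).im)) fun x => ?_
  rw [Complex.norm_exp, Real.exp_le_exp, Complex.add_re]
  have h1 : (Real.pi * I * τ * (quadForm S (fun i => (x i : ℝ)) : ℝ)).re =
      -(Real.pi * τ.im * quadForm S (fun i => (x i : ℝ))) := by
    simp [mul_assoc]
  have h2 : (2 * Real.pi * I * ∑ i, (x i : ℂ) * w i).re =
      ∑ i, -(2 * Real.pi * (w i).im) * x i := by
    rw [Finset.mul_sum, Complex.re_sum]
    refine Finset.sum_congr rfl fun i _ => ?_
    simp [mul_assoc]
    ring
  rw [h1, h2]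
  have := mul_le_mul_of_nonneg_left (hle fun i => (x i : ℝ))
    (show 0 ≤ Real.pi * τ.im by positivity)
  linarith

end Gaussian

/-! ### Poisson summation for positive definite quadratic forms -/

section Poisson

open Complex

theorem quadForm_sub {ι R : Type*} [Fintype ι] [CommRing R] (T : ι → ι → R)
    (hT : ∀ i j, T i j = T j i) (v w : ι → R) :
    quadForm T (fun i => v i - w i) =
      quadForm T v - 2 * ∑ i, v i * ∑ j, T i j * w j + quadForm T w := by
  have h1 : ∑ i, v i * ∑ j, T i j * w j = ∑ i, ∑ j, T i j * v i * w j := by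
    simp only [Finset.mul_sum]
    exact Finset.sum_congr rfl fun i _ => Finset.sum_congr rfl fun j _ => by ring
  have h2 : ∑ i, v i * ∑ j, T i j * w j = ∑ i, ∑ j, T i j * w i * v j := by
    rw [h1, Finset.sum_comm]
    exact Finset.sum_congr rfl fun i _ => Finset.sum_congr rfl fun j _ => by rw [hT]; ring
  rw [two_mul]
  nth_rewrite 1 [h1]
  rw [h2]
  simp only [quadForm, ← Finset.sum_add_distrib, ← Finset.sum_sub_distrib]
  exact Finset.sum_congr rfl fun i _ => Finset.sum_congr rfl fun j _ => by ring

theorem quadForm_cons {N : ℕ} {R : Type*} [CommRing R] (S : Fin (N + 1) → Fin (N + 1) → R)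
    (hS : ∀ i j, S i j = S j i) (x₀ : R) (x : Fin N → R) :
    quadForm S (Fin.cons x₀ x : Fin (N + 1) → R) = S 0 0 * x₀ ^ 2 +
      2 * x₀ * (∑ i, S i.succ 0 * x i) + quadForm (fun i j : Fin N => S i.succ j.succ) x := by
  have h : ∑ i : Fin N, S i.succ 0 * x i = ∑ i : Fin N, S 0 i.succ * x i :=
    Finset.sum_congr rfl fun i _ => by rw [hS]
  simp only [quadForm, Fin.sum_univ_succ, Fin.cons_zero, Fin.cons_succ, Finset.sum_add_distrib]
  rw [show ∑ i : Fin N, S i.succ 0 * x i * x₀ = x₀ * ∑ i : Fin N, S i.succ 0 * x i by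
      rw [Finset.mul_sum]; exact Finset.sum_congr rfl fun i _ => by ring,
    show ∑ i : Fin N, S 0 i.succ * x₀ * x i = x₀ * ∑ i : Fin N, S i.succ 0 * x i by
      rw [h, Finset.mul_sum]; exact Finset.sum_congr rfl fun i _ => by ring]
  ring

theorem quadForm_sub_rank_one {ι R : Type*} [Fintype ι] [CommRing R] (S : ι → ι → R) (b x : ι → R)
    (c : R) : quadForm (fun i j => S i j - c * (b i * b j)) x =
      quadForm S x - c * (∑ i, b i * x i) ^ 2 := by
  rw [sq, Finset.sum_mul_sum]
  simp only [quadForm, Finset.mul_sum, ← Finset.sum_sub_distrib]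
  exact Finset.sum_congr rfl fun i _ => Finset.sum_congr rfl fun j _ => by ring

theorem ofReal_quadForm {ι : Type*} [Fintype ι] (S : ι → ι → ℝ) (x : ι → ℝ) :
    ((quadForm S x : ℝ) : ℂ) = quadForm (fun i j => (S i j : ℂ)) (fun i => (x i : ℂ)) := by
  simp [quadForm]

theorem summable_cexp_quadForm_sub {ι : Type*} [Fintype ι] (T : ι → ι → ℝ)
    (hsymm : ∀ i j, T i j = T j i)
    (hT : ∀ x, x ≠ 0 → 0 < quadForm T x) {τ : ℂ} (hτ : 0 < τ.im) (w : ι → ℂ) :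
    Summable fun y : ι → ℤ => cexp (Real.pi * I * τ *
      quadForm (fun i j => (T i j : ℂ)) (fun i => (y i : ℂ) - w i)) := by
  refine ((summable_cexp_quadForm T hT hτ (fun i => -τ * ∑ j, T i j * w j)).mul_left
    (cexp (Real.pi * I * τ * quadForm (fun i j => (T i j : ℂ)) w))).congr fun y => ?_
  rw [← Complex.exp_add, quadForm_sub _ (fun i j => by rw [hsymm]), ofReal_quadForm]
  have : ∑ i, (y i : ℂ) * (-τ * ∑ j, T i j * w j) = -τ * ∑ i, (y i : ℂ) * ∑ j, T i j * w j := by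
    rw [Finset.mul_sum]; exact Finset.sum_congr rfl fun i _ => by ring
  rw [this]
  simp only [ofReal_intCast]
  congr 1
  ring

theorem im_neg_one_div_pos {τ : ℂ} (hτ : 0 < τ.im) : 0 < (-1 / τ).im := by
  rw [neg_div, one_div, neg_im, inv_im]
  have : 0 < normSq τ := normSq_pos.mpr fun h => by simp [h] at hτ
  have := div_pos hτ this
  rw [neg_div, neg_neg]
  exact this

/-- Jacobi's functional equation, with the exponent on the right completed to a square. -/
theorem tsum_cexp_int (τ : ℂ) (hτ : 0 < τ.im) (z : ℂ) :
    ∑' n : ℤ, cexp (Real.pi * I * τ * (n : ℂ) ^ 2 + 2 * Real.pi * I * (n * z)) =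
      ((-I * τ) ^ (1 / 2 : ℂ))⁻¹ * ∑' n : ℤ, cexp (Real.pi * I * (-1 / τ) * ((n : ℂ) - z) ^ 2) := by
  have h := jacobiTheta₂_functional_equation z τ
  have hτ0 : τ ≠ 0 := fun h => by simp [h] at hτ
  unfold jacobiTheta₂ jacobiTheta₂_term at h
  rw [show (fun n : ℤ => cexp (Real.pi * I * τ * (n : ℂ) ^ 2 + 2 * Real.pi * I * (n * z))) =
    fun n : ℤ => cexp (2 * Real.pi * I * n * z + Real.pi * I * n ^ 2 * τ) from
    funext fun n => by congr 1; ring, h, one_div, mul_assoc, ← tsum_mul_left]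
  congr 1
  refine tsum_congr fun n => ?_
  rw [← Complex.exp_add]
  congr 1
  field_simp
  ring

theorem summable_cexp_int (τ : ℂ) (hτ : 0 < τ.im) (z : ℂ) :
    Summable fun n : ℤ => cexp (Real.pi * I * τ * ((n : ℂ) - z) ^ 2) := by
  refine (((summable_jacobiTheta₂_term_iff (-τ * z) τ).mpr hτ).mul_left
    (cexp (Real.pi * I * τ * z ^ 2))).congr fun n => ?_
  rw [jacobiTheta₂_term, ← Complex.exp_add]
  congr 1
  ring

theorem ofReal_mul_cpow_half {s : ℝ} (hs : 0 < s) {z : ℂ} (hz : z ≠ 0) :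
    ((s : ℂ) * z) ^ (1 / 2 : ℂ) = (Real.sqrt s : ℂ) * z ^ (1 / 2 : ℂ) := by
  rw [cpow_def_of_ne_zero (mul_ne_zero (by exact_mod_cast hs.ne') hz), cpow_def_of_ne_zero hz,
    Complex.log_ofReal_mul hs hz, add_mul, Complex.exp_add, Real.sqrt_eq_rpow,
    Real.rpow_def_of_pos hs]
  simp

/-- Poisson summation for the exponential of a positive definite quadratic form and a linear form,
up to a positive constant which depends only on the quadratic form. -/
theorem exists_tsum_cexp_quadForm_eq (N : ℕ) (S T : Fin N → Fin N → ℝ)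
    (hS : ∀ i j, S i j = S j i) (hT : ∀ i j, T i j = T j i)
    (hSpos : ∀ x, x ≠ 0 → 0 < quadForm S x) (hTpos : ∀ x, x ≠ 0 → 0 < quadForm T x)
    (hST : ∀ i j, ∑ l, S i l * T l j = if i = j then 1 else 0) :
    ∃ c : ℝ, 0 < c ∧ ∀ τ : ℂ, 0 < τ.im → ∀ w : Fin N → ℂ,
      ∑' x : Fin N → ℤ, cexp (Real.pi * I * τ * (quadForm S (fun i => (x i : ℝ)) : ℝ) +
        2 * Real.pi * I * ∑ i, (x i : ℂ) * w i) =
      c * ((-I * τ) ^ (1 / 2 : ℂ))⁻¹ ^ N * ∑' y : Fin N → ℤ, cexp (Real.pi * I * (-1 / τ) *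
        quadForm (fun i j => (T i j : ℂ)) (fun i => (y i : ℂ) - w i)) := by
  induction N with
  | zero =>
    refine ⟨1, one_pos, fun τ _ w => ?_⟩
    simp [quadForm]
  | succ N ih =>
    set s := S 0 0 with hs
    set b : Fin N → ℝ := fun i => S i.succ 0 with hb
    -- Induction by eliminating the first variable: S₂ is the Schur complement of the corner entry s
    -- of S, and its inverse is the lower right block T₂ of T = S⁻¹. Each elimination contributes
    -- one factor √s to the constant.
    set S₂ : Fin N → Fin N → ℝ := fun i j => S i.succ j.succ - s⁻¹ * (b i * b j) with hS₂
    set T₂ : Fin N → Fin N → ℝ := fun i j => T i.succ j.succ with hT₂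
    have hspos : 0 < s := by
      have h := hSpos (Fin.cons 1 0) (fun h => one_ne_zero (congrFun h 0))
      rw [quadForm_cons S hS] at h
      simpa [quadForm] using h
    have hR0 : s * T 0 0 + ∑ l, b l * T l.succ 0 = 1 := by
      have h := hST 0 0
      rw [Fin.sum_univ_succ, if_pos rfl] at h
      rw [← h]
      exact congrArg _ (Finset.sum_congr rfl fun l _ => by rw [hb, hS])
    have hR1 : ∀ j : Fin N, ∑ l, b l * T₂ l j = -(s * T 0 j.succ) := by
      intro j
      have h := hST 0 j.succ
      rw [Fin.sum_univ_succ, if_neg (Fin.succ_ne_zero j).symm] at h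
      rw [eq_neg_iff_add_eq_zero, add_comm, ← h]
      exact congrArg _ (Finset.sum_congr rfl fun l _ => by rw [hb, hS])
    have hR2 : ∀ i j : Fin N, ∑ l : Fin N, S i.succ l.succ * T₂ l j =
        (if i = j then 1 else 0) - b i * T 0 j.succ := by
      intro i j
      have h := hST i.succ j.succ
      rw [Fin.sum_univ_succ] at h
      simp only [Fin.succ_inj] at h
      rw [eq_sub_iff_add_eq, add_comm, ← h]
    have hS₂T₂ : ∀ i j, ∑ l, S₂ i l * T₂ l j = if i = j then 1 else 0 := by
      intro i j
      have h : ∑ l, S₂ i l * T₂ l j = ∑ l : Fin N, S i.succ l.succ * T₂ l j -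
          s⁻¹ * b i * ∑ l, b l * T₂ l j := by
        rw [Finset.mul_sum, ← Finset.sum_sub_distrib]
        exact Finset.sum_congr rfl fun l _ => by simp only [hS₂]; ring
      rw [h, hR1, hR2]
      field_simp
      ring
    have hS₂pos : ∀ x, x ≠ 0 → 0 < quadForm S₂ x := by
      intro x hx
      have h := hSpos (Fin.cons (-(s⁻¹ * ∑ i, b i * x i)) x)
        (fun h => hx (funext fun i => congrFun h i.succ))
      rw [quadForm_cons S hS] at h
      rw [hS₂, quadForm_sub_rank_one]
      refine h.trans_eq ?_
      rw [← hs]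
      field_simp
      ring
    have hT₂pos : ∀ x, x ≠ 0 → 0 < quadForm T₂ x := by
      intro x hx
      have h := hTpos (Fin.cons 0 x) (fun h => hx (funext fun i => congrFun h i.succ))
      rw [quadForm_cons T hT] at h
      simpa using h
    -- The matching completion of the square on the dual side; it identifies the shift produced by
    -- the first variable with a shift in the remaining ones.
    have hTquad : ∀ (v₀ : ℂ) (v : Fin N → ℂ),
        quadForm (fun i j => (T i j : ℂ)) (Fin.cons v₀ v : Fin (N + 1) → ℂ) =
        v₀ ^ 2 / s + quadForm (fun i j => (T₂ i j : ℂ)) (fun i => v i - (v₀ / s) * b i) := by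
      intro v₀ v
      have hs0 : (s : ℂ) ≠ 0 := by exact_mod_cast hspos.ne'
      rw [quadForm_cons _ fun i j => by rw [hT], quadForm_sub _ fun i j => by simp only [hT₂, hT]]
      have e1 : ∀ i, ∑ j, (T₂ i j : ℂ) * (v₀ / s * b j) = -(v₀ * T i.succ 0) := by
        intro i
        have h := hR1 i
        have h' : ∑ j, (b j : ℂ) * T₂ j i = -(s * T 0 i.succ) := by exact_mod_cast h
        calc ∑ j, (T₂ i j : ℂ) * (v₀ / s * b j) = v₀ / s * ∑ j, (b j : ℂ) * T₂ j i := by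
              rw [Finset.mul_sum]
              exact Finset.sum_congr rfl fun j _ => by simp only [hT₂, hT i.succ j.succ]; ring
          _ = _ := by rw [h', hT 0]; field_simp
      have e2 : quadForm (fun i j => (T₂ i j : ℂ)) (fun i => v₀ / s * b i) =
          -(v₀ ^ 2 / s) * (1 - s * T 0 0) := by
        have h' : (1 : ℂ) - s * T 0 0 = ∑ l, (b l : ℂ) * T l.succ 0 := by
          rw [sub_eq_iff_eq_add, add_comm]; exact_mod_cast hR0.symm
        rw [h', Finset.mul_sum, quadForm]
        refine Finset.sum_congr rfl fun i _ => ?_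
        rw [show ∑ j, (T₂ i j : ℂ) * (v₀ / s * b i) * (v₀ / s * b j) =
          (v₀ / s * b i) * ∑ j, (T₂ i j : ℂ) * (v₀ / s * b j) by
            rw [Finset.mul_sum]; exact Finset.sum_congr rfl fun j _ => by ring, e1]
        ring
      rw [e2]
      simp only [e1]
      rw [show ∑ i, v i * -(v₀ * (T i.succ 0 : ℂ)) = -(v₀ * ∑ i, (T i.succ 0 : ℂ) * v i) by
        rw [Finset.mul_sum, ← Finset.sum_neg_distrib]
        exact Finset.sum_congr rfl fun i _ => by ring]
      field_simp
      ring
    obtain ⟨c, hc, hP⟩ := ih S₂ T₂ (fun i j => by simp only [hS₂, hS i.succ j.succ]; ring)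
      (fun i j => hT _ _) hS₂pos hT₂pos hS₂T₂
    refine ⟨c / Real.sqrt s, div_pos hc (Real.sqrt_pos.mpr hspos), fun τ hτ w => ?_⟩
    have hτ0 : τ ≠ 0 := fun h => by simp [h] at hτ
    have hs0 : (s : ℂ) ≠ 0 := by exact_mod_cast hspos.ne'
    have hτs : 0 < (s * τ : ℂ).im := by rw [Complex.im_ofReal_mul]; positivity
    set w' : Fin N → ℂ := fun i => w i.succ with hw'
    -- The intermediate double series: the first variable has been replaced by its dual y, while the
    -- remaining variables x are still untransformed. Interchanging the sums makes the induction
    -- hypothesis applicable for each fixed y.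
    let F : (Fin N → ℤ) → ℤ → ℂ := fun x y =>
      cexp (Real.pi * I * τ * (quadForm S₂ (fun i => (x i : ℝ)) : ℝ) +
        2 * Real.pi * I * ∑ i, (x i : ℂ) * (w' i + ((y : ℂ) - w 0) / s * b i)) *
      cexp (Real.pi * I * (-1 / (s * τ)) * ((y : ℂ) - w 0) ^ 2)
    have hF : Summable (Function.uncurry F) := by
      have h1 := (summable_cexp_quadForm S₂ hS₂pos hτ fun i => w' i - w 0 / s * b i).norm
      have h2 := (summable_cexp_int (-1 / (s * τ)) (im_neg_one_div_pos hτs) (w 0)).norm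
      refine Summable.of_norm ((h1.mul_of_nonneg h2 (fun _ => norm_nonneg _)
        (fun _ => norm_nonneg _)).congr fun p => ?_)
      rw [Function.uncurry, norm_mul]
      congr 1
      rw [Complex.norm_exp, Complex.norm_exp]
      congr 1
      rw [Complex.add_re, Complex.add_re]
      congr 1
      -- The dependence of the linear term on y is a pure phase, so the norm of F splits into a
      -- product of a function of x and a function of y.
      have h3 : 2 * Real.pi * I * ∑ i, (p.1 i : ℂ) * (w' i + ((p.2 : ℂ) - w 0) / s * b i) =
          2 * Real.pi * I * ∑ i, (p.1 i : ℂ) * (w' i - w 0 / s * b i) +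
          (2 * Real.pi * (∑ i, (p.1 i : ℝ) * ((p.2 : ℝ) / s * b i)) : ℝ) * I := by
        push_cast
        simp only [Finset.mul_sum, Finset.sum_mul, ← Finset.sum_add_distrib]
        exact Finset.sum_congr rfl fun i _ => by ring
      rw [h3, Complex.add_re, Complex.re_ofReal_mul]
      simp
    let e : (Fin N → ℤ) × ℤ ≃ (Fin (N + 1) → ℤ) := 
      (Equiv.prodComm _ _).trans (Fin.consEquiv fun _ => ℤ)
    have he : ∀ x y, e (x, y) = Fin.cons y x := fun _ _ => rfl
    have hinner : ∀ x : Fin N → ℤ, ∑' x₀ : ℤ, cexp (Real.pi * I * τ *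
        (quadForm S (fun i => ((Fin.cons x₀ x : Fin (N + 1) → ℤ) i : ℝ)) : ℝ) +
        2 * Real.pi * I * ∑ i, ((Fin.cons x₀ x : Fin (N + 1) → ℤ) i : ℂ) * w i) =
        ((-I * (s * τ)) ^ (1 / 2 : ℂ))⁻¹ * ∑' y, F x y := by
      intro x
      have hβ : ((∑ i, b i * (x i : ℝ) : ℝ) : ℂ) = ∑ i, (x i : ℂ) * b i := by
        push_cast; exact Finset.sum_congr rfl fun i _ => mul_comm _ _
      set β : ℝ := ∑ i, b i * (x i : ℝ) with hβdef
      have h1 := tsum_cexp_int (s * τ) hτs (τ * β + w 0)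
      have h2 := congrArg (fun z => cexp (Real.pi * I * τ * (quadForm
        (fun i j : Fin N => S i.succ j.succ) (fun i => (x i : ℝ)) : ℝ) +
        2 * Real.pi * I * ∑ i, (x i : ℂ) * w' i) * z) h1
      convert h2 using 1
      · rw [← tsum_mul_left]
        refine tsum_congr fun x₀ => ?_
        rw [← Complex.exp_add]
        congr 1
        have : (fun i => ((Fin.cons x₀ x : Fin (N + 1) → ℤ) i : ℝ)) =
            (Fin.cons (x₀ : ℝ) (fun i => (x i : ℝ)) : Fin (N + 1) → ℝ) := by
          ext i; refine Fin.cases ?_ (fun i => ?_) i <;> simp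
        rw [this, quadForm_cons S hS, Fin.sum_univ_succ]
        simp only [Fin.cons_zero, Fin.cons_succ]
        push_cast [hw', hβdef]
        ring
      · rw [mul_left_comm (cexp _)]
        congr 1
        rw [← tsum_mul_left]
        refine tsum_congr fun y => ?_
        simp only [F]
        rw [← Complex.exp_add, ← Complex.exp_add]
        congr 1
        rw [hS₂, quadForm_sub_rank_one]
        have h3 : ∑ i, (x i : ℂ) * (w' i + ((y : ℂ) - w 0) / s * b i) =
            ∑ i, (x i : ℂ) * w' i + ((y : ℂ) - w 0) / s * β := by
          rw [hβ, Finset.mul_sum, ← Finset.sum_add_distrib]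
          exact Finset.sum_congr rfl fun i _ => by ring
        rw [h3]
        push_cast [hβdef]
        field_simp
        ring
    have hG := summable_cexp_quadForm_sub T hT hTpos (im_neg_one_div_pos hτ) w
    rw [← e.tsum_eq, ← (Fin.consEquiv fun _ => ℤ).tsum_eq]
    have hL := e.summable_iff.mpr (summable_cexp_quadForm S hSpos hτ w)
    have hR := (Fin.consEquiv fun _ => ℤ).summable_iff.mpr hG
    simp only [Function.comp_def] at hL hR
    rw [hL.tsum_prod, hR.tsum_prod]
    simp only [he, hinner]
    rw [tsum_mul_left, ← Summable.tsum_comm hF]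
    have hsq : ((-I * (s * τ)) ^ (1 / 2 : ℂ))⁻¹ =
        (Real.sqrt s : ℂ)⁻¹ * ((-I * τ) ^ (1 / 2 : ℂ))⁻¹ := by
      rw [show -I * (s * τ) = s * (-I * τ) by ring, ofReal_mul_cpow_half hspos (by simp [hτ0]),
        mul_inv]
    rw [hsq]
    have hlast : ∀ y : ℤ, ∑' x, F x y = c * ((-I * τ) ^ (1 / 2 : ℂ))⁻¹ ^ N *
        ∑' x : Fin N → ℤ, cexp (Real.pi * I * (-1 / τ) * quadForm (fun i j => (T i j : ℂ))
          (fun i => (((Fin.consEquiv fun _ => ℤ) (y, x) : Fin (N + 1) → ℤ) i : ℂ) - w i)) := by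
      intro y
      simp only [F]
      rw [tsum_mul_right, hP τ hτ, mul_assoc, ← tsum_mul_right]
      congr 1
      refine tsum_congr fun x => ?_
      rw [← Complex.exp_add]
      congr 1
      have : (fun i => (((Fin.consEquiv fun _ => ℤ) (y, x) : Fin (N + 1) → ℤ) i : ℂ) - w i) =
          (Fin.cons ((y : ℂ) - w 0) (fun i => (x i : ℂ) - w' i) : Fin (N + 1) → ℂ) := by
        ext i; refine Fin.cases ?_ (fun i => ?_) i <;> simp [Fin.consEquiv, hw']
      rw [this, hTquad]
      simp only [sub_sub]
      generalize quadForm (fun i j => (T₂ i j : ℂ)) _ = Q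
      field_simp
      ring
    simp only [hlast]
    rw [tsum_mul_left]
    push_cast
    ring

end Poisson

/-! ### Convergence of theta series -/

section QuadFormBounds

theorem quadForm_eq_dotProduct {ι R : Type*} [Fintype ι] [CommRing R] (S : ι → ι → R)
    (x : ι → R) : quadForm S x = x ⬝ᵥ Matrix.of S *ᵥ x := by
  simp only [quadForm, dotProduct, Matrix.mulVec, Finset.mul_sum, Matrix.of_apply]
  exact Finset.sum_congr rfl fun i _ => Finset.sum_congr rfl fun j _ => by ring

theorem Matrix.PosDef.quadForm_pos {ι : Type*} [Fintype ι] {S : ι → ι → ℝ}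
    (hS : (Matrix.of S).PosDef)
    (x : ι → ℝ) (hx : x ≠ 0) : 0 < quadForm S x := by
  rw [quadForm_eq_dotProduct]
  simpa using hS.dotProduct_mulVec_pos hx

theorem Matrix.PosSemidef.quadForm_nonneg {ι : Type*} [Fintype ι] {S : ι → ι → ℝ}
    (hS : (Matrix.of S).PosSemidef) (x : ι → ℝ) : 0 ≤ quadForm S x := by
  rw [quadForm_eq_dotProduct]
  simpa using hS.dotProduct_mulVec_nonneg x

theorem exists_abs_quadForm_le {ι : Type*} [Fintype ι] (S : ι → ι → ℝ) :
    ∃ C, 0 < C ∧ ∀ x, |quadForm S x| ≤ C * ∑ i, x i ^ 2 := by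
  have h0 : 0 ≤ ∑ i, ∑ j, |S i j| := by positivity
  refine ⟨∑ i, ∑ j, |S i j| + 1, by linarith, fun x => ?_⟩
  have hle : ∀ i, x i ^ 2 ≤ ∑ i, x i ^ 2 := fun i =>
    Finset.single_le_sum (f := fun i => x i ^ 2) (fun i _ => sq_nonneg _) (Finset.mem_univ i)
  have h1 : |quadForm S x| ≤ ∑ i, ∑ j, |S i j| * ∑ i, x i ^ 2 := by
    refine (Finset.abs_sum_le_sum_abs _ _).trans (Finset.sum_le_sum fun i _ =>
      (Finset.abs_sum_le_sum_abs _ _).trans (Finset.sum_le_sum fun j _ => ?_))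
    rw [mul_assoc, abs_mul]
    refine mul_le_mul_of_nonneg_left ?_ (abs_nonneg _)
    rw [abs_mul]
    nlinarith [hle i, hle j, sq_abs (x i), sq_abs (x j), sq_nonneg (|x i| - |x j|)]
  have h2 : ∑ i, ∑ j, |S i j| * ∑ i, x i ^ 2 = (∑ i, ∑ j, |S i j|) * ∑ i, x i ^ 2 := by
    simp only [Finset.sum_mul]
  have h3 : 0 ≤ ∑ i, x i ^ 2 := by positivity
  linarith

end QuadFormBounds

namespace EvenLattice

open Complex

variable (Λ : EvenLattice.{u})

/-- The real Gram matrix of a basis. -/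
noncomputable def realGram {ι : Type*} (b : Module.Basis ι ℤ Λ) : ι → ι → ℝ :=
  fun i j => (Λ.form (b i) (b j) : ℝ)

theorem form_eq_sum_repr {ι : Type*} [Fintype ι] (b : Module.Basis ι ℤ Λ) (x y : Λ) :
    Λ.form x y = ∑ i, ∑ j, Λ.form (b i) (b j) * b.repr x i * b.repr y j := by
  conv_lhs => rw [← b.sum_repr x, ← b.sum_repr y]
  simp only [map_sum, LinearMap.sum_apply, map_smul, LinearMap.smul_apply, smul_eq_mul]
  rw [Finset.sum_comm]
  simp only [Finset.mul_sum]
  exact Finset.sum_congr rfl fun i _ => Finset.sum_congr rfl fun j _ => by ring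

theorem quadForm_realGram {ι : Type*} [Fintype ι] (b : Module.Basis ι ℤ Λ) (x : Λ) :
    quadForm (Λ.realGram b) (fun i => (b.repr x i : ℝ)) = Λ.form x x := by
  rw [Λ.form_eq_sum_repr b, quadForm]
  push_cast
  rfl

theorem quadForm_realGram_rat {ι : Type*} [Fintype ι] (b : Module.Basis ι ℤ Λ) (x : ι → ℚ) :
    0 ≤ quadForm (Λ.realGram b) (fun i => (x i : ℝ)) := by
  set d : ℕ := ∏ i, (x i).den
  have hd : (0 : ℝ) < d := by
    exact_mod_cast Finset.prod_pos fun i _ => (x i).den_pos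
  have hz : ∀ i, ∃ z : ℤ, (d : ℝ) * x i = z := by
    intro i
    obtain ⟨c, hc⟩ : (x i).den ∣ d := Finset.dvd_prod_of_mem _ (Finset.mem_univ i)
    refine ⟨c * (x i).num, ?_⟩
    rw [hc]
    have h := Rat.mul_den_eq_num (x i)
    have h' : (x i : ℝ) * (x i).den = (x i).num := by exact_mod_cast h
    push_cast
    rw [← h']
    ring
  choose z hz using hz
  have h1 := Λ.quadForm_realGram b (b.equivFun.symm z)
  have h2 : (fun i => ((b.repr (b.equivFun.symm z) i : ℤ) : ℝ)) = fun i => (d : ℝ) * x i := by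
    ext i
    rw [hz, ← b.equivFun_apply, LinearEquiv.apply_symm_apply]
  rw [h2, quadForm_smul] at h1
  have h3 : 0 ≤ Λ.form (b.equivFun.symm z) (b.equivFun.symm z) := by
    by_cases h : b.equivFun.symm z = 0
    · simp [h]
    · exact (Λ.pos _ h).le
  have h4 : (0 : ℝ) ≤ d ^ 2 * quadForm (Λ.realGram b) (fun i => (x i : ℝ)) := by
    rw [h1]; exact_mod_cast h3
  exact nonneg_of_mul_nonneg_right h4 (by positivity)

/-- Positivity is known only on lattice vectors. Clearing denominators and density give a
nonnegative real form; if it were degenerate, its integral Gram matrix would have a nonzero integral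
kernel vector, on which the form is positive. -/
theorem posDef_realGram {ι : Type*} [Fintype ι] (b : Module.Basis ι ℤ Λ) :
    (Matrix.of (Λ.realGram b)).PosDef := by
  classical
  have hnonneg : ∀ x, 0 ≤ quadForm (Λ.realGram b) x := by
    intro x
    have hcont : Continuous fun x : ι → ℝ => quadForm (Λ.realGram b) x := by
      unfold quadForm; fun_prop
    have hcl : IsClosed {x : ι → ℝ | 0 ≤ quadForm (Λ.realGram b) x} :=
      isClosed_le continuous_const hcont
    have hd : DenseRange fun (x : ι → ℚ) i => (x i : ℝ) :=
      DenseRange.piMap fun _ => Rat.denseRange_cast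
    exact hd.induction_on (p := fun x => 0 ≤ quadForm (Λ.realGram b) x) x hcl
      (Λ.quadForm_realGram_rat b)
  have hpsd : (Matrix.of (Λ.realGram b)).PosSemidef := by
    refine Matrix.PosSemidef.of_dotProduct_mulVec_nonneg ?_ fun x => ?_
    · ext i j
      simp [realGram, Λ.symm (b j) (b i)]
    · rw [star_trivial, ← quadForm_eq_dotProduct]
      exact hnonneg x
  rw [hpsd.posDef_iff_det_ne_zero]
  intro hdet
  have hmap : Matrix.of (Λ.realGram b) =
      (Matrix.of fun i j => Λ.form (b i) (b j)).map (Int.castRingHom ℝ) := by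
    ext i j; simp [realGram]
  rw [hmap, ← RingHom.mapMatrix_apply, ← RingHom.map_det] at hdet
  have hdet' : (Matrix.of fun i j => Λ.form (b i) (b j)).det = 0 := by
    simpa using hdet
  obtain ⟨v, hv, hv0⟩ := Matrix.exists_mulVec_eq_zero_iff.mpr hdet'
  have hx : b.equivFun.symm v ≠ 0 := by
    rwa [ne_eq, LinearEquiv.map_eq_zero_iff]
  have hpos := Λ.pos _ hx
  rw [Λ.form_eq_sum_repr b] at hpos
  simp only [← b.equivFun_apply, LinearEquiv.apply_symm_apply] at hpos
  have : ∑ i, ∑ j, Λ.form (b i) (b j) * v i * v j = ∑ i, v i *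
      ((Matrix.of fun i j => Λ.form (b i) (b j)) *ᵥ v) i := by
    refine Finset.sum_congr rfl fun i _ => ?_
    rw [Matrix.mulVec, dotProduct, Finset.mul_sum]
    exact Finset.sum_congr rfl fun j _ => by rw [Matrix.of_apply]; ring
  rw [this, hv0] at hpos
  simp at hpos

/-- The value `tr (T(g) Y)` for real `Y`. -/
def energy {n : ℕ} (Y : Matrix (Fin n) (Fin n) ℝ) (g : Fin n → Λ) : ℝ :=
  ∑ i, ∑ j, (Λ.form (g i) (g j) : ℝ) * Y i j

/-- Tuples of lattice vectors in coordinates. -/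
noncomputable def tupleEquiv (n : ℕ) :
    (Fin n → Λ) ≃ (Fin n × Fin (Module.finrank ℤ Λ) → ℤ) :=
  (Equiv.piCongrRight fun _ => (Module.finBasis ℤ Λ).equivFun.toEquiv).trans
    (Equiv.curry _ _ _).symm

theorem tupleEquiv_apply {n : ℕ} (g : Fin n → Λ) (p : Fin n × Fin (Module.finrank ℤ Λ)) :
    Λ.tupleEquiv n g p = (Module.finBasis ℤ Λ).repr (g p.1) p.2 := rfl

/-- The matrix of `g ↦ tr (T(g) Y)` in coordinates. -/
noncomputable def energyMatrix {n : ℕ} (Y : Matrix (Fin n) (Fin n) ℝ) :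
    Fin n × Fin (Module.finrank ℤ Λ) → Fin n × Fin (Module.finrank ℤ Λ) → ℝ :=
  fun p p' => Y p.1 p'.1 * Λ.realGram (Module.finBasis ℤ Λ) p.2 p'.2

open scoped Kronecker in
theorem energy_eq_quadForm {n : ℕ} (Y : Matrix (Fin n) (Fin n) ℝ) (g : Fin n → Λ) :
    Λ.energy Y g = quadForm (Λ.energyMatrix Y)
      (fun p => (Λ.tupleEquiv n g p : ℝ)) := by
  simp only [energy, quadForm, Fintype.sum_prod_type, energyMatrix, tupleEquiv_apply]
  refine Finset.sum_congr rfl fun i _ => ?_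
  rw [Finset.sum_comm]
  refine Finset.sum_congr rfl fun j _ => ?_
  rw [Λ.form_eq_sum_repr (Module.finBasis ℤ Λ)]
  push_cast
  simp only [Finset.sum_mul]
  exact Finset.sum_congr rfl fun k _ => Finset.sum_congr rfl fun l _ => by
    simp only [realGram]; ring

/-- In coordinates the energy is the quadratic form of the Kronecker product of Y and a Gram matrix,
and a Kronecker product of positive definite matrices is positive definite. -/
theorem exists_le_energy {n : ℕ} {Y : Matrix (Fin n) (Fin n) ℝ} (hY : Y.PosDef) :
    ∃ c > 0, ∀ g : Fin n → Λ, c * ∑ p, (Λ.tupleEquiv n g p : ℝ) ^ 2 ≤ Λ.energy Y g := by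
  obtain ⟨c, hc, h⟩ := exists_mul_sum_sq_le_quadForm (Λ.energyMatrix Y)
    (Matrix.PosDef.quadForm_pos (hY.kronecker (Λ.posDef_realGram (Module.finBasis ℤ Λ))))
  exact ⟨c, hc, fun g => by rw [energy_eq_quadForm]; exact h _⟩

theorem energy_mono {n : ℕ} {Y Y' : Matrix (Fin n) (Fin n) ℝ} (hY : (Y' - Y).PosSemidef)
    (g : Fin n → Λ) : Λ.energy Y g ≤ Λ.energy Y' g := by
  have h1 := Matrix.PosSemidef.quadForm_nonneg (S := Λ.energyMatrix (Y' - Y))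
    (hY.kronecker (Λ.posDef_realGram (Module.finBasis ℤ Λ)).posSemidef)
    (fun p => (Λ.tupleEquiv n g p : ℝ))
  rw [← energy_eq_quadForm] at h1
  have h2 : Λ.energy (Y' - Y) g = Λ.energy Y' g - Λ.energy Y g := by
    simp only [energy, ← Finset.sum_sub_distrib, Matrix.sub_apply, mul_sub]
  linarith

theorem summable_exp_neg_energy {n : ℕ} {Y : Matrix (Fin n) (Fin n) ℝ} (hY : Y.PosDef) {a : ℝ}
    (ha : 0 < a) : Summable fun g : Fin n → Λ => Real.exp (-(a * Λ.energy Y g)) := by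
  obtain ⟨c, hc, h⟩ := Λ.exists_le_energy hY
  have h1 := (Λ.tupleEquiv n).summable_iff.mpr
    (summable_exp_neg_sum_sq (ι := Fin n × Fin (Module.finrank ℤ Λ)) (mul_pos ha hc))
  refine Summable.of_nonneg_of_le (fun _ => (Real.exp_pos _).le) (fun g => ?_) h1
  rw [Function.comp_apply, Real.exp_le_exp, neg_le_neg_iff, mul_assoc]
  exact mul_le_mul_of_nonneg_left (h g) ha.le

/-- The value `tr (T(g) Z)` for complex `Z`. -/
theorem trace_gram_mul {n : ℕ} (g : Fin n → Λ) (Z : Matrix (Fin n) (Fin n) ℂ) :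
    ((Λ.gram g).map (Int.cast : ℤ → ℂ) * Z).trace =
      ∑ i, ∑ j, (Λ.form (g i) (g j) : ℂ) * Z i j := by
  rw [Matrix.trace]
  simp only [Matrix.diag_apply, Matrix.mul_apply, Matrix.map_apply, gram, Matrix.of_apply]
  rw [Finset.sum_comm]
  exact Finset.sum_congr rfl fun i _ => Finset.sum_congr rfl fun j _ => by rw [Λ.symm]

theorem im_trace_gram_mul {n : ℕ} (g : Fin n → Λ) (Z : Matrix (Fin n) (Fin n) ℂ) :
    (((Λ.gram g).map (Int.cast : ℤ → ℂ) * Z).trace).im = Λ.energy (Z.map Complex.im) g := by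
  rw [trace_gram_mul, energy, Complex.im_sum]
  refine Finset.sum_congr rfl fun i _ => ?_
  rw [Complex.im_sum]
  refine Finset.sum_congr rfl fun j _ => ?_
  rw [← Complex.ofReal_intCast, Complex.im_ofReal_mul, Matrix.map_apply]

theorem norm_cexp_trace {n : ℕ} (g : Fin n → Λ) (Z : Matrix (Fin n) (Fin n) ℂ) (κ : ℝ) :
    ‖cexp (κ * I * ((Λ.gram g).map (Int.cast : ℤ → ℂ) * Z).trace)‖ =
      Real.exp (-(κ * Λ.energy (Z.map Complex.im) g)) := by
  rw [Complex.norm_exp, ← im_trace_gram_mul, mul_assoc, Complex.re_ofReal_mul]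
  simp

end EvenLattice

/-! ### Convergence, boundedness and holomorphy of weighted theta series -/

namespace EvenLattice

open Complex

variable (Λ : EvenLattice.{u})

theorem summable_mul_cexp_trace {n : ℕ} {a : (Fin n → Λ) → ℂ} (ha : ∀ g, ‖a g‖ ≤ 1) {κ : ℝ}
    (hκ : 0 < κ) {Z : Matrix (Fin n) (Fin n) ℂ} (hZ : Z ∈ siegelUpperHalfSpace n) :
    Summable fun g => a g * cexp (κ * I * ((Λ.gram g).map (Int.cast : ℤ → ℂ) * Z).trace) := by
  refine Summable.of_norm_bounded (Λ.summable_exp_neg_energy hZ.2 hκ) fun g => ?_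
  rw [norm_mul, norm_cexp_trace]
  exact mul_le_of_le_one_left (Real.exp_pos _).le (ha g)

/-- Termwise, the energy can only grow when Im Z increases beyond Y₀, so the absolute series at Y₀
bounds everything. -/
theorem exists_norm_tsum_cexp_trace_le {n : ℕ} {a : (Fin n → Λ) → ℂ} (ha : ∀ g, ‖a g‖ ≤ 1) {κ : ℝ}
    (hκ : 0 < κ) {Y₀ : Matrix (Fin n) (Fin n) ℝ} (hY₀ : Y₀.PosDef) :
    ∃ c : ℝ, ∀ Z ∈ siegelUpperHalfSpace n, (Z.map Complex.im - Y₀).PosSemidef →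
      ‖∑' g, a g * cexp (κ * I * ((Λ.gram g).map (Int.cast : ℤ → ℂ) * Z).trace)‖ ≤ c := by
  refine ⟨∑' g : Fin n → Λ, Real.exp (-(κ * Λ.energy Y₀ g)), fun Z _ hY => ?_⟩
  refine tsum_of_norm_bounded (Λ.summable_exp_neg_energy hY₀ hκ).hasSum fun g => ?_
  rw [norm_mul, norm_cexp_trace]
  refine (mul_le_of_le_one_left (Real.exp_pos _).le (ha g)).trans ?_
  rw [Real.exp_le_exp, neg_le_neg_iff]
  exact mul_le_mul_of_nonneg_left (Λ.energy_mono hY g) hκ.le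

theorem exists_sum_abs_form_le (n : ℕ) : ∃ C > 0, ∀ g : Fin n → Λ,
    ∑ i, ∑ j, |(Λ.form (g i) (g j) : ℝ)| ≤ C * ∑ p, (Λ.tupleEquiv n g p : ℝ) ^ 2 := by
  have h : ∀ i j : Fin n, ∃ C, 0 < C ∧ ∀ g : Fin n → Λ,
      |(Λ.form (g i) (g j) : ℝ)| ≤ C * ∑ p, (Λ.tupleEquiv n g p : ℝ) ^ 2 := by
    intro i j
    obtain ⟨C, hC, h⟩ := exists_abs_quadForm_le (Λ.energyMatrix (Matrix.single i j 1))
    refine ⟨C, hC, fun g => ?_⟩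
    have h1 := h (fun p => (Λ.tupleEquiv n g p : ℝ))
    rw [← energy_eq_quadForm] at h1
    convert h1
    simp [energy, Matrix.single_apply, ite_and]
  choose C hC h using h
  have h0 : 0 ≤ ∑ i, ∑ j, C i j :=
    Finset.sum_nonneg fun i _ => Finset.sum_nonneg fun j _ => (hC i j).le
  refine ⟨∑ i, ∑ j, C i j + 1, by linarith, fun g => ?_⟩
  have h1 : ∑ i, ∑ j, |(Λ.form (g i) (g j) : ℝ)| ≤
      (∑ i, ∑ j, C i j) * ∑ p, (Λ.tupleEquiv n g p : ℝ) ^ 2 := by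
    simp only [Finset.sum_mul]
    exact Finset.sum_le_sum fun i _ => Finset.sum_le_sum fun j _ => h i j g
  have h2 : 0 ≤ ∑ p, (Λ.tupleEquiv n g p : ℝ) ^ 2 := by positivity
  linarith

/-- The linear form `Z ↦ tr (T(g) Z)`. -/
noncomputable def traceLinear {n : ℕ} (g : Fin n → Λ) : (Fin n → Fin n → ℂ) →L[ℂ] ℂ :=
  ∑ i, ∑ j, (Λ.form (g i) (g j) : ℂ) •
    ((ContinuousLinearMap.proj j : (Fin n → ℂ) →L[ℂ] ℂ).comp
      (ContinuousLinearMap.proj i : (Fin n → Fin n → ℂ) →L[ℂ] (Fin n → ℂ)))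

theorem traceLinear_apply {n : ℕ} (g : Fin n → Λ) (Z : Fin n → Fin n → ℂ) :
    Λ.traceLinear g Z = ∑ i, ∑ j, (Λ.form (g i) (g j) : ℂ) * Z i j := by
  simp [traceLinear]

theorem norm_traceLinear_apply_le {n : ℕ} (g : Fin n → Λ) (Z : Fin n → Fin n → ℂ) :
    ‖Λ.traceLinear g Z‖ ≤ (∑ i, ∑ j, |(Λ.form (g i) (g j) : ℝ)|) * ‖Z‖ := by
  rw [traceLinear_apply]
  simp only [Finset.sum_mul]
  refine (norm_sum_le _ _).trans (Finset.sum_le_sum fun i _ => (norm_sum_le _ _).trans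
    (Finset.sum_le_sum fun j _ => ?_))
  rw [norm_mul, Complex.norm_intCast]
  exact mul_le_mul_of_nonneg_left ((norm_le_pi_norm (Z i) j).trans (norm_le_pi_norm Z i))
    (abs_nonneg _)

/-- The series is differentiated term by term on a ball in the space of all matrices, not only the
symmetric ones. The radius c / (2C) ensures that Im tr (T(g) Z) keeps at least half of its lower
bound c · s(g) at the centre. -/
theorem differentiableAt_tsum_cexp_traceLinear {n : ℕ} {a : (Fin n → Λ) → ℂ}
    (ha : ∀ g, ‖a g‖ ≤ 1) {κ : ℝ} (hκ : 0 < κ) {Z₀ : Fin n → Fin n → ℂ}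
    (hZ₀ : Matrix.of Z₀ ∈ siegelUpperHalfSpace n) :
    DifferentiableAt ℂ (fun Z : Fin n → Fin n → ℂ =>
      ∑' g, a g * cexp (κ * I * Λ.traceLinear g Z)) Z₀ := by
  obtain ⟨c, hc, hlow⟩ := Λ.exists_le_energy hZ₀.2
  obtain ⟨C, hC, hup⟩ := Λ.exists_sum_abs_form_le n
  let s : (Fin n → Λ) → ℝ := fun g => ∑ p, (Λ.tupleEquiv n g p : ℝ) ^ 2
  have hs : ∀ g, 0 ≤ s g := fun g => by positivity
  have hsum := (Λ.tupleEquiv n).summable_iff.mpr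
    (summable_exp_neg_sum_sq (ι := Fin n × Fin (Module.finrank ℤ Λ))
      (show 0 < κ * c / 4 by positivity))
  have hnorm : ∀ g, ∀ Z ∈ Metric.ball Z₀ (c / (2 * C)),
      ‖cexp (κ * I * Λ.traceLinear g Z)‖ ≤ Real.exp (-(κ * c / 2 * s g)) := by
    intro g Z hZ
    rw [Complex.norm_exp, Real.exp_le_exp]
    have h1 : (Λ.traceLinear g Z₀).im = Λ.energy ((Matrix.of Z₀).map Complex.im) g := by
      rw [traceLinear_apply, ← im_trace_gram_mul, trace_gram_mul]
      rfl
    have h2 : |(Λ.traceLinear g Z).im - (Λ.traceLinear g Z₀).im| ≤ C * s g * (c / (2 * C)) := by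
      rw [← Complex.sub_im, ← map_sub]
      refine (Complex.abs_im_le_norm _).trans ((Λ.norm_traceLinear_apply_le g _).trans ?_)
      rw [Metric.mem_ball, dist_eq_norm] at hZ
      exact mul_le_mul (hup g) hZ.le (norm_nonneg _) (mul_nonneg hC.le (hs g))
    have h3 : C * s g * (c / (2 * C)) = c / 2 * s g := by field_simp
    rw [h3, abs_le] at h2
    have h4 := hlow g
    have h5 : c / 2 * s g ≤ (Λ.traceLinear g Z).im := by
      have : c * s g ≤ Λ.energy ((Matrix.of Z₀).map Complex.im) g := h4
      linarith [h2.1]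
    have h6 := mul_le_mul_of_nonneg_left h5 hκ.le
    rw [mul_assoc, Complex.re_ofReal_mul]
    simp only [Complex.I_mul_re]
    linarith
  refine (hasFDerivAt_tsum_of_isPreconnected (𝕜 := ℂ)
    (f := fun g Z => a g * cexp (κ * I * Λ.traceLinear g Z))
    (f' := fun g Z => a g • cexp (κ * I * Λ.traceLinear g Z) • ((κ : ℂ) * I) • Λ.traceLinear g)
    (hsum.mul_left (κ * C * (4 / (κ * c)))) (Metric.isOpen_ball (x := Z₀)
      (ε := c / (2 * C))) (convex_ball _ _).isPreconnected ?_ ?_ (Metric.mem_ball_self (by positivity))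
      ?_ (Metric.mem_ball_self (by positivity))).differentiableAt
  · intro g Z _
    exact (((Λ.traceLinear g).hasFDerivAt.const_mul (κ * I)).cexp).const_mul (a g)
  · intro g Z hZ
    have h1 : ‖Λ.traceLinear g‖ ≤ C * s g :=
      (ContinuousLinearMap.opNorm_le_bound _ (by positivity) (Λ.norm_traceLinear_apply_le g)).trans
        (hup g)
    rw [norm_smul, norm_smul, norm_smul, norm_mul, Complex.norm_I, mul_one, Complex.norm_real,
      Real.norm_of_nonneg hκ.le]
    -- Differentiation produces a factor of size s(g); half of the remaining Gaussian decay pays for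
    -- it, by 1 + x ≤ exp x.
    have h2 : s g ≤ 4 / (κ * c) * Real.exp (κ * c / 4 * s g) := by
      have h := (Real.add_one_le_exp (κ * c / 4 * s g))
      rw [div_mul_eq_mul_div, le_div_iff₀ (by positivity)]
      nlinarith
    have h3 : Real.exp (-(κ * c / 2 * s g)) * Real.exp (κ * c / 4 * s g) =
        Real.exp (-(κ * c / 4 * s g)) := by
      rw [← Real.exp_add]; congr 1; ring
    calc ‖a g‖ * (‖cexp (κ * I * Λ.traceLinear g Z)‖ * (κ * ‖Λ.traceLinear g‖))
        ≤ 1 * (Real.exp (-(κ * c / 2 * s g)) * (κ * (C * (4 / (κ * c) *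
            Real.exp (κ * c / 4 * s g))))) := by
          refine mul_le_mul (ha g) (mul_le_mul (hnorm g Z hZ) (mul_le_mul_of_nonneg_left
            (h1.trans (mul_le_mul_of_nonneg_left h2 hC.le)) hκ.le) (by positivity)
            (Real.exp_pos _).le) (by positivity) zero_le_one
      _ = κ * C * (4 / (κ * c)) * (Real.exp (-(κ * c / 2 * s g)) *
            Real.exp (κ * c / 4 * s g)) := by ring
      _ = _ := by rw [h3]; rfl
  · refine (Λ.summable_mul_cexp_trace ha hκ hZ₀).congr fun g => ?_
    rw [trace_gram_mul, traceLinear_apply]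
    rfl

theorem differentiableOn_tsum_cexp_trace {n : ℕ} {a : (Fin n → Λ) → ℂ} (ha : ∀ g, ‖a g‖ ≤ 1)
    {κ : ℝ} (hκ : 0 < κ) :
    DifferentiableOn ℂ (fun Z : Matrix (Fin n) (Fin n) ℂ =>
      ∑' g, a g * cexp (κ * I * ((Λ.gram g).map (Int.cast : ℤ → ℂ) * Z).trace))
      (siegelUpperHalfSpace n) := by
  intro Z₀ hZ₀
  have h := Λ.differentiableAt_tsum_cexp_traceLinear ha hκ hZ₀
  simp only [traceLinear_apply] at h
  simp only [trace_gram_mul]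
  exact DifferentiableAt.differentiableWithinAt h

/-! ### Poisson summation for unimodular lattices -/

variable {Λ}

/-- The dual basis with respect to the bilinear form of a unimodular lattice. -/
noncomputable def dualBasis (hΛ : Λ.IsUnimodular) {ι : Type*} [Fintype ι] [DecidableEq ι]
    (b : Module.Basis ι ℤ Λ) : Module.Basis ι ℤ Λ :=
  Module.Basis.ofEquivFun ((LinearEquiv.ofBijective Λ.form hΛ).trans (b.constr ℤ).symm)

theorem dualBasis_repr (hΛ : Λ.IsUnimodular) {ι : Type*} [Fintype ι] [DecidableEq ι]
    (b : Module.Basis ι ℤ Λ) (x : Λ) (i : ι) : (dualBasis hΛ b).repr x i = Λ.form x (b i) := rfl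

theorem form_dualBasis (hΛ : Λ.IsUnimodular) {ι : Type*} [Fintype ι] [DecidableEq ι]
    (b : Module.Basis ι ℤ Λ) (i j : ι) :
    Λ.form (dualBasis hΛ b i) (b j) = if i = j then 1 else 0 := by
  rw [← dualBasis_repr hΛ, Module.Basis.repr_self, Finsupp.single_apply]

/-- The coefficients of b i in the dual basis are the products (b i, b l), so the Gram matrices of
the two bases are inverse to each other. -/
theorem realGram_mul_realGram_dualBasis (hΛ : Λ.IsUnimodular) {ι : Type*} [Fintype ι]
    [DecidableEq ι] (b : Module.Basis ι ℤ Λ) (i j : ι) :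
    ∑ l, Λ.realGram b i l * Λ.realGram (dualBasis hΛ b) l j = if i = j then 1 else 0 := by
  have h1 : ∑ l, Λ.form (b i) (b l) • dualBasis hΛ b l = b i := by
    conv_rhs => rw [← (dualBasis hΛ b).sum_repr (b i)]
    rfl
  have h2 : ∑ l, Λ.form (b i) (b l) * Λ.form (dualBasis hΛ b l) (dualBasis hΛ b j) =
      if i = j then 1 else 0 := by
    have h3 : Λ.form (b i) (dualBasis hΛ b j) = if i = j then 1 else 0 := by
      rw [Λ.symm, form_dualBasis]; simp [eq_comm]
    rw [← h3]
    conv_rhs => rw [← h1]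
    simp
  simp only [realGram]
  exact_mod_cast congrArg (Int.cast : ℤ → ℝ) h2

theorem sum_realGram_repr {ι : Type*} [Fintype ι] (b : Module.Basis ι ℤ Λ) (x y : Λ) :
    ∑ i, (b.repr x i : ℂ) * ∑ j, (Λ.realGram b i j : ℂ) * b.repr y j = Λ.form x y := by
  rw [Λ.form_eq_sum_repr b]
  simp only [realGram, Finset.mul_sum]
  push_cast
  exact Finset.sum_congr rfl fun i _ => Finset.sum_congr rfl fun j _ => by ring

theorem summable_cexp_form_add (Λ : EvenLattice.{u}) {τ : ℂ} (hτ : 0 < τ.im) {J : Type*}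
    [Fintype J] (a : J → ℂ) (g : J → Λ) :
    Summable fun x : Λ => cexp (Real.pi * I * τ * Λ.form x x +
      2 * Real.pi * I * ∑ j, a j * Λ.form x (g j)) := by
  let b := Module.finBasis ℤ Λ
  have h := b.equivFun.toEquiv.summable_iff.mpr (summable_cexp_quadForm (Λ.realGram b)
    (Λ.posDef_realGram b).quadForm_pos hτ fun i => ∑ j, a j * Λ.form (b i) (g j))
  refine h.congr fun x => ?_
  have h1 := Λ.quadForm_realGram b x
  have h2 : ∑ i, (b.repr x i : ℂ) * ∑ j, a j * Λ.form (b i) (g j) =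
      ∑ j, a j * Λ.form x (g j) := by
    simp only [Finset.mul_sum]
    rw [Finset.sum_comm]
    refine Finset.sum_congr rfl fun j _ => ?_
    conv_rhs => rw [← b.sum_repr x]
    simp only [map_sum, LinearMap.sum_apply, map_smul, LinearMap.smul_apply, smul_eq_mul]
    push_cast
    rw [Finset.mul_sum]
    exact Finset.sum_congr rfl fun i _ => by ring
  simp only [Function.comp_apply, LinearEquiv.coe_toEquiv, b.equivFun_apply]
  rw [h1, h2]
  push_cast
  rfl

/-- The left side is written in a basis b and the right side in its dual basis; unimodularity makes
both of them sums over Λ itself. The shift, a vector of Λ ⊗ ℂ, is presented as a complex combination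
of lattice vectors g j. -/
theorem exists_tsum_cexp_form_eq (hΛ : Λ.IsUnimodular) :
    ∃ c : ℝ, 0 < c ∧ ∀ τ : ℂ, 0 < τ.im → ∀ (J : Type) [Fintype J] (a : J → ℂ) (g : J → Λ),
      ∑' x : Λ, cexp (Real.pi * I * τ * Λ.form x x + 2 * Real.pi * I * ∑ j, a j * Λ.form x (g j)) =
      c * ((-I * τ) ^ (1 / 2 : ℂ))⁻¹ ^ Λ.rank * ∑' x : Λ, cexp (Real.pi * I * (-1 / τ) *
        (Λ.form x x - 2 * ∑ j, a j * Λ.form x (g j) +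
          ∑ j, ∑ l, a j * a l * Λ.form (g j) (g l))) := by
  let b := Module.finBasis ℤ Λ
  let d := dualBasis hΛ b
  have hsymm : ∀ (b' : Module.Basis (Fin (Module.finrank ℤ Λ)) ℤ Λ) i j,
      Λ.realGram b' i j = Λ.realGram b' j i := fun b' i j => by simp only [realGram, Λ.symm (b' i)]
  obtain ⟨c, hc, h⟩ := exists_tsum_cexp_quadForm_eq _ (Λ.realGram b) (Λ.realGram d) (hsymm b)
    (hsymm d) (Λ.posDef_realGram b).quadForm_pos (Λ.posDef_realGram d).quadForm_pos
    (realGram_mul_realGram_dualBasis hΛ b)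
  refine ⟨c, hc, fun τ hτ J _ a g => ?_⟩
  -- The products with b i are the coordinates of the shift in the dual basis.
  have h1 := h τ hτ fun i => ∑ j, a j * Λ.form (g j) (b i)
  rw [← b.equivFun.toEquiv.tsum_eq, ← d.equivFun.toEquiv.tsum_eq] at h1
  convert h1 using 1
  · refine tsum_congr fun x => ?_
    have h2 : ∑ i, (b.repr x i : ℂ) * ∑ j, a j * Λ.form (g j) (b i) =
        ∑ j, a j * Λ.form x (g j) := by
      simp only [Finset.mul_sum]
      rw [Finset.sum_comm]
      refine Finset.sum_congr rfl fun j _ => ?_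
      rw [Λ.symm x]
      conv_rhs => rw [← b.sum_repr x]
      simp only [map_sum, map_smul, smul_eq_mul]
      push_cast
      rw [Finset.mul_sum]
      exact Finset.sum_congr rfl fun i _ => by ring
    simp only [LinearEquiv.coe_toEquiv, b.equivFun_apply]
    rw [h2, Λ.quadForm_realGram b x]
    push_cast
    rfl
  · rw [rank]
    congr 1
    refine tsum_congr fun x => ?_
    congr 2
    simp only [LinearEquiv.coe_toEquiv, d.equivFun_apply]
    have hg : ∀ i, ∑ j, a j * (Λ.form (g j) (b i) : ℂ) = ∑ j, a j * (d.repr (g j) i : ℂ) :=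
      fun i => rfl
    have hlin : ∀ y : Λ, ∑ i, (d.repr y i : ℂ) * ∑ j, (Λ.realGram d i j : ℂ) *
        ∑ l, a l * (d.repr (g l) j : ℂ) = ∑ l, a l * Λ.form y (g l) := by
      intro y
      simp only [← sum_realGram_repr d, Finset.mul_sum]
      rw [Finset.sum_comm' (t' := Finset.univ) (s' := fun _ => Finset.univ) (by simp)]
      rw [Finset.sum_congr rfl fun i _ => Finset.sum_comm, Finset.sum_comm]
      refine Finset.sum_congr rfl fun l _ => ?_
      rw [Finset.sum_comm]
      exact Finset.sum_congr rfl fun i _ => Finset.sum_congr rfl fun j _ => by ring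
    simp only [hg]
    rw [quadForm_sub _ fun i j => by rw [hsymm d], hlin]
    congr 1
    · congr 1
      have := Λ.quadForm_realGram d x
      rw [← Complex.ofReal_intCast, ← this, ofReal_quadForm]
      simp
    · have hexp : ∀ v : Fin (Module.finrank ℤ Λ) → ℂ,
          ∑ i, (∑ l, a l * (d.repr (g l) i : ℂ)) * v i =
            ∑ l, a l * ∑ i, (d.repr (g l) i : ℂ) * v i := by
        intro v
        simp only [Finset.sum_mul, Finset.mul_sum]
        rw [Finset.sum_comm]
        exact Finset.sum_congr rfl fun i _ => Finset.sum_congr rfl fun j _ => by ring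
      have hquad : ∀ w : Fin (Module.finrank ℤ Λ) → ℂ,
          quadForm (fun i j => (Λ.realGram d i j : ℂ)) w =
            ∑ i, w i * ∑ j, (Λ.realGram d i j : ℂ) * w j := by
        intro w
        simp only [quadForm, Finset.mul_sum]
        exact Finset.sum_congr rfl fun i _ => Finset.sum_congr rfl fun j _ => by ring
      rw [hquad, hexp]
      simp only [hlin]
      simp only [Finset.mul_sum]
      exact Finset.sum_congr rfl fun i _ => Finset.sum_congr rfl fun j _ => by ring

end EvenLattice

/-! ### The theta function of one variable and divisibility of the rank -/

theorem even_of_sq_eq_two_pow {G : ℤ} {m : ℕ} (h : G ^ 2 = 2 ^ m) : Even m := by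
  have h1 : G.natAbs ^ 2 = 2 ^ m := by
    zify
    rw [sq_abs]
    exact_mod_cast h
  obtain ⟨j, -, hj⟩ := (Nat.dvd_prime_pow Nat.prime_two).mp
    (Dvd.intro_left _ (by rw [← h1, pow_two]) : G.natAbs ∣ 2 ^ m)
  rw [hj, ← pow_mul] at h1
  have := Nat.pow_right_injective le_rfl h1
  exact ⟨j, by omega⟩

theorem signChar_intCast (n : ℤ) : (signChar (n : ZMod 2) : ℂ) =
    Complex.exp (Real.pi * Complex.I * n) := by
  rcases Int.even_or_odd' n with ⟨c, rfl | rfl⟩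
  · have h1 : ((2 * c : ℤ) : ZMod 2) = 0 := by
      rw [ZMod.intCast_zmod_eq_zero_iff_dvd]; exact ⟨c, rfl⟩
    rw [h1, signChar_zero]
    rw [show (Real.pi * Complex.I * ((2 * c : ℤ) : ℂ) : ℂ) = c * (2 * Real.pi * Complex.I) by
      push_cast; ring, Complex.exp_int_mul_two_pi_mul_I]
    simp
  · have h1 : ((2 * c + 1 : ℤ) : ZMod 2) = 1 := by
      have : ((2 * c : ℤ) : ZMod 2) = 0 := by
        rw [ZMod.intCast_zmod_eq_zero_iff_dvd]; exact ⟨c, rfl⟩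
      rw [Int.cast_add, this]; simp
    rw [h1, signChar_one]
    rw [show (Real.pi * Complex.I * ((2 * c + 1 : ℤ) : ℂ) : ℂ) =
      c * (2 * Real.pi * Complex.I) + Real.pi * Complex.I by push_cast; ring, Complex.exp_add,
      Complex.exp_int_mul_two_pi_mul_I, Complex.exp_pi_mul_I]
    simp

namespace EvenLattice

open Complex

variable {Λ : EvenLattice.{u}}

/-- The order 2^rank of Λ/2Λ is the square of an integer, the Gauss sum. -/
theorem even_rank (hΛ : Λ.IsUnimodular) : Even Λ.rank := by
  have h := quadraticGaussSum_sq (q_nondegenerate hΛ)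
  rw [card_modTwo] at h
  exact even_of_sq_eq_two_pow (by exact_mod_cast h)

variable (Λ) in
/-- The theta series in one variable. -/
noncomputable def thetaNull (τ : ℂ) : ℂ := ∑' x : Λ, cexp (Real.pi * I * τ * Λ.form x x)

theorem thetaNull_add_int (τ : ℂ) (n : ℤ) : Λ.thetaNull (τ + n) = Λ.thetaNull τ := by
  refine tsum_congr fun x => ?_
  rw [← two_mul_Q]
  rw [show (Real.pi * I * (τ + n) * ((2 * Λ.Q x : ℤ) : ℂ) : ℂ) =
    Real.pi * I * τ * ((2 * Λ.Q x : ℤ) : ℂ) + (n * Λ.Q x : ℤ) * (2 * Real.pi * I) by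
      push_cast; ring, Complex.exp_add, Complex.exp_int_mul_two_pi_mul_I, mul_one]

theorem summable_cexp_form (Λ : EvenLattice.{u}) {τ : ℂ} (hτ : 0 < τ.im) :
    Summable fun x : Λ => cexp (Real.pi * I * τ * Λ.form x x) :=
  (Λ.summable_cexp_form_add hτ (fun j : Fin 0 => j.elim0) fun j => j.elim0).congr fun x => by simp

theorem norm_cexp_form (τ : ℂ) (x : Λ) : ‖cexp (Real.pi * I * τ * Λ.form x x)‖ =
    Real.exp (-(Real.pi * τ.im * Λ.form x x)) := by
  rw [Complex.norm_exp]
  congr 1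
  rw [show (Real.pi * I * τ * Λ.form x x : ℂ) =
    ((Real.pi * (Λ.form x x : ℝ) : ℝ) : ℂ) * (I * τ) by push_cast; ring, re_ofReal_mul, I_mul_re]
  ring

theorem summable_exp_neg_form (Λ : EvenLattice.{u}) {t : ℝ} (ht : 0 < t) :
    Summable fun x : Λ => Real.exp (-(Real.pi * t * Λ.form x x)) :=
  (Λ.summable_cexp_form (τ := I * t) (by simpa using ht)).norm.congr fun x => by
    rw [norm_cexp_form]; simp

theorem thetaNull_I_ne_zero : Λ.thetaNull I ≠ 0 := by
  have h : Λ.thetaNull I = ((∑' x : Λ, Real.exp (-(Real.pi * 1 * Λ.form x x)) : ℝ) : ℂ) := by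
    rw [thetaNull, ofReal_tsum]
    refine tsum_congr fun x => ?_
    push_cast
    congr 1
    rw [mul_assoc (Real.pi : ℂ), I_mul_I]
    ring
  rw [h, Ne, ofReal_eq_zero]
  exact ((Λ.summable_exp_neg_form one_pos).tsum_pos (fun x => (Real.exp_pos _).le) 0
    (Real.exp_pos _)).ne'

/-- The undetermined constant of Poisson summation does not depend on τ, so it can be read off at
the fixed point τ = i without shift, where the theta value is nonzero. Evenness of the rank removes
the square root. -/
theorem tsum_cexp_form_eq_neg_I_mul (hΛ : Λ.IsUnimodular) {τ : ℂ} (hτ : 0 < τ.im) {J : Type}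
    [Fintype J] (a : J → ℂ) (g : J → Λ) :
    ∑' x : Λ, cexp (Real.pi * I * τ * Λ.form x x + 2 * Real.pi * I * ∑ j, a j * Λ.form x (g j)) =
      ((-I * τ) ^ (Λ.rank / 2))⁻¹ * ∑' x : Λ, cexp (Real.pi * I * (-1 / τ) *
        (Λ.form x x - 2 * ∑ j, a j * Λ.form x (g j) +
          ∑ j, ∑ l, a j * a l * Λ.form (g j) (g l))) := by
  obtain ⟨c, -, h⟩ := exists_tsum_cexp_form_eq hΛ
  have hpow : ∀ z : ℂ, (z ^ (1 / 2 : ℂ))⁻¹ ^ Λ.rank = (z ^ (Λ.rank / 2))⁻¹ := by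
    intro z
    have h1 : (z ^ (1 / 2 : ℂ)) ^ 2 = z := by
      have := Complex.cpow_nat_inv_pow z (two_ne_zero)
      simpa only [one_div, Nat.cast_ofNat] using this
    conv_lhs => rw [← Nat.div_mul_cancel (even_rank hΛ).two_dvd, mul_comm, pow_mul, inv_pow, h1,
      inv_pow]
  have hc : (c : ℂ) = 1 := by
    have h1 := h I (by simp) (Fin 0) (fun j => j.elim0) fun j => j.elim0
    rw [hpow] at h1
    have h2 : (-1 / I : ℂ) = I := by rw [div_I]; simp
    simp only [Finset.univ_eq_empty, Finset.sum_empty, mul_zero, add_zero, sub_zero, neg_mul,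
      I_mul_I, neg_neg, one_pow, inv_one, mul_one, h2] at h1
    exact (mul_eq_right₀ thetaNull_I_ne_zero).mp h1.symm
  rw [h τ hτ J a g, hpow, hc, one_mul]

theorem neg_I_mul_ne_zero {τ : ℂ} (hτ : 0 < τ.im) : -I * τ ≠ 0 := by
  refine mul_ne_zero (by simp) ?_
  rintro rfl
  simp at hτ

theorem thetaNull_neg_inv_neg_I_mul (hΛ : Λ.IsUnimodular) {τ : ℂ} (hτ : 0 < τ.im) :
    Λ.thetaNull (-1 / τ) = (-I * τ) ^ (Λ.rank / 2) * Λ.thetaNull τ := by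
  have h := tsum_cexp_form_eq_neg_I_mul hΛ hτ (fun j : Fin 0 => j.elim0) fun j => j.elim0
  simp only [Finset.univ_eq_empty, Finset.sum_empty, mul_zero, add_zero, sub_zero] at h
  rw [thetaNull, thetaNull, h, mul_inv_cancel_left₀ (pow_ne_zero _ (neg_I_mul_ne_zero hτ))]

/-- The map τ ↦ -1/(τ + 1) has order three. Going around the orbit of i returns the same nonzero
theta value, while the three automorphy factors multiply to (-i)^(m/2). This is the divisibility of
the rank by 8. -/
theorem neg_I_pow_half_rank (hΛ : Λ.IsUnimodular) : (-I) ^ (Λ.rank / 2) = 1 := by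
  have key : ∀ τ : ℂ, 0 < τ.im → Λ.thetaNull (-1 / (τ + 1)) =
      (-I * (τ + 1)) ^ (Λ.rank / 2) * Λ.thetaNull τ := by
    intro τ hτ
    rw [thetaNull_neg_inv_neg_I_mul hΛ (by simpa using hτ)]
    have := Λ.thetaNull_add_int τ 1
    rw [Int.cast_one] at this
    rw [this]
  have hI : (I + 1 : ℂ) ≠ 0 := fun h => by simpa using congrArg im h
  have him : 0 < ((I : ℂ) + 1).im := by simp
  have h1 := key I (by simp)
  have hτ₁ := im_neg_one_div_pos him
  have h2 := key _ hτ₁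
  have e2 : (-1 / (I + 1) + 1 : ℂ) = I / (I + 1) := by field_simp; ring
  rw [e2] at h2
  have him₂ : 0 < (I / (I + 1) : ℂ).im := by
    rw [← e2, add_im, one_im, add_zero]; exact hτ₁
  have h3 := key _ (im_neg_one_div_pos him₂)
  have e3 : (-1 / (I / (I + 1)) + 1 : ℂ) = I := by
    field_simp; rw [pow_two, I_mul_I]; ring
  rw [e3, h2, h1] at h3
  have e4 : (-1 / I : ℂ) = I := by rw [div_I]; simp
  rw [e4, ← mul_assoc, ← mul_assoc, ← mul_pow, ← mul_pow] at h3
  have h5 := (mul_eq_right₀ thetaNull_I_ne_zero).mp h3.symm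
  rwa [show (-I * I * (-I * (I / (I + 1))) * (-I * (I + 1)) : ℂ) = -I by
    field_simp; rw [pow_succ, pow_succ, pow_succ, pow_one]; simp only [I_mul_I]; ring_nf; simp] at h5

theorem even_half_rank (hΛ : Λ.IsUnimodular) : Even (Λ.rank / 2) := by
  by_contra h
  rw [Nat.not_even_iff_odd] at h
  obtain ⟨j, hj⟩ := h
  have h1 := neg_I_pow_half_rank hΛ
  rw [hj, pow_succ, pow_mul, neg_sq, I_sq] at h1
  have h2 := congrArg re h1
  rcases neg_one_pow_eq_or ℂ j with h3 | h3 <;> rw [h3] at h2 <;> simp at h2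

theorem tsum_cexp_form_eq (hΛ : Λ.IsUnimodular) {τ : ℂ} (hτ : 0 < τ.im) {J : Type}
    [Fintype J] (a : J → ℂ) (g : J → Λ) :
    ∑' x : Λ, cexp (Real.pi * I * τ * Λ.form x x + 2 * Real.pi * I * ∑ j, a j * Λ.form x (g j)) =
      (τ ^ (Λ.rank / 2))⁻¹ * ∑' x : Λ, cexp (Real.pi * I * (-1 / τ) *
        (Λ.form x x - 2 * ∑ j, a j * Λ.form x (g j) +
          ∑ j, ∑ l, a j * a l * Λ.form (g j) (g l))) := by
  rw [tsum_cexp_form_eq_neg_I_mul hΛ hτ, mul_pow, neg_I_pow_half_rank hΛ, one_mul]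

theorem thetaNull_neg_inv (hΛ : Λ.IsUnimodular) {τ : ℂ} (hτ : 0 < τ.im) :
    Λ.thetaNull (-1 / τ) = τ ^ (Λ.rank / 2) * Λ.thetaNull τ := by
  rw [thetaNull_neg_inv_neg_I_mul hΛ hτ, mul_pow, neg_I_pow_half_rank hΛ, one_mul]

/-- An element of the modular group moves 1/2 + it to 1/2 + i/(4t): shift by -1, invert, shift by
-2, invert. The intermediate points are w and u, and the factor is the power of uw = -2it. -/
theorem thetaNull_half (hΛ : Λ.IsUnimodular) {t : ℝ} (ht : 0 < t) :
    Λ.thetaNull (1 / 2 + I / (4 * t)) = (2 * t) ^ (Λ.rank / 2) * Λ.thetaNull (1 / 2 + I * t) := by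
  have ht' : (t : ℂ) ≠ 0 := by exact_mod_cast ht.ne'
  set w : ℂ := 1 / 2 + I * t + ((-1 : ℤ) : ℂ) with hw
  have hwv : w = I * t - 1 / 2 := by rw [hw]; push_cast; ring
  have him : 0 < w.im := by
    rw [hw]
    simp [ht]
  have hw0 : w ≠ 0 := fun h => by simp [h] at him
  set u : ℂ := -1 / w + ((-2 : ℤ) : ℂ) with hu
  have huim : 0 < u.im := by
    rw [hu, add_im, intCast_im, add_zero]
    exact im_neg_one_div_pos him
  have huw : u * w = -I * (2 * t) := by
    rw [hu, add_mul, div_mul_cancel₀ _ hw0, hwv]; push_cast; ring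
  have hu0 : u ≠ 0 := fun h => by simp [h] at huim
  have e1 : (1 / 2 + I / (4 * t) : ℂ) = -1 / u := by
    have : u = -I * (2 * t) / w := by rw [← huw, mul_div_cancel_right₀ _ hw0]
    rw [this, hwv]
    rw [hwv] at hw0
    field_simp
    ring_nf
    simp
    try ring
  rw [e1, thetaNull_neg_inv hΛ huim, hu, thetaNull_add_int, ← hu, thetaNull_neg_inv hΛ him, hw,
    thetaNull_add_int, ← hw, ← mul_assoc, ← mul_pow, huw, mul_pow, neg_I_pow_half_rank hΛ, one_mul]

theorem cexp_half (t : ℂ) (x : Λ) : cexp (Real.pi * I * (1 / 2 + t) * Λ.form x x) =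
    signChar (Λ.q (ModTwo.proj Λ x)) * cexp (Real.pi * I * t * Λ.form x x) := by
  rw [q_proj, signChar_intCast, ← Complex.exp_add]
  congr 1
  rw [← two_mul_Q]
  push_cast
  ring

/-- As t → ∞ only the zero vector survives, so the limit is 1. -/
theorem exists_thetaNull_half_ne_zero (Λ : EvenLattice.{u}) :
    ∃ t : ℝ, 0 < t ∧ Λ.thetaNull (1 / 2 + I * t) ≠ 0 := by
  classical
  have h : Filter.Tendsto (fun t : ℝ => Λ.thetaNull (1 / 2 + I * t)) Filter.atTop
      (nhds (∑' x : Λ, if x = 0 then 1 else 0)) := by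
    refine tendsto_tsum_of_dominated_convergence (Λ.summable_exp_neg_form one_pos) ?_ ?_
    · intro x
      split_ifs with hx
      · simp [hx]
      · rw [tendsto_zero_iff_norm_tendsto_zero]
        simp only [norm_cexp_form]
        refine Real.tendsto_exp_atBot.comp (Filter.tendsto_neg_atTop_atBot.comp ?_)
        have hpos : (0 : ℝ) < Λ.form x x := by exact_mod_cast Λ.pos x hx
        simp only [add_im, mul_im, I_re, I_im, ofReal_re, ofReal_im]
        norm_num
        exact (Filter.tendsto_id.const_mul_atTop Real.pi_pos).atTop_mul_const hpos
    · filter_upwards [Filter.eventually_ge_atTop 1] with t ht x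
      rw [norm_cexp_form, Real.exp_le_exp, neg_le_neg_iff]
      have hnn : (0 : ℝ) ≤ Λ.form x x := by
        by_cases hx : x = 0
        · simp [hx]
        · exact_mod_cast (Λ.pos x hx).le
      refine mul_le_mul_of_nonneg_right (mul_le_mul_of_nonneg_left ?_ Real.pi_pos.le) hnn
      simpa using ht
  rw [tsum_ite_eq] at h
  have h1 := (h.eventually_ne one_ne_zero).and (Filter.eventually_gt_atTop 0)
  obtain ⟨t, ht⟩ := h1.exists
  exact ⟨t, ht.2, ht.1⟩

end EvenLattice

/-! ### The sign of the Gauss sum of Λ/2Λ -/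

namespace EvenLattice

open Complex QuadraticMap

variable {Λ : EvenLattice.{u}}

/-- The decomposition of Λ into cosets of 2Λ, in the form in which Poisson summation delivers the
cosets. -/
theorem bijective_two_nsmul_sub {s : ModTwo Λ → Λ} (hs : ∀ a, ModTwo.proj Λ (s a) = a) :
    Function.Bijective fun p : ModTwo Λ × Λ => 2 • p.2 - s p.1 := by
  have h2 : ∀ y : Λ, ModTwo.proj Λ (2 • y) = 0 := fun y => ModTwo.proj_eq_zero_iff.mpr ⟨y, rfl⟩
  constructor
  · rintro ⟨a, y⟩ ⟨b, z⟩ h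
    have h1 : a = b := by
      have := congrArg (ModTwo.proj Λ) h
      simpa [map_sub, h2, hs] using this
    subst h1
    simp only [sub_left_inj] at h
    rw [Prod.mk.injEq]
    rw [two_nsmul, two_nsmul, ← two_zsmul, ← two_zsmul] at h
    exact ⟨rfl, smul_right_injective Λ (two_ne_zero (α := ℤ)) h⟩
  · intro x
    have h1 : ModTwo.proj Λ (x + s (-ModTwo.proj Λ x)) = 0 := by rw [map_add, hs, add_neg_cancel]
    obtain ⟨y, hy⟩ := ModTwo.proj_eq_zero_iff.mp h1
    exact ⟨(-ModTwo.proj Λ x, y), by simp only [← hy]; abel⟩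

theorem sum_signChar_mul_signChar_polar (y : ModTwo Λ) :
    ∑ a, signChar (Λ.q a) * signChar (polar Λ.q a y) =
      signChar (Λ.q y) * quadraticGaussSum Λ.q := by
  have h1 : quadraticGaussSum Λ.q = ∑ a, signChar (Λ.q (a + y)) :=
    (Equiv.sum_comp (Equiv.addRight y) fun a => signChar (Λ.q a)).symm
  rw [h1, Finset.mul_sum]
  refine Finset.sum_congr rfl fun a _ => ?_
  have h : ∀ u v w : ZMod 2, signChar u * signChar w =
      signChar v * signChar (u + v + w) := by decide
  rw [map_add_eq_polar]
  exact h _ _ _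

theorem I_pow_half_rank (hΛ : Λ.IsUnimodular) : I ^ (Λ.rank / 2) = 1 := by
  rw [← (even_half_rank hΛ).neg_pow, neg_I_pow_half_rank hΛ]

/-- At real part 1/2 the theta series carries the sign (-1)^q. Times the Gauss sum, this sign
becomes its own finite Fourier transform over a ∈ Λ/2Λ; Poisson summation converts the character of
a into a shift by a representative over 2, and the resulting cosets 2y - s a fill Λ. -/
theorem quadraticGaussSum_mul_thetaNull (hΛ : Λ.IsUnimodular) {t : ℝ} (ht : 0 < t) :
    (quadraticGaussSum Λ.q : ℂ) * Λ.thetaNull (1 / 2 + I / (4 * t)) =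
      (4 * t) ^ (Λ.rank / 2) * Λ.thetaNull (1 / 2 + I * t) := by
  classical
  have ht' : (t : ℂ) ≠ 0 := by exact_mod_cast ht.ne'
  choose s hs using ModTwo.proj_surjective (M := Λ)
  have him : 0 < (I / (4 * t) : ℂ).im := by
    rw [show (I / (4 * t) : ℂ) = ((1 / (4 * t) : ℝ) : ℂ) * I by push_cast; ring, im_ofReal_mul, I_im, mul_one]
    positivity
  have hp : ∀ a : ModTwo Λ, ∑' y : Λ, signChar (polar Λ.q a (ModTwo.proj Λ y)) *
      cexp (Real.pi * I * (I / (4 * t)) * Λ.form y y) =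
      (4 * t) ^ (Λ.rank / 2) * ∑' y : Λ, cexp (Real.pi * I * (I * t) *
        Λ.form (2 • y - s a) (2 • y - s a)) := by
    intro a
    have h := tsum_cexp_form_eq hΛ him (fun _ : Fin 1 => 1 / 2) fun _ => s a
    convert h using 1
    · refine tsum_congr fun y => ?_
      have h1 : polar Λ.q a (ModTwo.proj Λ y) = (Λ.form y (s a) : ZMod 2) := by
        conv_lhs => rw [← hs a]
        rw [polar_q_proj, Λ.symm]
      rw [h1, signChar_intCast, ← Complex.exp_add]
      congr 1
      simp only [Finset.univ_unique, Finset.sum_const, Finset.card_singleton, one_smul]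
      ring
    · congr 1
      · rw [div_pow, inv_div, I_pow_half_rank hΛ, div_one]
      · refine tsum_congr fun y => ?_
        congr 1
        have h2 : (-1 / (I / (4 * t)) : ℂ) = 4 * (I * t) := by
          field_simp; rw [I_sq]
        rw [h2]
        simp only [Finset.univ_unique, Finset.sum_const, Finset.card_singleton, one_smul, two_nsmul,
          map_sub, map_add, LinearMap.sub_apply, LinearMap.add_apply, Λ.symm (s a) y]
        push_cast
        ring
  have hsum := Λ.summable_cexp_form him
  calc (quadraticGaussSum Λ.q : ℂ) * Λ.thetaNull (1 / 2 + I / (4 * t))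
      = ∑' y : Λ, ∑ a, signChar (Λ.q a) * (signChar (polar Λ.q a (ModTwo.proj Λ y)) *
          cexp (Real.pi * I * (I / (4 * t)) * Λ.form y y)) := by
        rw [thetaNull, ← tsum_mul_left]
        refine tsum_congr fun y => ?_
        rw [cexp_half, ← mul_assoc]
        have h1 := sum_signChar_mul_signChar_polar (ModTwo.proj Λ y)
        have h2 := congrArg (Int.cast : ℤ → ℂ) h1
        push_cast at h2
        rw [mul_comm (quadraticGaussSum Λ.q : ℂ), ← h2, Finset.sum_mul]
        exact Finset.sum_congr rfl fun a _ => by ring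
    _ = ∑ a, signChar (Λ.q a) * ∑' y : Λ, signChar (polar Λ.q a (ModTwo.proj Λ y)) *
          cexp (Real.pi * I * (I / (4 * t)) * Λ.form y y) := by
        rw [Summable.tsum_finsetSum]
        · exact Finset.sum_congr rfl fun a _ => tsum_mul_left
        · intro a _
          refine Summable.mul_left _ (Summable.of_norm_bounded hsum.norm fun y => ?_)
          rw [norm_mul]
          refine mul_le_of_le_one_left (norm_nonneg _) ?_
          rw [norm_intCast]
          unfold signChar
          split_ifs <;> simp
    _ = (4 * t) ^ (Λ.rank / 2) * ∑ a, ∑' y : Λ, signChar (Λ.q (ModTwo.proj Λ (2 • y - s a))) *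
          cexp (Real.pi * I * (I * t) * Λ.form (2 • y - s a) (2 • y - s a)) := by
        rw [Finset.mul_sum]
        refine Finset.sum_congr rfl fun a _ => ?_
        rw [hp, mul_left_comm, ← tsum_mul_left]
        congr 2
        ext y
        rw [(ModTwo.proj Λ).map_sub, ModTwo.proj_eq_zero_iff.mpr ⟨y, rfl⟩, zero_sub,
          QuadraticMap.map_neg, hs]
    _ = _ := by
        congr 1
        have him2 : 0 < (1 / 2 + I * t : ℂ).im := by simpa using ht
        have h3 := (Equiv.ofBijective _ (bijective_two_nsmul_sub hs)).summable_iff.mpr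
          (Λ.summable_cexp_form him2)
        have h4 := h3.tsum_prod
        rw [tsum_fintype (L := SummationFilter.unconditional (ModTwo Λ))] at h4
        rw [thetaNull, ← (Equiv.ofBijective _ (bijective_two_nsmul_sub hs)).tsum_eq]
        refine Eq.trans ?_ h4.symm
        simp only [Function.comp_apply, cexp_half, Equiv.ofBijective_apply]

/-- Both relations between the theta values at 1/2 + i/(4t) and 1/2 + it hold, with factors
(2t)^(m/2) and (4t)^(m/2)/G. Hence G = 2^(m/2), after choosing t with a nonzero value. -/
theorem quadraticGaussSum_pos (hΛ : Λ.IsUnimodular) : 0 < quadraticGaussSum Λ.q := by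
  obtain ⟨t, ht, hne⟩ := Λ.exists_thetaNull_half_ne_zero
  have h := quadraticGaussSum_mul_thetaNull hΛ ht
  have ht' : (t : ℂ) ≠ 0 := by exact_mod_cast ht.ne'
  rw [thetaNull_half hΛ ht, ← mul_assoc] at h
  have h1 := mul_right_cancel₀ hne h
  have h2 : (quadraticGaussSum Λ.q : ℂ) = 2 ^ (Λ.rank / 2) := by
    rw [show (4 * t : ℂ) = 2 * (2 * t) by ring, mul_pow 2 (2 * (t : ℂ))] at h1
    exact mul_right_cancel₀ (pow_ne_zero _ (by simpa using ht')) h1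
  have h3 : quadraticGaussSum Λ.q = 2 ^ (Λ.rank / 2) := by exact_mod_cast h2
  rw [h3]
  positivity

end EvenLattice

/-! ### Generation of the integral symplectic group -/

section Symplectic

open Matrix Sum

variable {n : ℕ}

/-- The matrix `(1 S; 0 1)`. -/
def symplecticShear (S : Matrix (Fin n) (Fin n) ℤ) : Matrix (Fin n ⊕ Fin n) (Fin n ⊕ Fin n) ℤ :=
  fromBlocks 1 S 0 1

/-- The matrix `(U 0; 0 Vᵀ)`. -/
def symplecticLevi (U V : Matrix (Fin n) (Fin n) ℤ) :
    Matrix (Fin n ⊕ Fin n) (Fin n ⊕ Fin n) ℤ :=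
  fromBlocks U 0 0 Vᵀ

/-- The matrix of the quarter turn in the `i`-th coordinate plane. -/
def symplecticFlip (i : Fin n) : Matrix (Fin n ⊕ Fin n) (Fin n ⊕ Fin n) ℤ :=
  fromBlocks (1 - single i i 1) (-single i i 1) (single i i 1) (1 - single i i 1)

/-- The transvection `1 + u eᵀ`, where `e` is the `q`-th unit vector. -/
def columnTransvection (u : Fin n → ℤ) (q : Fin n) : Matrix (Fin n) (Fin n) ℤ :=
  1 + vecMulVec u (Pi.single q 1)

theorem columnTransvection_neg_mul {u : Fin n → ℤ} {q : Fin n} (hu : u q = 0) :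
    columnTransvection (-u) q * columnTransvection u q = 1 := by
  rw [columnTransvection, columnTransvection, mul_add, add_mul, add_mul, vecMulVec_mul_vecMulVec]
  simp [hu, neg_vecMulVec]

theorem symplecticShear_mem {S : Matrix (Fin n) (Fin n) ℤ} (hS : S.IsSymm) :
    symplecticShear S ∈ symplecticGroup (Fin n) ℤ := by
  rw [symplecticShear, SymplecticGroup.fromBlocks_mem_iff]
  simp [hS.eq]

theorem symplecticLevi_mem {U V : Matrix (Fin n) (Fin n) ℤ} (h : V * U = 1) :
    symplecticLevi U V ∈ symplecticGroup (Fin n) ℤ := by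
  rw [symplecticLevi, SymplecticGroup.fromBlocks_mem_iff]
  simp [← transpose_mul, h]

theorem symplecticFlip_mem (i : Fin n) : symplecticFlip i ∈ symplecticGroup (Fin n) ℤ := by
  rw [symplecticFlip, SymplecticGroup.fromBlocks_mem_iff]
  simp [transpose_sub, sub_mul, mul_sub]

variable {m : Type*}

theorem symplecticShear_single_mul_inl (p : Fin n) (t : ℤ) (M : Matrix (Fin n ⊕ Fin n) m ℤ)
    (r : Fin n) (x : m) : (symplecticShear (single p p t) * M) (inl r) x =
      M (inl r) x + if r = p then t * M (inr p) x else 0 := by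
  rw [mul_apply, Fintype.sum_sum_type]
  by_cases h : r = p
  · subst h; simp [symplecticShear, one_apply, single_apply]
  · simp [symplecticShear, one_apply, h, Ne.symm h]

theorem symplecticShear_mul_inr (S : Matrix (Fin n) (Fin n) ℤ) (M : Matrix (Fin n ⊕ Fin n) m ℤ)
    (r : Fin n) (x : m) : (symplecticShear S * M) (inr r) x = M (inr r) x := by
  rw [mul_apply, Fintype.sum_sum_type]
  simp [symplecticShear, one_apply]

theorem symplecticFlip_mul_inl (p : Fin n) (M : Matrix (Fin n ⊕ Fin n) m ℤ)
    (r : Fin n) (x : m) : (symplecticFlip p * M) (inl r) x =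
      if r = p then -M (inr p) x else M (inl r) x := by
  rw [mul_apply, Fintype.sum_sum_type]
  by_cases h : r = p
  · subst h; simp [symplecticFlip, one_apply, single_apply]
  · simp [symplecticFlip, one_apply, h, Ne.symm h]

theorem symplecticFlip_mul_inr (p : Fin n) (M : Matrix (Fin n ⊕ Fin n) m ℤ)
    (r : Fin n) (x : m) : (symplecticFlip p * M) (inr r) x =
      if r = p then M (inl p) x else M (inr r) x := by
  rw [mul_apply, Fintype.sum_sum_type]
  by_cases h : r = p
  · subst h; simp [symplecticFlip, one_apply, single_apply]
  · simp [symplecticFlip, one_apply, h, Ne.symm h]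

theorem symplecticLevi_mul_inl (u : Fin n → ℤ) (q : Fin n) (V : Matrix (Fin n) (Fin n) ℤ)
    (M : Matrix (Fin n ⊕ Fin n) m ℤ) (r : Fin n) (x : m) :
    (symplecticLevi (columnTransvection u q) V * M) (inl r) x =
      M (inl r) x + u r * M (inl q) x := by
  rw [mul_apply, Fintype.sum_sum_type]
  simp [symplecticLevi, columnTransvection, one_apply, vecMulVec_apply, add_mul,
    Finset.sum_add_distrib, Pi.single_apply]

theorem symplecticLevi_mul_inr_eq_zero (U V : Matrix (Fin n) (Fin n) ℤ)
    (M : Matrix (Fin n ⊕ Fin n) m ℤ) {x : m} (hx : ∀ r, M (inr r) x = 0) (r : Fin n) :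
    (symplecticLevi U V * M) (inr r) x = 0 := by
  rw [mul_apply, Fintype.sum_sum_type]
  simp [symplecticLevi, hx]

/-- The columns with index `inl i`, `i < j`, are unit vectors. -/
def HasUnitColumns (j : ℕ) (M : Matrix (Fin n ⊕ Fin n) (Fin n ⊕ Fin n) ℤ) : Prop :=
  ∀ i : Fin n, (i : ℕ) < j →
    (∀ r, M (inl r) (inl i) = if r = i then 1 else 0) ∧ ∀ r, M (inr r) (inl i) = 0

theorem HasUnitColumns.shear {j : ℕ} {M : Matrix (Fin n ⊕ Fin n) (Fin n ⊕ Fin n) ℤ}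
    (h : HasUnitColumns j M) (p : Fin n) (t : ℤ) :
    HasUnitColumns j (symplecticShear (single p p t) * M) := fun i hi =>
  ⟨fun r => by rw [symplecticShear_single_mul_inl, (h i hi).2, mul_zero, ite_self, add_zero,
    (h i hi).1], fun r => by rw [symplecticShear_mul_inr, (h i hi).2]⟩

theorem HasUnitColumns.flip {j : ℕ} {M : Matrix (Fin n ⊕ Fin n) (Fin n ⊕ Fin n) ℤ}
    (h : HasUnitColumns j M) {p : Fin n} (hp : j ≤ p) :
    HasUnitColumns j (symplecticFlip p * M) := by
  intro i hi
  have hpi : p ≠ i := by rintro rfl; omega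
  constructor
  · intro r
    rw [symplecticFlip_mul_inl]
    split_ifs with h1 h2 h2
    · exact absurd (h1.symm.trans h2) hpi
    · rw [(h i hi).2, neg_zero]
    · rw [(h i hi).1, if_pos h2]
    · rw [(h i hi).1, if_neg h2]
  · intro r
    rw [symplecticFlip_mul_inr, (h i hi).2, (h i hi).1, if_neg hpi, ite_self]

theorem HasUnitColumns.levi {j : ℕ} {M : Matrix (Fin n ⊕ Fin n) (Fin n ⊕ Fin n) ℤ}
    (h : HasUnitColumns j M) (u : Fin n → ℤ) {q : Fin n} (hq : j ≤ q)
    (V : Matrix (Fin n) (Fin n) ℤ) :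
    HasUnitColumns j (symplecticLevi (columnTransvection u q) V * M) := by
  intro i hi
  have hqi : q ≠ i := by rintro rfl; omega
  refine ⟨fun r => ?_, symplecticLevi_mul_inr_eq_zero _ _ _ (h i hi).2⟩
  rw [symplecticLevi_mul_inl, (h i hi).1, (h i hi).1, if_neg hqi, mul_zero, add_zero]

/-- The size of the part of the column `inl j` outside the first `j` coordinates. -/
def columnWeight (j : Fin n) (M : Matrix (Fin n ⊕ Fin n) (Fin n ⊕ Fin n) ℤ) : ℕ :=
  ∑ i, if j ≤ i then (M (inl i) (inl j)).natAbs + 2 * (M (inr i) (inl j)).natAbs else 0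

theorem columnWeight_lt {j p : Fin n} (hp : j ≤ p)
    {M M' : Matrix (Fin n ⊕ Fin n) (Fin n ⊕ Fin n) ℤ}
    (h : ∀ i ≠ p, M' (inl i) (inl j) = M (inl i) (inl j) ∧ M' (inr i) (inl j) = M (inr i) (inl j))
    (hlt : (M' (inl p) (inl j)).natAbs + 2 * (M' (inr p) (inl j)).natAbs <
      (M (inl p) (inl j)).natAbs + 2 * (M (inr p) (inl j)).natAbs) :
    columnWeight j M' < columnWeight j M := by
  refine Finset.sum_lt_sum (fun i _ => ?_) ⟨p, Finset.mem_univ _, ?_⟩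
  · by_cases hi : i = p
    · subst hi
      rw [if_pos hp, if_pos hp]
      exact hlt.le
    · rw [(h i hi).1, (h i hi).2]
  · rw [if_pos hp, if_pos hp]
    exact hlt

theorem exists_natAbs_add_mul_lt {a c : ℤ} (hc : c ≠ 0) (h : c.natAbs ≤ a.natAbs) :
    ∃ t : ℤ, (a + t * c).natAbs < a.natAbs := by
  rcases le_total 0 a with ha | ha <;> rcases le_total 0 c with hc' | hc'
  · exact ⟨-1, by omega⟩
  · exact ⟨1, by omega⟩
  · exact ⟨1, by omega⟩
  · exact ⟨-1, by omega⟩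

variable {M : Matrix (Fin n ⊕ Fin n) (Fin n ⊕ Fin n) ℤ}

theorem symplectic_relations (hM : M ∈ symplecticGroup (Fin n) ℤ) :
    M.toBlocks₁₁ᵀ * M.toBlocks₂₁ = M.toBlocks₂₁ᵀ * M.toBlocks₁₁ ∧
      M.toBlocks₁₂ᵀ * M.toBlocks₂₂ = M.toBlocks₂₂ᵀ * M.toBlocks₁₂ ∧
      M.toBlocks₁₁ᵀ * M.toBlocks₂₂ - M.toBlocks₂₁ᵀ * M.toBlocks₁₂ = 1 := by
  rw [← fromBlocks_toBlocks M] at hM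
  exact SymplecticGroup.fromBlocks_mem_iff.mp hM

/-- The entry (p, j) of the symmetry of AᵀC: column p is already a unit vector, so it picks out
exactly this coefficient. -/
theorem HasUnitColumns.inr_eq_zero (hM : M ∈ symplecticGroup (Fin n) ℤ) {j : Fin n}
    (h : HasUnitColumns j M) {p : Fin n} (hp : p < j) : M (inr p) (inl j) = 0 := by
  have h1 := congrFun₂ (symplectic_relations hM).1 p j
  simpa [mul_apply, (h p hp).1, (h p hp).2, toBlocks₁₁, toBlocks₂₁] using h1

/-- Once the lower half of column j is zero, the relation AᵀD - CᵀB = 1 makes its upper half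
unimodular, with column j of D as witness; the earlier unit columns force the first entries of the
witness to vanish. -/
theorem HasUnitColumns.exists_sum_eq_one (hM : M ∈ symplecticGroup (Fin n) ℤ) {j : Fin n}
    (h : HasUnitColumns j M) (hc : ∀ p, M (inr p) (inl j) = 0) :
    ∃ d : Fin n → ℤ, (∀ p < j, d p = 0) ∧ ∑ p, M (inl p) (inl j) * d p = 1 := by
  refine ⟨fun p => M (inr p) (inr j), fun p hp => ?_, ?_⟩
  · have h1 := congrFun₂ (symplectic_relations hM).2.2 p j
    simpa [mul_apply, (h p hp).1, (h p hp).2, toBlocks₁₁, toBlocks₂₁, toBlocks₂₂, one_apply,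
      hp.ne] using h1
  · have h1 := congrFun₂ (symplectic_relations hM).2.2 j j
    simpa [mul_apply, hc, toBlocks₁₁, toBlocks₂₁, toBlocks₂₂] using h1

theorem HasUnitColumns.eq_shear (hM : M ∈ symplecticGroup (Fin n) ℤ) (h : HasUnitColumns n M) :
    ∃ S : Matrix (Fin n) (Fin n) ℤ, S.IsSymm ∧ M = symplecticShear S := by
  have hA : M.toBlocks₁₁ = 1 := by
    ext r i
    simp [toBlocks₁₁, (h i i.2).1, one_apply]
  have hC : M.toBlocks₂₁ = 0 := by
    ext r i
    simp [toBlocks₂₁, (h i i.2).2]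
  obtain ⟨-, h2, h3⟩ := symplectic_relations hM
  rw [hA, hC] at h3
  have hD : M.toBlocks₂₂ = 1 := by simpa using h3
  rw [hD] at h2
  refine ⟨M.toBlocks₁₂, by simpa [IsSymm] using h2, ?_⟩
  conv_lhs => rw [← fromBlocks_toBlocks M, hA, hC, hD]
  rfl

/-- The integral symplectic group is generated by the matrices `(1 S; 0 1)`, the matrices
`(U 0; 0 U⁻ᵀ)` and the quarter turns. -/
theorem symplectic_induction (P : Matrix (Fin n ⊕ Fin n) (Fin n ⊕ Fin n) ℤ → Prop)
    (shear : ∀ S : Matrix (Fin n) (Fin n) ℤ, S.IsSymm → P (symplecticShear S))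
    (shear_mul : ∀ S : Matrix (Fin n) (Fin n) ℤ, S.IsSymm → ∀ M ∈ symplecticGroup (Fin n) ℤ,
      P (symplecticShear S * M) → P M)
    (levi_mul : ∀ U V : Matrix (Fin n) (Fin n) ℤ, V * U = 1 → ∀ M ∈ symplecticGroup (Fin n) ℤ,
      P (symplecticLevi U V * M) → P M)
    (flip_mul : ∀ i, ∀ M ∈ symplecticGroup (Fin n) ℤ, P (symplecticFlip i * M) → P M)
    (hM : M ∈ symplecticGroup (Fin n) ℤ) : P M := by
  have key : ∀ l j : ℕ, j + l = n → ∀ M ∈ symplecticGroup (Fin n) ℤ, HasUnitColumns j M → P M := by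
    intro l
    induction l with
    | zero =>
      intro j hj M hM h
      rw [add_zero] at hj
      subst hj
      obtain ⟨S, hS, rfl⟩ := h.eq_shear hM
      exact shear S hS
    | succ l ih =>
      intro j hj
      have hmul : ∀ {g M : Matrix (Fin n ⊕ Fin n) (Fin n ⊕ Fin n) ℤ},
          g ∈ symplecticGroup (Fin n) ℤ → M ∈ symplecticGroup (Fin n) ℤ →
          g * M ∈ symplecticGroup (Fin n) ℤ := fun hg hM => mul_mem hg hM
      set J : Fin n := ⟨j, by omega⟩ with hJ
      have hJle : ∀ {p : Fin n}, J ≤ p ↔ j ≤ p := fun {p} => by rw [Fin.le_def]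
      have hlev : ∀ {M} (u : Fin n → ℤ) (q : Fin n), u q = 0 → M ∈ symplecticGroup (Fin n) ℤ →
          (symplecticLevi (columnTransvection u q) (columnTransvection (-u) q) * M ∈
            symplecticGroup (Fin n) ℤ) ∧
          (P (symplecticLevi (columnTransvection u q) (columnTransvection (-u) q) * M) → P M) :=
        fun u q hu hM => ⟨hmul (symplecticLevi_mem (columnTransvection_neg_mul hu)) hM,
          levi_mul _ _ (columnTransvection_neg_mul hu) _ hM⟩
      have hone : ∀ M ∈ symplecticGroup (Fin n) ℤ, HasUnitColumns j M →
          (∀ p, M (inr p) (inl J) = 0) → M (inl J) (inl J) = 1 → P M := by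
        intro M hM h hc ha
        set u : Fin n → ℤ := fun r => if r = J then 0 else -M (inl r) (inl J) with hu
        obtain ⟨h1, h2⟩ := hlev u J (by simp [hu]) hM
        refine h2 (ih (j + 1) (by omega) _ h1 fun i hi => ?_)
        rcases Nat.lt_succ_iff_lt_or_eq.mp hi with hi | hi
        · exact h.levi u le_rfl _ i hi
        · obtain rfl : i = J := Fin.ext hi
          refine ⟨fun r => ?_, symplecticLevi_mul_inr_eq_zero _ _ _ hc⟩
          rw [symplecticLevi_mul_inl, ha, hu]
          by_cases hr : r = J
          · simp [hr, ha]
          · simp [hr]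
      intro M hM
      induction hw : columnWeight J M using Nat.strong_induction_on generalizing M with
      | _ w ihw =>
      intro h
      by_cases hc : ∃ p : Fin n, j ≤ p ∧ M (inr p) (inl J) ≠ 0
      · obtain ⟨p, hp, hcp⟩ := hc
        -- A Euclidean algorithm on the pair (a, c) in rows inl p and inr p. If |a| < |c|, a flip
        -- exchanges them up to sign, and the weight 2 on c makes this a decrease; otherwise a shear
        -- subtracts a multiple of c from a.
        rcases lt_or_ge (M (inl p) (inl J)).natAbs (M (inr p) (inl J)).natAbs with hlt | hle
        · refine flip_mul p M hM (ihw _ ?_ _ (hmul (symplecticFlip_mem p) hM) rfl (h.flip hp))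
          rw [← hw]
          refine columnWeight_lt (hJle.mpr hp) (fun i hi => ?_) ?_
          · rw [symplecticFlip_mul_inl, symplecticFlip_mul_inr, if_neg hi, if_neg hi]
            exact ⟨rfl, rfl⟩
          · rw [symplecticFlip_mul_inl, symplecticFlip_mul_inr, if_pos rfl, if_pos rfl,
              Int.natAbs_neg]
            omega
        · obtain ⟨t, ht⟩ := exists_natAbs_add_mul_lt hcp hle
          have hS : (single p p t : Matrix (Fin n) (Fin n) ℤ).IsSymm := by
            simp [IsSymm]
          refine shear_mul _ hS M hM (ihw _ ?_ _ (hmul (symplecticShear_mem hS) hM) rfl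
            (h.shear p t))
          rw [← hw]
          refine columnWeight_lt (hJle.mpr hp) (fun i hi => ?_) ?_
          · rw [symplecticShear_single_mul_inl, symplecticShear_mul_inr, if_neg hi, add_zero]
            exact ⟨rfl, rfl⟩
          · rw [symplecticShear_single_mul_inl, symplecticShear_mul_inr, if_pos rfl]
            omega
      have hc0 : ∀ p, M (inr p) (inl J) = 0 := by
        intro p
        rcases lt_or_ge p J with hp | hp
        · exact h.inr_eq_zero (j := J) hM hp
        · by_contra hne
          exact hc ⟨p, hJle.mp hp, hne⟩
      -- With the lower half cleared, the Euclidean algorithm continues among the entries of the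
      -- upper half in rows at least j, now by transvections.
      by_cases ha : ∃ p q : Fin n, p ≠ q ∧ j ≤ p ∧ j ≤ q ∧ M (inl q) (inl J) ≠ 0 ∧
          (M (inl q) (inl J)).natAbs ≤ (M (inl p) (inl J)).natAbs
      · obtain ⟨p, q, hpq, hp, hq, hne, hle⟩ := ha
        obtain ⟨t, ht⟩ := exists_natAbs_add_mul_lt hne hle
        obtain ⟨h1, h2⟩ := hlev (Pi.single p t) q (by simp [hpq.symm]) hM
        refine h2 (ihw _ ?_ _ h1 rfl (h.levi _ hq _))
        rw [← hw]
        refine columnWeight_lt (hJle.mpr hp) (fun i hi => ?_) ?_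
        · rw [symplecticLevi_mul_inl, symplecticLevi_mul_inr_eq_zero _ _ _ hc0, hc0]
          simp [hi]
        · rw [symplecticLevi_mul_inl, symplecticLevi_mul_inr_eq_zero _ _ _ hc0, hc0]
          simpa using ht
      -- No further reduction is possible, so at most one entry in rows at least j is nonzero;
      -- unimodularity makes it ±1.
      obtain ⟨d, hd, hsum⟩ := h.exists_sum_eq_one (j := J) hM hc0
      obtain ⟨p, -, hp⟩ := Finset.exists_ne_zero_of_sum_ne_zero (hsum.trans_ne one_ne_zero)
      have hap : M (inl p) (inl J) ≠ 0 := left_ne_zero_of_mul hp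
      have hjp : j ≤ p := by
        by_contra hlt
        exact right_ne_zero_of_mul hp (hd p (lt_of_not_ge fun hle => hlt (hJle.mp hle)))
      have hother : ∀ q : Fin n, q ≠ p → j ≤ q → M (inl q) (inl J) = 0 := by
        intro q hqp hq
        by_contra hne
        rcases le_total (M (inl q) (inl J)).natAbs (M (inl p) (inl J)).natAbs with hle | hle
        · exact ha ⟨p, q, hqp.symm, hjp, hq, hne, hle⟩
        · exact ha ⟨q, p, hqp, hq, hjp, hap, hle⟩
      have hunit : M (inl p) (inl J) * d p = 1 := by
        rw [← hsum, Finset.sum_eq_single p]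
        · intro q _ hqp
          rcases lt_or_ge q J with hq | hq
          · rw [hd q hq, mul_zero]
          · rw [hother q hqp (hJle.mp hq), zero_mul]
        · simp
      have hsq : M (inl p) (inl J) = 1 ∨ M (inl p) (inl J) = -1 :=
        Int.isUnit_iff.mp (IsUnit.of_mul_eq_one _ hunit)
      by_cases hpJ : p = J
      · rw [hpJ] at hsq
        rcases hsq with h1 | h1
        · exact hone M hM h hc0 h1
        -- Two quarter turns in the plane of J change the sign of its two coordinates.
        · refine flip_mul J _ hM (flip_mul J _ (hmul (symplecticFlip_mem J) hM)
            (hone _ (hmul (symplecticFlip_mem J) (hmul (symplecticFlip_mem J) hM))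
              ((h.flip le_rfl).flip le_rfl) (fun r => ?_) ?_))
          · simp only [symplecticFlip_mul_inr, symplecticFlip_mul_inl, if_true, hc0, neg_zero]
            split_ifs <;> rfl
          · simp [symplecticFlip_mul_inr, symplecticFlip_mul_inl, h1]
      -- The unit sits in row p ≠ J; adding ±1 times that row to row J, with the same sign, puts 1
      -- at the required place.
      · obtain ⟨h1, h2⟩ := hlev (Pi.single J (M (inl p) (inl J))) p (by simp [hpJ]) hM
        refine h2 (hone _ h1 (h.levi _ hjp _) (symplecticLevi_mul_inr_eq_zero _ _ _ hc0) ?_)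
        rw [symplecticLevi_mul_inl, hother J (Ne.symm hpJ) le_rfl]
        rcases hsq with h3 | h3 <;> simp [h3]
  exact key n 0 (zero_add n) M hM fun i hi => absurd hi (Nat.not_lt_zero _)

end Symplectic

/-! ### The action of the symplectic group on the Siegel upper half space -/

section Siegel

open Matrix Complex
open scoped ComplexOrder

variable {n : ℕ}

theorem star_dotProduct_map_ofReal_mulVec {Y : Matrix (Fin n) (Fin n) ℝ} (hY : Y.IsSymm)
    (x : Fin n → ℂ) : star x ⬝ᵥ (Y.map ofReal *ᵥ x) =
      (((fun i => (x i).re) ⬝ᵥ (Y *ᵥ fun i => (x i).re) +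
        (fun i => (x i).im) ⬝ᵥ (Y *ᵥ fun i => (x i).im) : ℝ) : ℂ) := by
  apply Complex.ext
  · simp only [dotProduct, mulVec, Finset.mul_sum, re_sum, ofReal_re, ← Finset.sum_add_distrib]
    refine Finset.sum_congr rfl fun i _ => Finset.sum_congr rfl fun j _ => ?_
    simp
  · have h : ∑ i, ∑ j, (x i).re * (Y i j * (x j).im) = ∑ i, ∑ j, (x i).im * (Y i j * (x j).re) := by
      rw [Finset.sum_comm]
      refine Finset.sum_congr rfl fun i _ => Finset.sum_congr rfl fun j _ => ?_
      rw [hY.apply]; ring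
    rw [← sub_eq_zero] at h
    simp only [← Finset.sum_sub_distrib] at h
    simp only [dotProduct, mulVec, Finset.mul_sum, im_sum, ofReal_im]
    rw [← h]
    refine Finset.sum_congr rfl fun i _ => Finset.sum_congr rfl fun j _ => ?_
    simp
    ring

theorem Matrix.PosDef.map_ofReal {Y : Matrix (Fin n) (Fin n) ℝ} (hY : Y.PosDef) :
    (Y.map ofReal).PosDef := by
  have hs : Y.IsSymm := by simpa [IsHermitian, IsSymm, conjTranspose] using hY.1
  refine .of_dotProduct_mulVec_pos ?_ fun x hx => ?_
  · ext i j
    simp [hs.apply i j]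
  · rw [star_dotProduct_map_ofReal_mulVec hs]
    have h0 := fun y => hY.posSemidef.dotProduct_mulVec_nonneg y
    simp only [star_trivial] at h0
    have hne : (fun i => (x i).re) ≠ 0 ∨ (fun i => (x i).im) ≠ 0 := by
      by_contra! h
      exact hx (funext fun i => Complex.ext (congrFun h.1 i) (congrFun h.2 i))
    rw [zero_lt_real]
    rcases hne with h | h
    · have := hY.dotProduct_mulVec_pos h
      rw [star_trivial] at this
      linarith [h0 fun i => (x i).im]
    · have := hY.dotProduct_mulVec_pos h
      rw [star_trivial] at this
      linarith [h0 fun i => (x i).re]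

theorem Matrix.PosDef.of_map_ofReal {Y : Matrix (Fin n) (Fin n) ℝ} (hs : Y.IsSymm)
    (hY : (Y.map ofReal).PosDef) : Y.PosDef := by
  refine .of_dotProduct_mulVec_pos (by simpa [IsHermitian, conjTranspose] using hs.eq)
    fun x hx => ?_
  have h := hY.dotProduct_mulVec_pos (x := fun i => (x i : ℂ)) fun h => hx (funext fun i => by
    simpa using congrFun h i)
  rw [star_dotProduct_map_ofReal_mulVec hs, zero_lt_real] at h
  have h0 : (fun _ : Fin n => (0 : ℝ)) = 0 := rfl
  simpa [h0] using h

theorem two_I_smul_map_im {Z : Matrix (Fin n) (Fin n) ℂ} (hZ : Z.IsSymm) :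
    (2 * I) • (Z.map im).map ofReal = Z - Zᴴ := by
  ext i j
  simp only [Matrix.smul_apply, map_apply, Matrix.sub_apply, conjTranspose_apply, hZ.apply i j, smul_eq_mul]
  have h := Complex.sub_conj (Z i j)
  push_cast at h
  rw [← starRingEnd_apply, h]
  ring

/-- The numerator `A Z + B` for `M = (A B; C D)`. -/
noncomputable def siegelNum (M : Matrix (Fin n ⊕ Fin n) (Fin n ⊕ Fin n) ℤ)
    (Z : Matrix (Fin n) (Fin n) ℂ) : Matrix (Fin n) (Fin n) ℂ :=
  M.toBlocks₁₁.map (Int.cast : ℤ → ℂ) * Z + M.toBlocks₁₂.map (Int.cast : ℤ → ℂ)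

theorem siegelAction_eq (M : Matrix (Fin n ⊕ Fin n) (Fin n ⊕ Fin n) ℤ)
    (Z : Matrix (Fin n) (Fin n) ℂ) :
    siegelAction M Z = siegelNum M Z * (siegelDenom M Z)⁻¹ := rfl

variable {M : Matrix (Fin n ⊕ Fin n) (Fin n ⊕ Fin n) ℤ} {Z : Matrix (Fin n) (Fin n) ℂ}

/-- The symplectic relations in polarized form, with two independent matrices W and Z: taking W = Z
yields symmetry of the image, taking W the conjugate transpose of Z yields its imaginary part. -/
theorem siegelNum_mul_siegelDenom_sub (hM : M ∈ symplecticGroup (Fin n) ℤ)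
    (W Z : Matrix (Fin n) (Fin n) ℂ) :
    (siegelNum M Wᵀ)ᵀ * siegelDenom M Z - (siegelDenom M Wᵀ)ᵀ * siegelNum M Z = W - Z := by
  obtain ⟨h1, h2, h3⟩ := symplectic_relations hM
  have h4 : M.toBlocks₂₂ᵀ * M.toBlocks₁₁ - M.toBlocks₁₂ᵀ * M.toBlocks₂₁ = 1 := by
    have := congrArg transpose h3
    simpa [transpose_sub, transpose_mul] using this
  set c := (Int.castRingHom ℂ).mapMatrix (m := Fin n)
  have e1 := congrArg c h1
  have e2 := congrArg c h2
  have e3 := congrArg c h3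
  have e4 := congrArg c h4
  simp only [map_mul, map_sub, map_one] at e1 e2 e3 e4
  have hc : ∀ X : Matrix (Fin n) (Fin n) ℤ, X.map (Int.cast : ℤ → ℂ) = c X := fun X => rfl
  have ht : ∀ X : Matrix (Fin n) (Fin n) ℤ, (c X)ᵀ = c Xᵀ := fun X => rfl
  simp only [siegelNum, siegelDenom, hc, transpose_add, transpose_mul, transpose_transpose, ht]
  have : (W * c M.toBlocks₁₁ᵀ + c M.toBlocks₁₂ᵀ) * (c M.toBlocks₂₁ * Z + c M.toBlocks₂₂) -
      (W * c M.toBlocks₂₁ᵀ + c M.toBlocks₂₂ᵀ) * (c M.toBlocks₁₁ * Z + c M.toBlocks₁₂) =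
      W * (c M.toBlocks₁₁ᵀ * c M.toBlocks₂₁ - c M.toBlocks₂₁ᵀ * c M.toBlocks₁₁) * Z +
      W * (c M.toBlocks₁₁ᵀ * c M.toBlocks₂₂ - c M.toBlocks₂₁ᵀ * c M.toBlocks₁₂) -
      (c M.toBlocks₂₂ᵀ * c M.toBlocks₁₁ - c M.toBlocks₁₂ᵀ * c M.toBlocks₂₁) * Z +
      (c M.toBlocks₁₂ᵀ * c M.toBlocks₂₂ - c M.toBlocks₂₂ᵀ * c M.toBlocks₁₂) := by
    noncomm_ring
  rw [this, e1, e2, e3, e4]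
  simp

theorem conjTranspose_map_intCast_mul_add (A B : Matrix (Fin n) (Fin n) ℤ)
    (Z : Matrix (Fin n) (Fin n) ℂ) :
    (A.map (Int.cast : ℤ → ℂ) * Z + B.map (Int.cast : ℤ → ℂ))ᴴ =
      (A.map (Int.cast : ℤ → ℂ) * Zᴴᵀ + B.map (Int.cast : ℤ → ℂ))ᵀ := by
  have h : ∀ X : Matrix (Fin n) (Fin n) ℤ,
      (X.map (Int.cast : ℤ → ℂ))ᴴ = (X.map (Int.cast : ℤ → ℂ))ᵀ := fun X => by ext i j; simp
  rw [conjTranspose_add, conjTranspose_mul, transpose_add, transpose_mul, transpose_transpose, h, h]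

theorem conjTranspose_siegelDenom_mul_sub (hM : M ∈ symplecticGroup (Fin n) ℤ)
    (hZ : Z.IsSymm) :
    (siegelDenom M Z)ᴴ * siegelNum M Z - (siegelNum M Z)ᴴ * siegelDenom M Z =
      (2 * I) • (Z.map im).map ofReal := by
  have h := siegelNum_mul_siegelDenom_sub hM Zᴴ Z
  rw [two_I_smul_map_im hZ, ← neg_sub Zᴴ, ← h, neg_sub]
  rw [siegelDenom, siegelNum, conjTranspose_map_intCast_mul_add, conjTranspose_map_intCast_mul_add]
  rfl

/-- A kernel vector x of CZ + D would satisfy x* (Im Z) x = 0. -/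
theorem isUnit_det_siegelDenom (hM : M ∈ symplecticGroup (Fin n) ℤ)
    (hZ : Z ∈ siegelUpperHalfSpace n) : IsUnit (siegelDenom M Z).det := by
  rw [isUnit_iff_ne_zero]
  intro h
  obtain ⟨x, hx, hx0⟩ := exists_mulVec_eq_zero_iff.mpr h
  have h1 := congrArg (fun X => star x ⬝ᵥ (X *ᵥ x)) (conjTranspose_siegelDenom_mul_sub hM hZ.1)
  simp only [sub_mulVec, ← mulVec_mulVec, hx0, mulVec_zero, sub_zero, smul_mulVec,
    dotProduct_smul] at h1
  rw [dotProduct_mulVec, ← star_mulVec, hx0, star_zero, zero_dotProduct] at h1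
  have h2 := hZ.2.map_ofReal.dotProduct_mulVec_pos hx
  have h3 : (2 * I : ℂ) ≠ 0 := by simp
  exact (smul_ne_zero h3 h2.ne') h1.symm

theorem siegelAction_mul_siegelDenom (hM : M ∈ symplecticGroup (Fin n) ℤ)
    (hZ : Z ∈ siegelUpperHalfSpace n) :
    siegelAction M Z * siegelDenom M Z = siegelNum M Z := by
  rw [siegelAction_eq, Matrix.mul_assoc, nonsing_inv_mul _ (isUnit_det_siegelDenom hM hZ),
    Matrix.mul_one]

theorem siegelAction_eq_of_mul_eq (hM : M ∈ symplecticGroup (Fin n) ℤ)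
    (hZ : Z ∈ siegelUpperHalfSpace n) {W : Matrix (Fin n) (Fin n) ℂ}
    (h : W * siegelDenom M Z = siegelNum M Z) : siegelAction M Z = W := by
  rw [siegelAction_eq, ← h, Matrix.mul_assoc, mul_nonsing_inv _ (isUnit_det_siegelDenom hM hZ),
    Matrix.mul_one]

/-- With N = CZ + D, the imaginary part of the image is N⁻* (Im Z) N⁻¹, which is positive definite.
-/
theorem siegelAction_mem (hM : M ∈ symplecticGroup (Fin n) ℤ)
    (hZ : Z ∈ siegelUpperHalfSpace n) : siegelAction M Z ∈ siegelUpperHalfSpace n := by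
  set N := siegelDenom M Z with hN
  set W := siegelAction M Z with hW
  have hu : IsUnit N.det := isUnit_det_siegelDenom hM hZ
  have hWN : W * N = siegelNum M Z := siegelAction_mul_siegelDenom hM hZ
  have hinv : N * N⁻¹ = 1 := mul_nonsing_inv _ hu
  have hsymm : W.IsSymm := by
    have h := siegelNum_mul_siegelDenom_sub hM Z Z
    rw [hZ.1.eq, sub_self, sub_eq_zero, ← hWN, ← hN, transpose_mul, Matrix.mul_assoc] at h
    have h1 := congrArg (fun X => N⁻¹ᵀ * X * N⁻¹) h
    have hinv' : N⁻¹ᵀ * Nᵀ = 1 := by rw [← transpose_mul, hinv, transpose_one]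
    simp only [← Matrix.mul_assoc, hinv', Matrix.one_mul] at h1
    simp only [Matrix.mul_assoc, hinv, Matrix.mul_one] at h1
    exact h1
  have hsymm_im : (W.map im).IsSymm := by
    ext i j
    simp [hsymm.apply i j]
  refine ⟨hsymm, .of_map_ofReal hsymm_im ?_⟩
  have h := conjTranspose_siegelDenom_mul_sub hM hZ.1
  have h1 : (2 * I) • (W.map im).map ofReal =
      (2 * I) • (N⁻¹ᴴ * (Z.map im).map ofReal * N⁻¹) := by
    have hinv' : N⁻¹ᴴ * Nᴴ = 1 := by rw [← conjTranspose_mul, hinv, conjTranspose_one]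
    rw [two_I_smul_map_im hsymm, ← Matrix.smul_mul, ← Matrix.mul_smul, ← h, ← hN, ← hWN,
      conjTranspose_mul]
    calc W - Wᴴ = (N⁻¹ᴴ * Nᴴ) * (W - Wᴴ) * (N * N⁻¹) := by rw [hinv, hinv']; simp
      _ = _ := by noncomm_ring
  have h2 : (2 * I : ℂ) ≠ 0 := by simp
  rw [smul_right_injective _ h2 h1]
  refine hZ.2.map_ofReal.conjTranspose_mul_mul_same (mulVec_injective_iff_isUnit.mpr ?_)
  exact (isUnit_iff_isUnit_det _).mpr (isUnit_nonsing_inv_det _ hu)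

theorem siegelNum_mul_eq (M₁ : Matrix (Fin n ⊕ Fin n) (Fin n ⊕ Fin n) ℤ)
    (hM : M ∈ symplecticGroup (Fin n) ℤ) (hZ : Z ∈ siegelUpperHalfSpace n) :
    siegelNum (M₁ * M) Z = siegelNum M₁ (siegelAction M Z) * siegelDenom M Z ∧
      siegelDenom (M₁ * M) Z = siegelDenom M₁ (siegelAction M Z) * siegelDenom M Z := by
  have h := siegelAction_mul_siegelDenom hM hZ
  have hM' : M₁ * M = fromBlocks M₁.toBlocks₁₁ M₁.toBlocks₁₂ M₁.toBlocks₂₁ M₁.toBlocks₂₂ *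
      fromBlocks M.toBlocks₁₁ M.toBlocks₁₂ M.toBlocks₂₁ M.toBlocks₂₂ := by
    rw [fromBlocks_toBlocks, fromBlocks_toBlocks]
  set c := (Int.castRingHom ℂ).mapMatrix (m := Fin n)
  have hc : ∀ X : Matrix (Fin n) (Fin n) ℤ, X.map (Int.cast : ℤ → ℂ) = c X := fun X => rfl
  rw [hM', fromBlocks_multiply]
  constructor
  · rw [siegelNum, siegelNum, add_mul, Matrix.mul_assoc, h]
    simp only [siegelNum, siegelDenom, toBlocks_fromBlocks₁₁, toBlocks_fromBlocks₁₂, hc, map_add,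
      map_mul]
    noncomm_ring
  · rw [siegelDenom, siegelDenom, add_mul, Matrix.mul_assoc, h]
    simp only [siegelNum, siegelDenom, toBlocks_fromBlocks₂₁, toBlocks_fromBlocks₂₂, hc, map_add,
      map_mul]
    noncomm_ring

theorem siegelDenom_mul (M₁ : Matrix (Fin n ⊕ Fin n) (Fin n ⊕ Fin n) ℤ)
    (hM : M ∈ symplecticGroup (Fin n) ℤ) (hZ : Z ∈ siegelUpperHalfSpace n) :
    siegelDenom (M₁ * M) Z = siegelDenom M₁ (siegelAction M Z) * siegelDenom M Z :=
  (siegelNum_mul_eq M₁ hM hZ).2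

theorem siegelAction_mul (M₁ : Matrix (Fin n ⊕ Fin n) (Fin n ⊕ Fin n) ℤ)
    (hM : M ∈ symplecticGroup (Fin n) ℤ) (hZ : Z ∈ siegelUpperHalfSpace n) :
    siegelAction (M₁ * M) Z = siegelAction M₁ (siegelAction M Z) := by
  rw [siegelAction_eq, (siegelNum_mul_eq M₁ hM hZ).1, (siegelNum_mul_eq M₁ hM hZ).2,
    Matrix.mul_inv_rev, siegelAction_eq M₁, Matrix.mul_assoc, ← Matrix.mul_assoc (siegelDenom M Z),
    mul_nonsing_inv _ (isUnit_det_siegelDenom hM hZ), Matrix.one_mul]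

/-- The transformation law for the full modular group follows from its special cases for
generators. -/
theorem siegel_transform_of_generators {k : ℕ} {f : Matrix (Fin n) (Fin n) ℂ → ℂ}
    (shear : ∀ S : Matrix (Fin n) (Fin n) ℤ, S.IsSymm → ∀ Z ∈ siegelUpperHalfSpace n,
      f (siegelAction (symplecticShear S) Z) =
        (siegelDenom (symplecticShear S) Z).det ^ k * f Z)
    (levi : ∀ U V : Matrix (Fin n) (Fin n) ℤ, V * U = 1 → ∀ Z ∈ siegelUpperHalfSpace n,
      f (siegelAction (symplecticLevi U V) Z) =
        (siegelDenom (symplecticLevi U V) Z).det ^ k * f Z)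
    (flip : ∀ i, ∀ Z ∈ siegelUpperHalfSpace n, f (siegelAction (symplecticFlip i) Z) =
        (siegelDenom (symplecticFlip i) Z).det ^ k * f Z)
    (hM : M ∈ symplecticGroup (Fin n) ℤ) (hZ : Z ∈ siegelUpperHalfSpace n) :
    f (siegelAction M Z) = (siegelDenom M Z).det ^ k * f Z := by
  have step : ∀ g ∈ symplecticGroup (Fin n) ℤ,
      (∀ Z ∈ siegelUpperHalfSpace n, f (siegelAction g Z) = (siegelDenom g Z).det ^ k * f Z) →
      ∀ M ∈ symplecticGroup (Fin n) ℤ,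
      (∀ Z ∈ siegelUpperHalfSpace n,
        f (siegelAction (g * M) Z) = (siegelDenom (g * M) Z).det ^ k * f Z) →
      ∀ Z ∈ siegelUpperHalfSpace n, f (siegelAction M Z) = (siegelDenom M Z).det ^ k * f Z := by
    intro g hg h M hM hgM Z hZ
    have hW := siegelAction_mem hM hZ
    have h1 := hgM Z hZ
    rw [siegelAction_mul g hM hZ, siegelDenom_mul g hM hZ, h _ hW, det_mul, mul_pow, mul_assoc]
      at h1
    exact mul_left_cancel₀ (pow_ne_zero _ (isUnit_det_siegelDenom hg hW).ne_zero) h1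
  exact symplectic_induction (fun M => ∀ Z ∈ siegelUpperHalfSpace n,
      f (siegelAction M Z) = (siegelDenom M Z).det ^ k * f Z) shear
    (fun S hS => step _ (symplecticShear_mem hS) (shear S hS))
    (fun U V h => step _ (symplecticLevi_mem h) (levi U V h))
    (fun i => step _ (symplecticFlip_mem i) (flip i)) hM Z hZ

end Siegel

/-! ### Theta series of unimodular lattices are Siegel modular forms -/

/-- Modulo two the terms (i, j) and (j, i) cancel and the diagonal terms vanish. -/
theorem even_sum_mul_of_symm {n : ℕ} {X S : Fin n → Fin n → ℤ} (hX : ∀ i j, X i j = X j i)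
    (hS : ∀ i j, S i j = S j i) (hd : ∀ i, Even (X i i)) : Even (∑ i, ∑ j, X i j * S i j) := by
  rw [even_iff_two_dvd, ← Fintype.sum_prod_type']
  refine (ZMod.intCast_zmod_eq_zero_iff_dvd _ 2).mp ?_
  push_cast
  refine Finset.sum_involution (fun p _ => p.swap) (fun p _ => ?_) (fun p _ hp h => hp ?_)
    (fun _ _ => Finset.mem_univ _) (fun p _ => Prod.swap_swap p)
  · rw [Prod.fst_swap, Prod.snd_swap, hX p.2, hS p.2]
    have : ∀ x : ZMod 2, x + x = 0 := by decide
    exact this _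
  · have h1 : p.2 = p.1 := congrArg Prod.fst h
    have h2 : ((X p.1 p.1 : ℤ) : ZMod 2) = 0 :=
      (ZMod.intCast_zmod_eq_zero_iff_dvd _ 2).mpr (hd p.1).two_dvd
    rw [h1, h2, zero_mul]

namespace EvenLattice

open Complex Matrix

variable {Λ : EvenLattice.{u}} {n : ℕ}

theorem summable_thetaTerm (Λ : EvenLattice.{u}) {Z : Matrix (Fin n) (Fin n) ℂ}
    (hZ : Z ∈ siegelUpperHalfSpace n) : Summable (Λ.thetaTerm Z) :=
  (Λ.summable_mul_cexp_trace (a := fun _ => 1) (fun _ => by simp) Real.pi_pos hZ).congr fun g => by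
    rw [one_mul, thetaTerm]

theorem theta_shear (Λ : EvenLattice.{u}) (k : ℕ) {S : Matrix (Fin n) (Fin n) ℤ} (hS : S.IsSymm)
    (Z : Matrix (Fin n) (Fin n) ℂ) :
    Λ.theta n (siegelAction (symplecticShear S) Z) =
      (siegelDenom (symplecticShear S) Z).det ^ k * Λ.theta n Z := by
  have hN : siegelDenom (symplecticShear S) Z = 1 := by
    simp [siegelDenom, symplecticShear]
  have hA : siegelAction (symplecticShear S) Z = Z + S.map (Int.cast : ℤ → ℂ) := by
    rw [siegelAction, hN]
    simp [symplecticShear]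
  rw [hN, hA, det_one, one_pow, one_mul]
  refine tsum_congr fun g => ?_
  rw [thetaTerm, thetaTerm, trace_gram_mul, trace_gram_mul]
  obtain ⟨c, hc⟩ := (even_sum_mul_of_symm (X := fun i j => Λ.form (g i) (g j)) (S := S)
    (fun i j => Λ.symm _ _) (fun i j => hS.apply j i) (fun i => Λ.even _)).two_dvd
  have hc' := congrArg (Int.cast : ℤ → ℂ) hc
  push_cast at hc'
  simp only [Matrix.add_apply, map_apply, mul_add, Finset.sum_add_distrib]
  rw [hc', ← mul_add, mul_add, Complex.exp_add,
    show (Real.pi * I * (2 * c) : ℂ) = c * (2 * Real.pi * I) by ring,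
    Complex.exp_int_mul_two_pi_mul_I, mul_one]

theorem gram_sum_smul (U : Matrix (Fin n) (Fin n) ℤ) (g : Fin n → Λ) :
    Λ.gram (fun p => ∑ i, U i p • g i) = Uᵀ * Λ.gram g * U := by
  ext p q
  simp only [gram, of_apply, mul_apply, transpose_apply, map_sum, LinearMap.sum_apply, map_smul,
    LinearMap.smul_apply, smul_eq_mul, Finset.mul_sum, Finset.sum_mul]
  exact Finset.sum_congr rfl fun i _ => Finset.sum_congr rfl fun j _ => by ring

/-- The reindexing of tuples by an invertible integral matrix. -/
def tupleSmulEquiv (Λ : EvenLattice.{u}) {U V : Matrix (Fin n) (Fin n) ℤ} (h : V * U = 1) :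
    (Fin n → Λ) ≃ (Fin n → Λ) where
  toFun g p := ∑ i, U i p • g i
  invFun g p := ∑ i, V i p • g i
  left_inv g := by
    have h' : U * V = 1 := mul_eq_one_comm.mp h
    funext p
    simp only [Finset.smul_sum, smul_smul]
    rw [Finset.sum_comm]
    have : ∀ j, ∑ i, (V i p * U j i) • g j = (1 : Matrix (Fin n) (Fin n) ℤ) j p • g j := by
      intro j
      rw [← Finset.sum_smul, ← h', mul_apply]
      congr 1
      exact Finset.sum_congr rfl fun i _ => mul_comm _ _
    simp [this, one_apply]
  right_inv g := by
    funext p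
    simp only [Finset.smul_sum, smul_smul]
    rw [Finset.sum_comm]
    have : ∀ j, ∑ i, (U i p * V j i) • g j = (1 : Matrix (Fin n) (Fin n) ℤ) j p • g j := by
      intro j
      rw [← Finset.sum_smul, ← h, mul_apply]
      congr 1
      exact Finset.sum_congr rfl fun i _ => mul_comm _ _
    simp [this, one_apply]

/-- Replacing the tuple g by its image under U is a bijection of the summation range. The
determinant factor is a power of ±1, which is trivial because the weight is even. -/
theorem theta_levi (Λ : EvenLattice.{u}) {k : ℕ} (hk : Even k) {U V : Matrix (Fin n) (Fin n) ℤ}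
    (h : V * U = 1) {Z : Matrix (Fin n) (Fin n) ℂ} (hZ : Z ∈ siegelUpperHalfSpace n) :
    Λ.theta n (siegelAction (symplecticLevi U V) Z) =
      (siegelDenom (symplecticLevi U V) Z).det ^ k * Λ.theta n Z := by
  set c := (Int.castRingHom ℂ).mapMatrix (m := Fin n)
  have hc : ∀ X : Matrix (Fin n) (Fin n) ℤ, X.map (Int.cast : ℤ → ℂ) = c X := fun X => rfl
  have hN : siegelDenom (symplecticLevi U V) Z = c Vᵀ := by
    simp [siegelDenom, symplecticLevi, hc]
  have hA : siegelAction (symplecticLevi U V) Z = c U * Z * c Uᵀ := by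
    refine siegelAction_eq_of_mul_eq (symplecticLevi_mem h) hZ ?_
    rw [hN, Matrix.mul_assoc, ← map_mul, ← transpose_mul, h, transpose_one, map_one]
    simp [siegelNum, symplecticLevi, hc]
  have hdet : (siegelDenom (symplecticLevi U V) Z).det ^ k = 1 := by
    have h1 : (c Vᵀ).det = ((V.det : ℤ) : ℂ) := by
      rw [← RingHom.map_det, det_transpose]; rfl
    have h2 : V.det = 1 ∨ V.det = -1 :=
      Int.isUnit_iff.mp (IsUnit.of_mul_eq_one U.det (by rw [← det_mul, h, det_one]))
    rw [hN, h1]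
    rcases h2 with h2 | h2 <;> rw [h2] <;> simp [hk.neg_one_pow]
  rw [hdet, one_mul, hA, theta, theta, ← (Λ.tupleSmulEquiv h).tsum_eq (Λ.thetaTerm Z)]
  refine tsum_congr fun g => ?_
  rw [thetaTerm, thetaTerm]
  congr 2
  have h3 : Λ.gram (Λ.tupleSmulEquiv h g) = Uᵀ * Λ.gram g * U := gram_sum_smul U g
  rw [h3, hc, hc, map_mul, map_mul, Matrix.mul_assoc (c Uᵀ), Matrix.mul_assoc (c Uᵀ),
    Matrix.trace_mul_comm (c Uᵀ)]
  simp only [Matrix.mul_assoc]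

/-- The partial inversion of a symmetric matrix in the coordinate `i`. -/
noncomputable def partialInversion (i : Fin n) (Z : Matrix (Fin n) (Fin n) ℂ) :
    Matrix (Fin n) (Fin n) ℂ :=
  of fun p q => if p = i then (if q = i then -1 / Z i i else Z i q / Z i i) else
    if q = i then Z p i / Z i i else Z p q - Z p i * Z i q / Z i i

theorem im_diag_pos {Z : Matrix (Fin n) (Fin n) ℂ} (hZ : Z ∈ siegelUpperHalfSpace n) (i : Fin n) :
    0 < (Z i i).im := hZ.2.diag_pos

theorem siegelDenom_flip (i : Fin n) (Z : Matrix (Fin n) (Fin n) ℂ) (p q : Fin n) :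
    siegelDenom (symplecticFlip i) Z p q = if p = i then Z i q else if p = q then 1 else 0 := by
  simp only [siegelDenom, symplecticFlip, toBlocks_fromBlocks₂₁, toBlocks_fromBlocks₂₂,
    Matrix.add_apply, mul_apply, map_apply, single_apply, Matrix.sub_apply, one_apply]
  by_cases h : p = i
  · subst h
    simp only [true_and, if_true]
    split_ifs <;> simp_all
  · simp [h, Ne.symm h]

theorem siegelNum_flip (i : Fin n) (Z : Matrix (Fin n) (Fin n) ℂ) (p q : Fin n) :
    siegelNum (symplecticFlip i) Z p q = if p = i then (if q = i then -1 else 0) else Z p q := by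
  simp only [siegelNum, symplecticFlip, toBlocks_fromBlocks₁₁, toBlocks_fromBlocks₁₂,
    Matrix.add_apply, mul_apply, map_apply, single_apply, Matrix.sub_apply, one_apply,
    Matrix.neg_apply]
  by_cases h : p = i
  · subst h
    by_cases hq : q = p
    · simp [hq]
    · simp [hq, Ne.symm hq]
  · simp [h, Ne.symm h]

theorem siegelAction_flip {Z : Matrix (Fin n) (Fin n) ℂ} (hZ : Z ∈ siegelUpperHalfSpace n)
    (i : Fin n) : siegelAction (symplecticFlip i) Z = partialInversion i Z := by
  have h0 : Z i i ≠ 0 := fun h => by simpa [h] using im_diag_pos hZ i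
  refine siegelAction_eq_of_mul_eq (symplecticFlip_mem i) hZ ?_
  ext p q
  have h : (partialInversion i Z * siegelDenom (symplecticFlip i) Z) p q =
      partialInversion i Z p i * Z i q +
        if q = i then 0 else partialInversion i Z p q := by
    rw [mul_apply, ← Finset.add_sum_erase _ _ (Finset.mem_univ i)]
    congr 1
    · rw [siegelDenom_flip, if_pos rfl]
    · rw [Finset.sum_congr rfl fun r hr => by
        rw [siegelDenom_flip, if_neg (Finset.ne_of_mem_erase hr)]]
      simp
  rw [h, siegelNum_flip]
  simp only [partialInversion, of_apply, if_true]
  split_ifs with h1 h2 h2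
  · subst h2; field_simp; simp
  · field_simp; ring
  · subst h2; field_simp; simp
  · field_simp; ring

theorem det_siegelDenom_flip (i : Fin n) (Z : Matrix (Fin n) (Fin n) ℂ) :
    (siegelDenom (symplecticFlip i) Z).det = Z i i := by
  have h : (siegelDenom (symplecticFlip i) Z)ᵀ = (1 : Matrix (Fin n) (Fin n) ℂ).updateCol i (Z i) := by
    ext p q
    rw [transpose_apply, siegelDenom_flip, updateCol_apply, one_apply]
    simp [eq_comm]
  rw [← det_transpose, h, ← cramer_apply, cramer_one]
  rfl

theorem sum_form_update {Z : Matrix (Fin n) (Fin n) ℂ} (hZ : Z.IsSymm) (i : Fin n)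
    (h : Fin n → Λ) (x : Λ) :
    ∑ p, ∑ q, (Λ.form ((h + Pi.single i x : Fin n → Λ) p) ((h + Pi.single i x : Fin n → Λ) q) : ℂ) *
        Z p q =
      Z i i * Λ.form x x + 2 * ∑ p, Z i p * Λ.form x (h p) +
        ∑ p, ∑ q, Λ.form (h p) (h q) * Z p q := by
  have e : ∀ (y : Λ) q, (Λ.form y ((Pi.single i x : Fin n → Λ) q) : ℂ) =
      if q = i then (Λ.form y x : ℂ) else 0 := by
    intro y q
    by_cases hq : q = i
    · subst hq; simp
    · simp [hq]
  have e' : ∀ (y : Λ) q, (Λ.form ((Pi.single i x : Fin n → Λ) q) y : ℂ) =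
      if q = i then (Λ.form x y : ℂ) else 0 := by
    intro y q
    rw [Λ.symm, e, Λ.symm]
  simp only [Pi.add_apply, map_add, LinearMap.add_apply, Int.cast_add, add_mul,
    Finset.sum_add_distrib, e, e', ite_mul, zero_mul, Finset.sum_ite_eq', Finset.mem_univ, if_true,
    Finset.sum_ite_irrel, Finset.sum_const_zero]
  have h1 : ∑ p, (Λ.form (h p) x : ℂ) * Z p i = ∑ p, Z i p * Λ.form x (h p) :=
    Finset.sum_congr rfl fun p _ => by rw [Λ.symm, hZ.apply, mul_comm]
  have h2 : ∑ p, (Λ.form x (h p) : ℂ) * Z i p = ∑ p, Z i p * Λ.form x (h p) :=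
    Finset.sum_congr rfl fun p _ => mul_comm _ _
  rw [h1, h2]
  ring

/-- Only the i-th lattice vector is summed by Poisson, the others being held fixed: the parameter is
Z i i and the shift is given by row i of Z. Completing the square turns Z into its partial
inversion, and the factor is a power of Z i i, the determinant of CZ + D. -/
theorem theta_flip (hΛ : Λ.IsUnimodular) (i : Fin n) {Z : Matrix (Fin n) (Fin n) ℂ}
    (hZ : Z ∈ siegelUpperHalfSpace n) :
    Λ.theta n (siegelAction (symplecticFlip i) Z) =
      (siegelDenom (symplecticFlip i) Z).det ^ (Λ.rank / 2) * Λ.theta n Z := by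
  have h0 : Z i i ≠ 0 := fun h => by simpa [h] using im_diag_pos hZ i
  have hW := siegelAction_mem (symplecticFlip_mem i) hZ
  rw [siegelAction_flip hZ] at hW
  rw [det_siegelDenom_flip, siegelAction_flip hZ]
  let e : ({j // j ≠ i} → Λ) × Λ ≃ (Fin n → Λ) :=
    (Equiv.prodComm _ _).trans (Equiv.piSplitAt i fun _ => (Λ : Type u)).symm
  have he : ∀ r x, e (r, x) = e (r, 0) + Pi.single i x := by
    intro r x
    funext p
    by_cases hp : p = i
    · subst hp; simp [e]
    · simp [e, hp]
  -- With a zero in place i, the exceptional entries of the partial inversion in row and column i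
  -- drop out of the sums over the fixed vectors.
  have he0 : ∀ r, e (r, 0) i = 0 := fun r => by simp [e]
  have hsplit : ∀ W ∈ siegelUpperHalfSpace n,
      Λ.theta n W = ∑' r, ∑' x, Λ.thetaTerm W (e (r, x)) := by
    intro W hW
    rw [theta, ← e.tsum_eq]
    exact (e.summable_iff.mpr (Λ.summable_thetaTerm hW)).tsum_prod
  rw [hsplit _ hW, hsplit _ hZ, ← tsum_mul_left]
  refine tsum_congr fun r => ?_
  have hp := tsum_cexp_form_eq hΛ (im_diag_pos hZ i) (fun p => Z i p) (e (r, 0))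
  set h := e (r, 0) with hh
  set T : ℂ := ∑ p, ∑ q, Λ.form (h p) (h q) * Z p q with hT
  have h1 : ∀ x, Λ.thetaTerm Z (e (r, x)) = cexp (Real.pi * I * T) *
      cexp (Real.pi * I * Z i i * Λ.form x x + 2 * Real.pi * I * ∑ j, Z i j * Λ.form x (h j)) := by
    intro x
    rw [thetaTerm, trace_gram_mul, he, sum_form_update hZ.1, ← Complex.exp_add]
    congr 1
    ring
  have h2 : ∀ x, Λ.thetaTerm (partialInversion i Z) (e (r, x)) = cexp (Real.pi * I * T) *
      cexp (Real.pi * I * (-1 / Z i i) * (Λ.form x x - 2 * ∑ j, Z i j * Λ.form x (h j) +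
          ∑ j, ∑ l, Z i j * Z i l * Λ.form (h j) (h l))) := by
    intro x
    rw [thetaTerm, trace_gram_mul, he, sum_form_update hW.1, ← Complex.exp_add]
    congr 1
    have h3 : partialInversion i Z i i = -1 / Z i i := by simp [partialInversion]
    have h4 : ∑ p, partialInversion i Z i p * Λ.form x (h p) =
        (∑ p, Z i p * Λ.form x (h p)) / Z i i := by
      rw [Finset.sum_div]
      refine Finset.sum_congr rfl fun p _ => ?_
      by_cases hp : p = i
      · subst hp; simp [hh, he0]
      · simp only [partialInversion, of_apply, if_true, if_neg hp]; ring
    have h5 : ∑ p, ∑ q, Λ.form (h p) (h q) * partialInversion i Z p q =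
        T - (∑ p, ∑ q, Z i p * Z i q * Λ.form (h p) (h q)) / Z i i := by
      rw [hT, Finset.sum_div, ← Finset.sum_sub_distrib]
      refine Finset.sum_congr rfl fun p _ => ?_
      rw [Finset.sum_div, ← Finset.sum_sub_distrib]
      refine Finset.sum_congr rfl fun q _ => ?_
      by_cases hp : p = i
      · subst hp; simp [hh, he0]
      by_cases hq : q = i
      · subst hq; simp [hh, he0]
      simp only [partialInversion, of_apply, if_neg hp, if_neg hq]
      rw [hZ.1.apply i p]
      ring
    rw [← hh, h3, h4, h5]
    ring
  simp only [h1, h2, tsum_mul_left]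
  rw [hp, mul_left_comm, mul_inv_cancel_left₀ (pow_ne_zero _ h0)]

theorem theta_transform (hΛ : Λ.IsUnimodular) {M : Matrix (Fin n ⊕ Fin n) (Fin n ⊕ Fin n) ℤ}
    (hM : M ∈ symplecticGroup (Fin n) ℤ) {Z : Matrix (Fin n) (Fin n) ℂ}
    (hZ : Z ∈ siegelUpperHalfSpace n) :
    Λ.theta n (siegelAction M Z) = (siegelDenom M Z).det ^ (Λ.rank / 2) * Λ.theta n Z :=
  siegel_transform_of_generators (fun _ hS Z _ => Λ.theta_shear _ hS Z)
    (fun _ _ h _ hZ => Λ.theta_levi (even_half_rank hΛ) h hZ)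
    (fun i _ hZ => theta_flip hΛ i hZ) hM hZ

end EvenLattice

namespace EvenLattice

open Complex QuadraticMap

variable {Λ : EvenLattice.{u}}

/-! ### Perestroikas of unimodular lattices -/

theorem mem_preimage {F : Submodule (ZMod 2) (ModTwo Λ)} {x : Λ} :
    x ∈ Λ.preimage F ↔ ModTwo.proj Λ x ∈ F := Iff.rfl

theorem two_smul_mem_preimage (F : Submodule (ZMod 2) (ModTwo Λ)) (x : Λ) :
    (2 : ℤ) • x ∈ Λ.preimage F := by
  rw [mem_preimage, show ModTwo.proj Λ ((2 : ℤ) • x) = 0 from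
    ModTwo.proj_eq_zero_iff.mpr ⟨x, by rw [two_zsmul, two_nsmul]⟩]
  exact F.zero_mem

theorem two_mul_form_perestroika {F : Submodule (ZMod 2) (ModTwo Λ)} (hF : IsIsotropic Λ.q F)
    (x y : Λ.preimage F) : 2 * (Λ.perestroika F hF).form x y = Λ.form x y :=
  Int.mul_ediv_cancel' (even_form_of_isIsotropic hF x y)

/-- The inverse image of F lies between 2Λ and Λ. -/
theorem rank_perestroika {F : Submodule (ZMod 2) (ModTwo Λ)} (hF : IsIsotropic Λ.q F) :
    (Λ.perestroika F hF).rank = Λ.rank := by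
  refine le_antisymm (Submodule.finrank_le (Λ.preimage F)) ?_
  let f : Λ →ₗ[ℤ] Λ.preimage F :=
    (LinearMap.lsmul ℤ Λ 2).codRestrict _ (two_smul_mem_preimage F)
  refine LinearMap.finrank_le_finrank_of_injective (f := f) fun x y h => ?_
  exact smul_right_injective Λ (two_ne_zero (α := ℤ)) (congrArg Subtype.val h)

theorem form_injective (Λ : EvenLattice.{u}) :
    Function.Injective (Λ.form : Λ → (Λ →ₗ[ℤ] ℤ)) := by
  intro x y h
  by_contra hne
  have h1 := Λ.pos (x - y) (sub_ne_zero.mpr hne)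
  rw [Λ.form.map_sub, h, sub_self] at h1
  exact lt_irrefl _ h1

/-- A functional φ on the inverse image of F becomes one on Λ through x ↦ φ(2x), represented by some
y in Λ. On the inverse image (y, x) = 2φ(x) is even, so y reduces into the complement of F, which is
F; halving the form then represents φ by y. -/
theorem isUnimodular_perestroika (hΛ : Λ.IsUnimodular) {F : Submodule (ZMod 2) (ModTwo Λ)}
    (hF : IsLagrangian Λ.q F) : (Λ.perestroika F hF.isIsotropic).IsUnimodular := by
  refine ⟨form_injective _, fun φ => ?_⟩
  let f : Λ →ₗ[ℤ] Λ.preimage F :=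
    (LinearMap.lsmul ℤ Λ 2).codRestrict _ (two_smul_mem_preimage F)
  have hf : ∀ x : Λ.preimage F, f x = (2 : ℤ) • x := fun x => Subtype.ext rfl
  let φ' : Λ.preimage F →ₗ[ℤ] ℤ := φ
  obtain ⟨y, hy⟩ := hΛ.2 (φ'.comp f)
  have hyx : ∀ x : Λ.preimage F, Λ.form y x = 2 * φ' x := by
    intro x
    rw [hy, LinearMap.comp_apply, hf, map_smul, smul_eq_mul]
  have hmem : y ∈ Λ.preimage F := by
    refine hF.polarPerp_le fun z hz => ?_
    obtain ⟨x, rfl⟩ := ModTwo.proj_surjective z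
    rw [polar_q_proj, hyx ⟨x, hz⟩]
    exact (ZMod.intCast_zmod_eq_zero_iff_dvd _ 2).mpr ⟨_, rfl⟩
  refine ⟨(⟨y, hmem⟩ : Λ.preimage F), LinearMap.ext fun x => ?_⟩
  have h1 := two_mul_form_perestroika hF.isIsotropic (⟨y, hmem⟩ : Λ.preimage F) x
  exact mul_left_cancel₀ two_ne_zero (h1.trans (hyx x))

theorem thetaTerm_perestroika {F : Submodule (ZMod 2) (ModTwo Λ)} (hF : IsIsotropic Λ.q F)
    {n : ℕ} (Z : Matrix (Fin n) (Fin n) ℂ) (g : Fin n → Λ.preimage F) :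
    (Λ.perestroika F hF).thetaTerm Z g = cexp (Real.pi * I / 2 *
      ((Λ.gram fun i => (g i : Λ)).map (Int.cast : ℤ → ℂ) * Z).trace) := by
  have e : (Λ.perestroika F hF).thetaTerm Z g = cexp (Real.pi * I *
      ∑ i, ∑ j, ((Λ.perestroika F hF).form (g i) (g j) : ℂ) * Z i j) :=
    congrArg (fun t => cexp (Real.pi * I * t)) ((Λ.perestroika F hF).trace_gram_mul g Z)
  rw [e, trace_gram_mul]
  have h : ∑ i, ∑ j, (Λ.form (g i) (g j) : ℂ) * Z i j =
      2 * ∑ i, ∑ j, ((Λ.perestroika F hF).form (g i) (g j) : ℂ) * Z i j := by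
    rw [Finset.mul_sum]
    refine Finset.sum_congr rfl fun i _ => ?_
    rw [Finset.mul_sum]
    refine Finset.sum_congr rfl fun j _ => ?_
    rw [← two_mul_form_perestroika hF, Int.cast_mul]
    push_cast
    ring
  rw [h]
  congr 1
  ring

/-! ### Isomorphic lattices -/

theorem Iso.theta_eq {L L' : EvenLattice.{u}} (h : L.Iso L') (n : ℕ)
    (Z : Matrix (Fin n) (Fin n) ℂ) : L.theta n Z = L'.theta n Z := by
  obtain ⟨φ, hφ⟩ := h
  rw [theta, theta, ← ((Equiv.refl (Fin n)).arrowCongr φ.toEquiv).tsum_eq]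
  refine tsum_congr fun g => ?_
  rw [thetaTerm, thetaTerm, trace_gram_mul, trace_gram_mul]
  simp only [Equiv.arrowCongr_apply, Equiv.refl_symm, Equiv.coe_refl, Function.comp_apply, id,
    LinearEquiv.coe_toEquiv, hφ]

/-! ### Automorphisms -/

/-- The terms of a convergent Gaussian sum exceed a given level only finitely often. -/
theorem finite_setOf_form_le (Λ : EvenLattice.{u}) (N : ℤ) : {x : Λ | Λ.form x x ≤ N}.Finite := by
  have h := (Λ.summable_exp_neg_form one_pos).tendsto_cofinite_zero
  have h1 := h.eventually (gt_mem_nhds (Real.exp_pos (-(Real.pi * 1 * N))))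
  rw [Filter.eventually_cofinite] at h1
  refine h1.subset fun x hx => ?_
  simp only [Set.mem_ofPred_eq, not_lt, Real.exp_le_exp, neg_le_neg_iff] at hx ⊢
  exact mul_le_mul_of_nonneg_left (by exact_mod_cast hx) (by positivity)

/-- An automorphism is determined by the images of a basis, and each image has bounded norm. -/
instance finite_aut (Λ : EvenLattice.{u}) : Finite Λ.Aut := by
  let b := Module.finBasis ℤ Λ
  have hfin : ∀ i, Finite {x : Λ // Λ.form x x ≤ Λ.form (b i) (b i)} := fun i =>
    (Λ.finite_setOf_form_le _).to_subtype
  refine Finite.of_injective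
    (fun (σ : Λ.Aut) i => (⟨σ.1 (b i), (σ.2 (b i) (b i)).le⟩ :
      {x : Λ // Λ.form x x ≤ Λ.form (b i) (b i)})) fun σ τ h => ?_
  refine Subtype.ext (LinearEquiv.toLinearMap_injective (b.ext fun i => ?_))
  exact congrArg Subtype.val (congrFun h i)

theorem translate_mul (σ τ : Λ ≃ₗ[ℤ] Λ) (F : Submodule (ZMod 2) (ModTwo Λ)) :
    Λ.translate (σ * τ) F = Λ.translate σ (Λ.translate τ F) := by
  rw [translate, translate, translate, ← Submodule.map_comp]
  congr 1
  ext a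
  obtain ⟨x, rfl⟩ := ModTwo.proj_surjective a
  rfl

theorem translate_one (F : Submodule (ZMod 2) (ModTwo Λ)) : Λ.translate 1 F = F := by
  rw [translate]
  convert Submodule.map_id F
  ext a
  obtain ⟨x, rfl⟩ := ModTwo.proj_surjective a
  rfl

theorem proj_mem_translate_iff {σ : Λ ≃ₗ[ℤ] Λ} {F : Submodule (ZMod 2) (ModTwo Λ)} {x : Λ} :
    ModTwo.proj Λ (σ x) ∈ Λ.translate σ F ↔ ModTwo.proj Λ x ∈ F := by
  constructor
  · intro h
    have h1 : ModTwo.proj Λ (σ⁻¹ (σ x)) ∈ Λ.translate σ⁻¹ (Λ.translate σ F) :=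
      ⟨_, h, rfl⟩
    rw [← translate_mul, inv_mul_cancel, translate_one] at h1
    rwa [show σ⁻¹ (σ x) = x from σ.symm_apply_apply x] at h1
  · exact fun h => ⟨_, h, rfl⟩

theorem IsIsotropic.translate {σ : Λ ≃ₗ[ℤ] Λ} (hσ : σ ∈ Λ.Aut)
    {F : Submodule (ZMod 2) (ModTwo Λ)} (hF : IsIsotropic Λ.q F) :
    IsIsotropic Λ.q (Λ.translate σ F) := by
  rintro _ ⟨a, ha, rfl⟩
  rw [← hF a ha]
  exact (Λ.modTwoIsometry σ hσ).map_app a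

theorem iso_perestroika_translate {σ : Λ ≃ₗ[ℤ] Λ} (hσ : σ ∈ Λ.Aut)
    {F : Submodule (ZMod 2) (ModTwo Λ)} (hF : IsIsotropic Λ.q F)
    (hF' : IsIsotropic Λ.q (Λ.translate σ F)) :
    (Λ.perestroika F hF).Iso (Λ.perestroika (Λ.translate σ F) hF') := by
  have hmap : (Λ.preimage F).map (σ : Λ →ₗ[ℤ] Λ) = Λ.preimage (Λ.translate σ F) := by
    ext y
    rw [Submodule.mem_map]
    constructor
    · rintro ⟨x, hx, rfl⟩
      exact proj_mem_translate_iff.mpr hx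
    · intro hy
      refine ⟨σ.symm y, (proj_mem_translate_iff (σ := σ)).mp ?_, σ.apply_symm_apply y⟩
      rw [σ.apply_symm_apply]
      exact hy
  refine ⟨σ.ofSubmodules _ _ hmap, fun (x y : Λ.preimage F) => ?_⟩
  refine mul_left_cancel₀ (two_ne_zero (α := ℤ)) ?_
  exact (two_mul_form_perestroika hF' _ _).trans
    ((hσ x y).trans (two_mul_form_perestroika hF x y).symm)

/-- The action of the automorphism group on the subspaces of `Λ / 2Λ`. -/
@[reducible]
def autMulAction (Λ : EvenLattice.{u}) : MulAction Λ.Aut (Submodule (ZMod 2) (ModTwo Λ)) where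
  smul σ F := Λ.translate σ F
  one_smul F := translate_one F
  mul_smul σ τ F := translate_mul σ.1 τ.1 F

theorem ncard_setOf_translate_mul_cardAutPair (F : Submodule (ZMod 2) (ModTwo Λ)) :
    {F' | ∃ σ ∈ Λ.Aut, Λ.translate σ F = F'}.ncard * Λ.cardAutPair F = Nat.card Λ.Aut := by
  let _ := Λ.autMulAction
  have h := (MulAction.stabilizer Λ.Aut F).index_mul_card
  rw [MulAction.index_stabilizer] at h
  have e : {F' | ∃ σ ∈ Λ.Aut, Λ.translate σ F = F'} = MulAction.orbit Λ.Aut F := by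
    ext F'
    exact ⟨fun ⟨σ, hσ, h⟩ => ⟨⟨σ, hσ⟩, h⟩, fun ⟨σ, h⟩ => ⟨σ.1, σ.2, h⟩⟩
  rw [e]
  exact h

theorem cardAutPair_pos (F : Submodule (ZMod 2) (ModTwo Λ)) : 0 < Λ.cardAutPair F := by
  have : Nonempty {σ : Λ.Aut // Λ.translate σ F = F} := ⟨⟨1, translate_one F⟩⟩
  exact Nat.card_pos

end EvenLattice

namespace EvenLattice

open Complex QuadraticMap

variable {Λ : EvenLattice.{u}}

/-! ### The twisted theta series as a combination of theta series -/

theorem isLagrangian_of_isMaximalIsotropic (hΛ : Λ.IsUnimodular)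
    {F : Submodule (ZMod 2) (ModTwo Λ)} (hF : IsMaximalIsotropic Λ.q F) : IsLagrangian Λ.q F :=
  IsMaximalIsotropic.isLagrangian (q_nondegenerate hΛ) (quadraticGaussSum_pos hΛ) hF

theorem abs_dicksonSign_le (F₀ F : Submodule (ZMod 2) (ModTwo Λ)) :
    |dicksonSign Λ.q F₀ F| ≤ 1 := by
  rw [dicksonSign]
  split_ifs <;> simp

theorem norm_dicksonSign_le (F₀ F : Submodule (ZMod 2) (ModTwo Λ)) :
    ‖(dicksonSign Λ.q F₀ F : ℂ)‖ ≤ 1 := by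
  rw [norm_intCast]
  exact_mod_cast abs_dicksonSign_le F₀ F

theorem pi_mul_I_div_two : (Real.pi * I / 2 : ℂ) = ((Real.pi / 2 : ℝ) : ℂ) * I := by
  push_cast; ring

theorem summable_twistedThetaTerm (F₀ : Submodule (ZMod 2) (ModTwo Λ)) {n : ℕ}
    {Z : Matrix (Fin n) (Fin n) ℂ} (hZ : Z ∈ siegelUpperHalfSpace n) :
    Summable (Λ.twistedThetaTerm (dicksonSign Λ.q F₀) Z) :=
  (Λ.summable_mul_cexp_trace (a := fun g => (dicksonSign Λ.q F₀ (Λ.spanModTwo g) : ℂ))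
    (fun _ => norm_dicksonSign_le _ _) Real.pi_div_two_pos hZ).congr fun g => by
      rw [twistedThetaTerm, pi_mul_I_div_two]

variable (Λ) in
/-- The theta series of the inverse image of `F` with the bilinear form `(x, y) / 2`. -/
noncomputable def preimageTheta (F : Submodule (ZMod 2) (ModTwo Λ)) (n : ℕ)
    (Z : Matrix (Fin n) (Fin n) ℂ) : ℂ :=
  ∑' g : Fin n → Λ.preimage F, cexp (Real.pi * I / 2 *
    ((Λ.gram fun i => (g i : Λ)).map (Int.cast : ℤ → ℂ) * Z).trace)

theorem theta_perestroika {F : Submodule (ZMod 2) (ModTwo Λ)} (hF : IsIsotropic Λ.q F) (n : ℕ)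
    (Z : Matrix (Fin n) (Fin n) ℂ) :
    (Λ.perestroika F hF).theta n Z = Λ.preimageTheta F n Z :=
  tsum_congr fun g => thetaTerm_perestroika hF Z g

theorem preimageTheta_translate {σ : Λ ≃ₗ[ℤ] Λ} (hσ : σ ∈ Λ.Aut)
    {F : Submodule (ZMod 2) (ModTwo Λ)} (hF : IsIsotropic Λ.q F) (n : ℕ)
    (Z : Matrix (Fin n) (Fin n) ℂ) :
    Λ.preimageTheta (Λ.translate σ F) n Z = Λ.preimageTheta F n Z := by
  rw [← theta_perestroika hF, ← theta_perestroika (IsIsotropic.translate hσ hF)]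
  exact ((iso_perestroika_translate hσ hF _).theta_eq n Z).symm

theorem spanModTwo_le_iff {n : ℕ} {g : Fin n → Λ} {F : Submodule (ZMod 2) (ModTwo Λ)} :
    Λ.spanModTwo g ≤ F ↔ ∀ i, g i ∈ Λ.preimage F := by
  rw [spanModTwo, Submodule.span_le, Set.range_subset_iff]
  rfl

open Classical in
theorem preimageTheta_eq_tsum (F : Submodule (ZMod 2) (ModTwo Λ)) (n : ℕ)
    (Z : Matrix (Fin n) (Fin n) ℂ) :
    Λ.preimageTheta F n Z = ∑' g : Fin n → Λ, if Λ.spanModTwo g ≤ F then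
      cexp (Real.pi * I / 2 * ((Λ.gram g).map (Int.cast : ℤ → ℂ) * Z).trace) else 0 := by
  simp only [spanModTwo_le_iff]
  let e : {g : Fin n → Λ // ∀ i, g i ∈ Λ.preimage F} ≃ (Fin n → Λ.preimage F) :=
    Equiv.subtypePiEquivPi
  rw [preimageTheta, ← e.tsum_eq]
  refine (tsum_subtype {g : Fin n → Λ | ∀ i, g i ∈ Λ.preimage F} fun g => cexp (Real.pi * I / 2 *
    ((Λ.gram g).map (Int.cast : ℤ → ℂ) * Z).trace)).trans (tsum_congr fun g => ?_)
  rw [Set.indicator_apply]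
  exact if_congr Iff.rfl rfl rfl

/-- For each tuple g the sign of F(g) is the sum of the signs of the F that contain it;
interchanging the finite sum over F with the series leaves, for each F, the tuples in its inverse
image. -/
theorem twistedTheta_eq_sum [Fintype (Submodule (ZMod 2) (ModTwo Λ))] (hΛ : Λ.IsUnimodular)
    {F₀ : Submodule (ZMod 2) (ModTwo Λ)} (hF₀ : IsMaximalIsotropic Λ.q F₀) {n : ℕ}
    {Z : Matrix (Fin n) (Fin n) ℂ} (hZ : Z ∈ siegelUpperHalfSpace n) :
    Λ.twistedTheta (dicksonSign Λ.q F₀) n Z =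
      ∑ F, (dicksonSign Λ.q F₀ F : ℂ) * Λ.preimageTheta F n Z := by
  classical
  have hsum : ∀ F : Submodule (ZMod 2) (ModTwo Λ), Summable fun g : Fin n → Λ =>
      if Λ.spanModTwo g ≤ F then
        cexp (Real.pi * I / 2 * ((Λ.gram g).map (Int.cast : ℤ → ℂ) * Z).trace) else 0 := by
    intro F
    refine (Λ.summable_mul_cexp_trace (a := fun g => if Λ.spanModTwo g ≤ F then 1 else 0)
      (fun g => ?_) Real.pi_div_two_pos hZ).congr fun g => ?_
    · split_ifs <;> simp
    · rw [pi_mul_I_div_two, ite_mul, one_mul, zero_mul]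
  simp only [preimageTheta_eq_tsum, ← tsum_mul_left]
  rw [← Summable.tsum_finsetSum fun F _ => (hsum F).mul_left _, twistedTheta]
  refine tsum_congr fun g => ?_
  rw [twistedThetaTerm, ← sum_dicksonSign (q_nondegenerate hΛ) (quadraticGaussSum_pos hΛ)
    (isLagrangian_of_isMaximalIsotropic hΛ hF₀), Finset.sum_filter, Int.cast_sum, Finset.sum_mul]
  refine Finset.sum_congr rfl fun F _ => ?_
  split_ifs <;> simp

/-- Determinant one makes the Dickson invariant of the induced isometry trivial, so the sign is
constant on the orbit and the mass is independent of representatives. -/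
theorem dicksonSign_translate (hΛ : Λ.IsUnimodular)
    {F₀ F : Submodule (ZMod 2) (ModTwo Λ)} (hF₀ : IsMaximalIsotropic Λ.q F₀)
    (hF : IsMaximalIsotropic Λ.q F) {σ : Λ ≃ₗ[ℤ] Λ} (hσ : σ ∈ Λ.Aut)
    (hdet : LinearMap.det (σ : Λ →ₗ[ℤ] Λ) = 1) :
    dicksonSign Λ.q F₀ (Λ.translate σ F) = dicksonSign Λ.q F₀ F := by
  have hL₀ := isLagrangian_of_isMaximalIsotropic hΛ hF₀
  have h := dicksonSign_map (q_nondegenerate hΛ) hL₀ (isLagrangian_of_isMaximalIsotropic hΛ hF)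
    (modTwoIsometry σ hσ)
  rw [dicksonInvariant_modTwoIsometry (hL₀.exists_hyperbolicBasis (q_nondegenerate hΛ)) σ hσ hdet,
    signChar_zero, one_mul] at h
  exact h

theorem isMaximalIsotropic_translate (hΛ : Λ.IsUnimodular) {F : Submodule (ZMod 2) (ModTwo Λ)}
    (hF : IsMaximalIsotropic Λ.q F) {σ : Λ ≃ₗ[ℤ] Λ} (hσ : σ ∈ Λ.Aut) :
    IsMaximalIsotropic Λ.q (Λ.translate σ F) :=
  ((isLagrangian_of_isMaximalIsotropic hΛ hF).map (modTwoIsometry σ hσ)).isMaximalIsotropic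

/-- Sums of invariant functions over the maximal isotropic subspaces. -/
theorem sum_eq_sum_orbitRepresentatives [Fintype (Submodule (ZMod 2) (ModTwo Λ))]
    (hΛ : Λ.IsUnimodular) {R : Finset (Submodule (ZMod 2) (ModTwo Λ))}
    (hR : Λ.IsOrbitRepresentatives R) {h : Submodule (ZMod 2) (ModTwo Λ) → ℂ}
    (h0 : ∀ F, ¬ IsMaximalIsotropic Λ.q F → h F = 0)
    (hinv : ∀ F, IsMaximalIsotropic Λ.q F → ∀ σ ∈ Λ.Aut, h (Λ.translate σ F) = h F) :
    ∑ F, h F = (Nat.card Λ.Aut : ℂ) * ∑ F ∈ R, h F / Λ.cardAutPair F := by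
  classical
  choose! rep hrep hunique using hR.2
  have h1 : ∑ F, h F = ∑ F with IsMaximalIsotropic Λ.q F, h F := by
    rw [Finset.sum_filter]
    refine Finset.sum_congr rfl fun F _ => ?_
    split_ifs with hF
    · rfl
    · exact h0 F hF
  rw [h1, ← Finset.sum_fiberwise_of_maps_to (t := R) (g := rep)
    (fun F hF => (hrep F (Finset.mem_filter.mp hF).2).1), Finset.mul_sum]
  refine Finset.sum_congr rfl fun F' hF' => ?_
  -- The fibre of the map to representatives is a full Aut(Λ)-orbit, whose size is # Aut(Λ) divided
  -- by the order of the stabilizer.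
  have hset : (↑((Finset.univ.filter fun F => IsMaximalIsotropic Λ.q F).filter fun F => rep F = F') :
      Set (Submodule (ZMod 2) (ModTwo Λ))) = {F | ∃ σ ∈ Λ.Aut, Λ.translate σ F' = F} := by
    ext F
    simp only [Finset.coe_filter, Finset.mem_filter, Finset.mem_univ, true_and, Set.mem_ofPred_eq]
    constructor
    · rintro ⟨hF, rfl⟩
      exact (hrep F hF).2
    · rintro ⟨σ, hσ, rfl⟩
      have hF := isMaximalIsotropic_translate hΛ (hR.1 F' hF') hσ
      exact ⟨hF, (hunique _ hF F' ⟨hF', σ, hσ, rfl⟩).symm⟩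
  have hcard := ncard_setOf_translate_mul_cardAutPair F'
  rw [← hset, Set.ncard_coe_finset] at hcard
  rw [Finset.sum_congr rfl (g := fun _ => h F') (fun F hF => by
    rw [← Finset.mem_coe, hset] at hF
    obtain ⟨σ, hσ, rfl⟩ := hF
    exact hinv F' (hR.1 F' hF') σ hσ), Finset.sum_const, nsmul_eq_mul, ← hcard]
  have hne : (Λ.cardAutPair F' : ℂ) ≠ 0 := by exact_mod_cast (cardAutPair_pos F').ne'
  push_cast
  field_simp

theorem exists_class (hΛ : Λ.IsUnimodular) {ι : Type*} {L : ι → EvenLattice.{u}}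
    (hL : IsClassRepresentatives Λ.rank L) {F : Submodule (ZMod 2) (ModTwo Λ)}
    (hF : IsMaximalIsotropic Λ.q F) :
    ∃ i, ∀ j, (∃ h : IsIsotropic Λ.q F, (Λ.perestroika F h).Iso (L j)) ↔ i = j := by
  obtain ⟨i, hi, hu⟩ := hL.2 (Λ.perestroika F hF.1)
    (isUnimodular_perestroika hΛ (isLagrangian_of_isMaximalIsotropic hΛ hF)) (rank_perestroika hF.1)
  refine ⟨i, fun j => ⟨fun ⟨_, h⟩ => (hu j h).symm, ?_⟩⟩
  rintro rfl
  exact ⟨hF.1, hi⟩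

/-- The sum over orbit representatives, arranged by isomorphism classes of perestroikas. -/
theorem finite_modifiedMass_and_sum (hΛ : Λ.IsUnimodular) {ι : Type*} {L : ι → EvenLattice.{u}}
    (hL : IsClassRepresentatives Λ.rank L) {R : Finset (Submodule (ZMod 2) (ModTwo Λ))}
    (hR : Λ.IsOrbitRepresentatives R) (ε : Submodule (ZMod 2) (ModTwo Λ) → ℤ) :
    {i | Λ.modifiedMass ε R (L i) ≠ 0}.Finite ∧ ∀ (n : ℕ) (Z : Matrix (Fin n) (Fin n) ℂ),
      ∑ᶠ i, (Λ.modifiedMass ε R (L i) : ℂ) * (L i).theta n Z =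
        ∑ F ∈ R, ε F * Λ.preimageTheta F n Z / Λ.cardAutPair F := by
  classical
  have hcls : ∀ F ∈ R, ∃ i, ∀ j,
      (∃ h : IsIsotropic Λ.q F, (Λ.perestroika F h).Iso (L j)) ↔ i = j :=
    fun F hF => exists_class hΛ hL (hR.1 F hF)
  rcases isEmpty_or_nonempty ι with hι | hι
  · have hR0 : R = ∅ := Finset.eq_empty_of_forall_notMem fun F hF => hι.elim (hcls F hF).choose
    exact ⟨Set.toFinite _, fun n Z => by simp [hR0, finsum_of_isEmpty]⟩
  choose! cls hcls using hcls
  have hmass : ∀ i, Λ.modifiedMass ε R (L i) =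
      ∑ F ∈ R with cls F = i, (ε F : ℚ) / (Λ.cardAutPair F : ℚ) := by
    intro i
    rw [modifiedMass]
    refine Finset.sum_congr (Finset.filter_congr fun F hF => hcls F hF i) fun _ _ => rfl
  have hsupp : ∀ i, Λ.modifiedMass ε R (L i) ≠ 0 → i ∈ R.image cls := by
    intro i hi
    rw [hmass] at hi
    obtain ⟨F, hF, -⟩ := Finset.exists_ne_zero_of_sum_ne_zero hi
    rw [Finset.mem_filter] at hF
    exact Finset.mem_image.mpr ⟨F, hF⟩
  refine ⟨(R.image cls).finite_toSet.subset hsupp, fun n Z => ?_⟩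
  -- Only classes of perestroikas at representatives can have nonzero mass, so the sum over all
  -- classes is a finite sum over this image.
  rw [finsum_eq_sum_of_support_subset (s := R.image cls) _ (fun i hi => hsupp i fun h => hi (by
      simp [h])), ← Finset.sum_fiberwise_of_maps_to (t := R.image cls) (g := cls)
      (fun F hF => Finset.mem_image_of_mem _ hF)]
  refine Finset.sum_congr rfl fun i _ => ?_
  rw [hmass, Rat.cast_sum, Finset.sum_mul]
  refine Finset.sum_congr rfl fun F hF => ?_
  rw [Finset.mem_filter] at hF
  obtain ⟨h, hiso⟩ := (hcls F hF.1 i).mpr hF.2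
  rw [← hiso.theta_eq, theta_perestroika]
  push_cast
  ring

theorem twistedTheta_eq_finsum (hΛ : Λ.IsUnimodular)
    (hdet : ∀ σ ∈ Λ.Aut, LinearMap.det (σ : Λ →ₗ[ℤ] Λ) = 1)
    {F₀ : Submodule (ZMod 2) (ModTwo Λ)} (hF₀ : IsMaximalIsotropic Λ.q F₀)
    {R : Finset (Submodule (ZMod 2) (ModTwo Λ))} (hR : Λ.IsOrbitRepresentatives R)
    {ι : Type*} {L : ι → EvenLattice.{u}} (hL : IsClassRepresentatives Λ.rank L) {n : ℕ}
    {Z : Matrix (Fin n) (Fin n) ℂ} (hZ : Z ∈ siegelUpperHalfSpace n) :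
    Λ.twistedTheta (dicksonSign Λ.q F₀) n Z = (Nat.card Λ.Aut : ℂ) *
      ∑ᶠ i, (Λ.modifiedMass (dicksonSign Λ.q F₀) R (L i) : ℂ) * (L i).theta n Z := by
  classical
  have := Fintype.ofFinite (Submodule (ZMod 2) (ModTwo Λ))
  rw [twistedTheta_eq_sum hΛ hF₀ hZ, (finite_modifiedMass_and_sum hΛ hL hR _).2 n Z,
    sum_eq_sum_orbitRepresentatives hΛ hR]
  · intro F hF
    rw [dicksonSign, if_neg hF, Int.cast_zero, zero_mul]
  · intro F hF σ hσ
    rw [dicksonSign_translate hΛ hF₀ hF hσ (hdet σ hσ), preimageTheta_translate hσ hF.1]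

/-! ### Modularity, vanishing and cuspidality -/

theorem isSiegelModularForm_twistedTheta (hΛ : Λ.IsUnimodular)
    {F₀ : Submodule (ZMod 2) (ModTwo Λ)} (hF₀ : IsMaximalIsotropic Λ.q F₀) (n : ℕ) :
    IsSiegelModularForm n (Λ.rank / 2) (Λ.twistedTheta (dicksonSign Λ.q F₀) n) := by
  have hf : Λ.twistedTheta (dicksonSign Λ.q F₀) n = fun Z => ∑' g : Fin n → Λ,
      (dicksonSign Λ.q F₀ (Λ.spanModTwo g) : ℂ) * cexp (((Real.pi / 2 : ℝ) : ℂ) * I *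
        ((Λ.gram g).map (Int.cast : ℤ → ℂ) * Z).trace) := by
    funext Z
    rw [twistedTheta]
    simp only [twistedThetaTerm, pi_mul_I_div_two]
  refine ⟨?_, ?_, ?_⟩
  · rw [hf]
    exact Λ.differentiableOn_tsum_cexp_trace (fun _ => norm_dicksonSign_le _ _) Real.pi_div_two_pos
  · intro M hM Z hZ
    -- The transformation law is inherited from the theta series of each Λ_F in the finite signed
    -- sum, all of the same weight.
    have := Fintype.ofFinite (Submodule (ZMod 2) (ModTwo Λ))
    rw [twistedTheta_eq_sum hΛ hF₀ hZ, twistedTheta_eq_sum hΛ hF₀ (siegelAction_mem hM hZ),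
      Finset.mul_sum]
    refine Finset.sum_congr rfl fun F _ => ?_
    by_cases hF : IsMaximalIsotropic Λ.q F
    · have h := theta_transform
        (isUnimodular_perestroika hΛ (isLagrangian_of_isMaximalIsotropic hΛ hF)) hM hZ
      rw [theta_perestroika, theta_perestroika, rank_perestroika] at h
      rw [h]
      ring
    · rw [dicksonSign, if_neg hF]
      simp
  · intro Y₀ hY₀
    rw [hf]
    exact Λ.exists_norm_tsum_cexp_trace_le (fun _ => norm_dicksonSign_le _ _) Real.pi_div_two_pos
      hY₀

/-- Maximal isotropic subspaces have dimension exactly m/2. -/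
theorem dicksonSign_eq_zero_of_finrank_lt (hΛ : Λ.IsUnimodular)
    (F₀ : Submodule (ZMod 2) (ModTwo Λ)) {F : Submodule (ZMod 2) (ModTwo Λ)}
    (h : Module.finrank (ZMod 2) F < Λ.rank / 2) : dicksonSign Λ.q F₀ F = 0 := by
  rw [dicksonSign, if_neg]
  intro hF
  have h1 := (isLagrangian_of_isMaximalIsotropic hΛ hF).two_mul_finrank (q_nondegenerate hΛ)
  rw [finrank_modTwo] at h1
  omega

theorem twistedTheta_eq_zero (hΛ : Λ.IsUnimodular) (F₀ : Submodule (ZMod 2) (ModTwo Λ)) {n : ℕ}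
    (hn : n < Λ.rank / 2) (Z : Matrix (Fin n) (Fin n) ℂ) :
    Λ.twistedTheta (dicksonSign Λ.q F₀) n Z = 0 := by
  rw [twistedTheta, ← tsum_zero (β := Fin n → Λ)]
  refine tsum_congr fun g => ?_
  rw [twistedThetaTerm, dicksonSign_eq_zero_of_finrank_lt hΛ, Int.cast_zero, zero_mul]
  refine (finrank_range_le_card _).trans_lt ?_
  rwa [Fintype.card_fin]

/-- If the last vector were zero, the span would be generated by n < m/2 vectors, too few for a
maximal isotropic subspace. -/
theorem last_ne_zero_of_dicksonSign_ne_zero (hΛ : Λ.IsUnimodular)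
    {F₀ : Submodule (ZMod 2) (ModTwo Λ)} {n : ℕ} (hn : n < Λ.rank / 2) {g : Fin (n + 1) → Λ}
    (hg : dicksonSign Λ.q F₀ (Λ.spanModTwo g) ≠ 0) : g (Fin.last n) ≠ 0 := by
  intro h0
  refine hg (dicksonSign_eq_zero_of_finrank_lt hΛ _ (lt_of_le_of_lt ?_ hn))
  have hle : Λ.spanModTwo g ≤ Λ.spanModTwo (fun i : Fin n => g i.castSucc) := by
    rw [spanModTwo, Submodule.span_le, Set.range_subset_iff]
    intro i
    refine Fin.lastCases ?_ (fun j => ?_) i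
    · rw [h0, map_zero]
      exact Submodule.zero_mem _
    · exact Submodule.subset_span ⟨j, rfl⟩
  refine (Submodule.finrank_mono hle).trans ((finrank_range_le_card _).trans_eq ?_)
  rw [Fintype.card_fin]

theorem trace_gram_mul_siegelExtend {n : ℕ} (g : Fin (n + 1) → Λ) (Z : Matrix (Fin n) (Fin n) ℂ)
    (t : ℝ) : ((Λ.gram g).map (Int.cast : ℤ → ℂ) * siegelExtend Z t).trace =
      ((Λ.gram fun i : Fin n => g i.castSucc).map (Int.cast : ℤ → ℂ) * Z).trace +
        I * t * Λ.form (g (Fin.last n)) (g (Fin.last n)) := by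
  have e1 : ∀ i : Fin n, finSumFinEquiv.symm (Fin.castSucc i) = (Sum.inl i : Fin n ⊕ Fin 1) :=
    fun i => finSumFinEquiv_symm_apply_castAdd i
  have e2 : finSumFinEquiv.symm (Fin.last n) = (Sum.inr 0 : Fin n ⊕ Fin 1) :=
    finSumFinEquiv_symm_apply_natAdd 0
  rw [trace_gram_mul, trace_gram_mul, Fin.sum_univ_castSucc]
  simp only [Fin.sum_univ_castSucc, siegelExtend, Matrix.reindex_apply, Matrix.submatrix_apply, e1,
    e2, Matrix.fromBlocks_apply₁₁, Matrix.fromBlocks_apply₁₂, Matrix.fromBlocks_apply₂₁,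
    Matrix.fromBlocks_apply₂₂, Matrix.zero_apply, mul_zero, add_zero, Matrix.of_apply,
    Finset.sum_const_zero, zero_add]
  ring

/-- Dominated convergence, with the absolute terms for t = 1 and sign 1 as majorant: a term with
nonzero sign has a nonzero last vector, so it decays exponentially in t, and all other terms are
zero. -/
theorem tendsto_twistedTheta_siegelExtend (hΛ : Λ.IsUnimodular)
    (F₀ : Submodule (ZMod 2) (ModTwo Λ)) {n : ℕ} (hn : n < Λ.rank / 2)
    {Z : Matrix (Fin n) (Fin n) ℂ} (hZ : Z ∈ siegelUpperHalfSpace n) :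
    Filter.Tendsto (fun t : ℝ => Λ.twistedTheta (dicksonSign Λ.q F₀) (n + 1) (siegelExtend Z t))
      Filter.atTop (nhds 0) := by
  have hterm : ∀ (t : ℝ) (g : Fin (n + 1) → Λ),
      ‖Λ.twistedThetaTerm (dicksonSign Λ.q F₀) (siegelExtend Z t) g‖ =
      ‖(dicksonSign Λ.q F₀ (Λ.spanModTwo g) : ℂ)‖ *
        (Real.exp (-(Real.pi / 2 * Λ.energy (Z.map im) fun i : Fin n => g i.castSucc)) *
          Real.exp (-(Real.pi * (t / 2) * Λ.form (g (Fin.last n)) (g (Fin.last n))))) := by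
    intro t g
    rw [twistedThetaTerm, norm_mul, trace_gram_mul_siegelExtend, mul_add, Complex.exp_add,
      norm_mul, pi_mul_I_div_two, norm_cexp_trace]
    congr 2
    have := norm_cexp_form (I * (t / 2 : ℝ)) (g (Fin.last n))
    rw [show (I * (t / 2 : ℝ) : ℂ).im = t / 2 by simp] at this
    rw [← this]
    congr 2
    push_cast
    ring
  have hbound : Summable fun g : Fin (n + 1) → Λ =>
      Real.exp (-(Real.pi / 2 * Λ.energy (Z.map im) fun i : Fin n => g i.castSucc)) *
        Real.exp (-(Real.pi * (1 / 2) * Λ.form (g (Fin.last n)) (g (Fin.last n)))) := by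
    have h := (Λ.summable_exp_neg_energy hZ.2 Real.pi_div_two_pos).mul_of_nonneg
      (Λ.summable_exp_neg_form one_half_pos) (fun _ => (Real.exp_pos _).le)
      (fun _ => (Real.exp_pos _).le)
    refine (((Fin.snocEquiv fun _ : Fin (n + 1) => (Λ : Type u)).symm.trans
      (Equiv.prodComm _ _)).summable_iff.mpr h).congr fun g => ?_
    rfl
  rw [← tsum_zero (β := Fin (n + 1) → Λ)]
  refine tendsto_tsum_of_dominated_convergence hbound (fun g => ?_) ?_
  · by_cases hg : dicksonSign Λ.q F₀ (Λ.spanModTwo g) = 0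
    · simp only [twistedThetaTerm, hg, Int.cast_zero, zero_mul]
      exact tendsto_const_nhds
    · rw [tendsto_zero_iff_norm_tendsto_zero]
      simp only [hterm]
      have hpos : (0 : ℝ) < Λ.form (g (Fin.last n)) (g (Fin.last n)) := by
        exact_mod_cast Λ.pos _ (last_ne_zero_of_dicksonSign_ne_zero hΛ hn hg)
      have hlim : Filter.Tendsto (fun t : ℝ =>
          Real.exp (-(Real.pi * (t / 2) * Λ.form (g (Fin.last n)) (g (Fin.last n)))))
          Filter.atTop (nhds 0) := by
        refine Real.tendsto_exp_atBot.comp (Filter.tendsto_neg_atTop_atBot.comp ?_)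
        exact ((Filter.tendsto_id.atTop_div_const two_pos).const_mul_atTop
          Real.pi_pos).atTop_mul_const hpos
      simpa using (hlim.const_mul (Real.exp (-(Real.pi / 2 *
        Λ.energy (Z.map im) fun i : Fin n => g i.castSucc)))).const_mul
          ‖(dicksonSign Λ.q F₀ (Λ.spanModTwo g) : ℂ)‖
  · filter_upwards [Filter.eventually_ge_atTop 1] with t ht g
    rw [hterm]
    refine (mul_le_of_le_one_left (by positivity) (norm_dicksonSign_le _ _)).trans
      (mul_le_mul_of_nonneg_left ?_ (Real.exp_pos _).le)
    rw [Real.exp_le_exp, neg_le_neg_iff]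
    have hnn : (0 : ℝ) ≤ Λ.form (g (Fin.last n)) (g (Fin.last n)) := by
      by_cases hx : g (Fin.last n) = 0
      · simp [hx]
      · exact_mod_cast (Λ.pos _ hx).le
    exact mul_le_mul_of_nonneg_right (mul_le_mul_of_nonneg_left (by linarith) Real.pi_pos.le) hnn

theorem isSiegelCuspForm_twistedTheta (hΛ : Λ.IsUnimodular)
    {F₀ : Submodule (ZMod 2) (ModTwo Λ)} (hF₀ : IsMaximalIsotropic Λ.q F₀) :
    ∀ n, n = Λ.rank / 2 →
      IsSiegelCuspForm n (Λ.rank / 2) (Λ.twistedTheta (dicksonSign Λ.q F₀) n)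
  | 0, _ => ⟨isSiegelModularForm_twistedTheta hΛ hF₀ 0, trivial⟩
  | n + 1, hn => ⟨isSiegelModularForm_twistedTheta hΛ hF₀ (n + 1), fun _ hZ =>
      tendsto_twistedTheta_siegelExtend hΛ F₀ (by omega) hZ⟩

end EvenLattice

theorem theorem2 (Λ : EvenLattice.{u}) (hΛ : Λ.IsUnimodular)
    (hdet : ∀ σ ∈ Λ.Aut, LinearMap.det (σ : Λ →ₗ[ℤ] Λ) = 1)
    (F₀ : Submodule (ZMod 2) (ModTwo Λ)) (hF₀ : IsMaximalIsotropic Λ.q F₀)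
    (ε : Submodule (ZMod 2) (ModTwo Λ) → ℤ) (hε : ε = dicksonSign Λ.q F₀)
    (R : Finset (Submodule (ZMod 2) (ModTwo Λ))) (hR : Λ.IsOrbitRepresentatives R)
    {ι : Type*} (L : ι → EvenLattice.{u}) (hL : EvenLattice.IsClassRepresentatives Λ.rank L) :
    -- all the series converge absolutely, and only finitely many modified masses are nonzero
    (∀ n, ∀ Z ∈ siegelUpperHalfSpace n,
      Summable (Λ.twistedThetaTerm ε Z) ∧ ∀ i, Summable ((L i).thetaTerm Z)) ∧
    {i | Λ.modifiedMass ε R (L i) ≠ 0}.Finite ∧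
    -- the identity between the twisted theta series and the theta series of the `L i`
    (∀ n, ∀ Z ∈ siegelUpperHalfSpace n,
      Λ.twistedTheta ε n Z =
        (Nat.card Λ.Aut : ℂ) * ∑ᶠ i, (Λ.modifiedMass ε R (L i) : ℂ) * (L i).theta n Z) ∧
    -- modularity, vanishing and cuspidality
    (∀ n, IsSiegelModularForm n (Λ.rank / 2) (Λ.twistedTheta ε n)) ∧
    (∀ n, n < Λ.rank / 2 → ∀ Z ∈ siegelUpperHalfSpace n, Λ.twistedTheta ε n Z = 0) ∧
    IsSiegelCuspForm (Λ.rank / 2) (Λ.rank / 2) (Λ.twistedTheta ε (Λ.rank / 2)) := by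
  subst hε
  exact ⟨fun n Z hZ => ⟨EvenLattice.summable_twistedThetaTerm F₀ hZ,
      fun i => (L i).summable_thetaTerm hZ⟩,
    (EvenLattice.finite_modifiedMass_and_sum hΛ hL hR _).1,
    fun n Z hZ => EvenLattice.twistedTheta_eq_finsum hΛ hdet hF₀ hR hL hZ,
    EvenLattice.isSiegelModularForm_twistedTheta hΛ hF₀,
    fun n hn Z _ => EvenLattice.twistedTheta_eq_zero hΛ F₀ hn Z,
    EvenLattice.isSiegelCuspForm_twistedTheta hΛ hF₀ _ rfl⟩
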